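/- Let $m\ge 2$ and let $(W,S)$ be a Coxeter system of type $I_2(2m)$, $S=\{s_1,s_2\}$, where $s_1s_2$ has order $2m$; let $\ell$ be the length function and let $w\mapsto w^\diamond$ be the automorphism of $W$ with $s_1^\diamond=s_2$, $s_2^\diamond=s_1$. *Notation.* Let $\Phi$ be the root system of $W$ (all roots of the same length), with positive roots determined by $S$ and with the map $\alpha\mapsto\alpha^\diamond$ induced by the permutation of the two simple roots. Call $w,w'$ $\diamond$-conjugate if $w'=x^\diamond wx^{-1}$ for some $x\in W$, and call $w$ a $\diamond$-twisted involution if $w^\diamond=w^{-1}$. For such $w$ put $C_W^\diamond(w)=\{x\in W\mid x^\diamond w=wx\}$, $\Phi_w=\{\alpha\in\Phi\mid w(\alpha)=-\alpha^\diamond\}$, $\varepsilon_w(x)=(-1)^k$ for $x\in C_W^\diamond(w)$, where $k$ is the number of positive $\alpha\in\Phi_w$ with $x(\alpha)$ negative, and $\Upsilon_w^\diamond=\operatorname{Ind}_{C_W^\diamond(w)}^W(\varepsilon_w)$. Let $\mathbf H$ be the generic Iwahori–Hecke algebra of $(W,S)$ over $\mathbb Z[v,v^{-1}]$, with basis $T_w$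 and $T_sT_w=T_{sw}$ if $\ell(sw)>\ell(w)$, $T_sT_w=T_{sw}+(v-v^{-1})T_w$ otherwise. Let $\mathbf C_w=\sum_{y\le w}(-1)^{\ell(w)+\ell(y)}v^{\ell(w)-\ell(y)}P_{y,w}(v^{-2})\,T_y$ be its Kazhdan–Lusztig basis ($P_{y,w}(q)$ being the Kazhdan–Lusztig polynomials and $\le$ the Bruhat order), and write $\mathbf C_x\mathbf C_y=\sum_z h_{x,y,z}\mathbf C_z$. For a left cell $\Gamma$ (an equivalence class for the Kazhdan–Lusztig left preorder $\le_L$), $[\Gamma]_1$ denotes the character of the $\mathbb Q[W]$-module obtained, by $v\mapsto 1$, from the $\mathbf H$-module with basis $(e_x)_{x\in\Gamma}$ and action $\mathbf C_x.e_y=\sum_{z\in\Gamma}h_{x,y,z}e_z$. Write $1_k=s_1s_2s_1\cdots$ and $2_k=s_2s_1s_2\cdots$ ($k$ factors each). Let $\langle\ ,\ \rangle_W$ be the usual scalar product of class functions. Then the following hold. 1. $1_{2m}=2_{2m}$ is the longest element of $W$. Up to $\diamond$-conjugacy, $1$ is the only $\diamond$-twisted involution; let $C_1$ be its $\diamond$-conjugacy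 class. 2. $\operatorname{Irr}(W)=\{1,\varepsilon,\varepsilon_1,\varepsilon_2,\chi_1,\dots,\chi_{m-1}\}$ (with $m+3$ distinct elements), where $1$ is the trivial and $\varepsilon$ the sign character, $\varepsilon_1,\varepsilon_2$ are of degree $1$ with $\varepsilon_1(s_1)=\varepsilon_2(s_2)=1$ and $\varepsilon_1(s_2)=\varepsilon_2(s_1)=-1$, and $\chi_j$ is the unique irreducible character of degree $2$ with $\chi_j(1_2)=2\cos(\pi j/m)$. 3. $C_W^\diamond(1)=\{x\in W\mid x^\diamond=x\}=\{1,1_{2m}\}$, $\Phi_1=\varnothing$, the character $\varepsilon_w$ for $w=1$ is trivial, and $$\Upsilon_1^\diamond=\operatorname{Ind}_{C_W^\diamond(1)}^W(1)=\begin{cases}1+\varepsilon+\varepsilon_1+\varepsilon_2+\sum_{1\le j\le (m-2)/2}2\chi_{2j}& (m\text{ even}),\\ 1+\varepsilon+\sum_{1\le j\le (m-1)/2}2\chi_{2j}&(m\text{ odd}).\end{cases}$$ 4. $W$ has exactly four left cells: $\Gamma_0=\{1\}$, $\Gamma_1=\{1_1,2_2,1_3,\dots,1_{2m-1}\}$,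 $\Gamma_2=\{2_1,1_2,2_3,\dots,2_{2m-1}\}$, $\Gamma_{2m}=\{1_{2m}\}$. We have $|C_1\cap\Gamma_i|=1$ for $i\in\{0,2m\}$ and $|C_1\cap\Gamma_i|=m-1$ for $i\in\{1,2\}$. 5. $[\Gamma_0]_1=1$, $[\Gamma_1]_1=\varepsilon_2+\sum_{1\le j\le m-1}\chi_j$, $[\Gamma_2]_1=\varepsilon_1+\sum_{1\le j\le m-1}\chi_j$, $[\Gamma_{2m}]_1=\varepsilon$. 6. $\langle\Upsilon_1^\diamond,[\Gamma_i]_1\rangle_W=1$ for $i\in\{0,2m\}$ and $=m-1$ for $i\in\{1,2\}$. Hence Kottwitz' conjecture holds for $(W,\diamond)$: for every $\diamond$-twisted involution $w$ with $\diamond$-conjugacy class $C$ and every left cell $\Gamma$ of $W$, $\langle\Upsilon_w^\diamond,[\Gamma]_1\rangle_W=|C\cap\Gamma|$. -/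

import Mathlib

namespace TwistedInv

noncomputable section

/-- The set of irreducible complex characters of `G`. -/
def irrChars (G : Type*) [Group G] : Set (G → ℂ) :=
  {χ | ∃ (n : ℕ) (ρ : Representation ℂ G (Fin n → ℂ)), ρ.IsIrreducible ∧ χ = ρ.character}

/-- The scalar product `⟨φ, ψ⟩ = |G|⁻¹ ∑ φ(g) conj(ψ(g))` of class functions. -/
def classInner {G : Type*} [Group G] [Fintype G] (φ ψ : G → ℂ) : ℂ :=
  (Fintype.card G : ℂ)⁻¹ * ∑ g, φ g * (starRingEnd ℂ) (ψ g)

open scoped Classical in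
/-- The induced class function `Ind_H^G(ψ)(g) = |H|⁻¹ ∑_{x ∈ G, x⁻¹gx ∈ H} ψ(x⁻¹gx)`. -/
def induced {G : Type*} [Group G] [Fintype G] (H : Subgroup G) (ψ : H → ℂ) : G → ℂ :=
  fun g => (Nat.card H : ℂ)⁻¹ *
    ∑ x : G, if h : x⁻¹ * g * x ∈ H then ψ ⟨x⁻¹ * g * x, h⟩ else 0

/-! ### Roots: the geometric representation on the space with basis the simple roots -/

section Roots

variable {B : Type*} (M : CoxeterMatrix B)

/-- The linear form `2 (α_i, ·)`, where `(α_i, α_j) = -cos (π / M i j)`. (An entry `M i j = 0`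
stands for `∞`, and then the value is `-1`, as it should be.) -/
def simpleCoroot (i : B) : Module.Dual ℝ (B →₀ ℝ) :=
  Finsupp.linearCombination ℝ (fun j => -2 * Real.cos (Real.pi / (M i j : ℝ)))

/-- The simple root `α_i`. -/
def simpleRoot (i : B) : B →₀ ℝ := Finsupp.single i 1

theorem simpleCoroot_simpleRoot (i j : B) :
    simpleCoroot M i (simpleRoot j) = -2 * Real.cos (Real.pi / (M i j : ℝ)) := by
  simp [simpleCoroot, simpleRoot]

theorem simpleCoroot_self (i : B) : simpleCoroot M i (simpleRoot i) = 2 := by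
  rw [simpleCoroot_simpleRoot]; simp

/-- The reflection `v ↦ v - 2 (α_i, v) α_i`. -/
def simpleReflection (i : B) : (B →₀ ℝ) ≃ₗ[ℝ] (B →₀ ℝ) :=
  Module.reflection (simpleCoroot_self M i)

theorem simpleReflection_liftable :
    M.IsLiftable (fun i => simpleReflection M i) := by
  intro i i'
  by_cases hii : i = i'
  · subst hii
    rw [M.diagonal, pow_one]
    exact LinearEquiv.ext (Module.involutive_reflection (simpleCoroot_self M i))
  have hm1 : M i i' ≠ 1 := M.off_diagonal i i' hii
  have hfy := simpleCoroot_simpleRoot M i i'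
  have hgx := simpleCoroot_simpleRoot M i' i
  rw [M.symmetric i' i] at hgx
  generalize M i i' = m at hfy hgx hm1
  rcases Nat.eq_zero_or_pos m with rfl | hpos
  · simp
  refine LinearEquiv.ext fun z => ?_
  unfold simpleReflection
  rw [Module.reflection_mul_reflection_pow_apply _ _ m z
    (2 * Real.cos (2 * (Real.pi / m))) (by rw [hfy, hgx, Real.cos_two_mul]; ring)]
  have hS := fun n : ℤ => Polynomial.Chebyshev.S_two_mul_real_cos (2 * (Real.pi / (m : ℝ))) n
  rcases Nat.lt_or_ge m 3 with h3 | h3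
  · obtain rfl : m = 2 := by omega
    have hc : Real.cos (Real.pi / ((2 : ℕ) : ℝ)) = 0 := by
      rw [Nat.cast_ofNat]; exact Real.cos_pi_div_two
    have ht : 2 * Real.cos (2 * (Real.pi / ((2 : ℕ) : ℝ))) = -2 := by
      rw [Real.cos_two_mul, hc]; norm_num
    rw [hc, mul_zero] at hfy hgx
    rw [ht, hfy, hgx]
    norm_num
    module
  have hmR : (3 : ℝ) ≤ m := by exact_mod_cast h3
  have hm0 : (m : ℝ) ≠ 0 := by positivity
  have hsin : Real.sin (2 * (Real.pi / (m : ℝ))) ≠ 0 := by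
    refine (Real.sin_pos_of_pos_of_lt_pi (by positivity) ?_).ne'
    rw [← mul_div_assoc, div_lt_iff₀ (by positivity)]
    nlinarith [Real.pi_pos]
  rcases Nat.even_or_odd' m with ⟨k, hk | hk⟩
  · have h0 : (Polynomial.Chebyshev.S ℝ ((k : ℤ) - 1)).eval
        (2 * Real.cos (2 * (Real.pi / (m : ℝ)))) = 0 := by
      have h := hS ((k : ℤ) - 1)
      have he : (((k : ℤ) - 1 : ℤ) + 1 : ℝ) * (2 * (Real.pi / (m : ℝ))) = Real.pi := by
        rw [hk] at hm0 ⊢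
        push_cast at hm0 ⊢
        have hk0 : (k : ℝ) ≠ 0 := fun h => hm0 (by rw [h, mul_zero])
        field_simp
        ring
      rw [he, Real.sin_pi] at h
      exact (mul_eq_zero.mp h).resolve_right hsin
    have e1 : ((m : ℤ) - 2) / 2 = (k : ℤ) - 1 := by omega
    have e2 : ((m : ℤ) - 1) / 2 = (k : ℤ) - 1 := by omega
    rw [e1, e2, h0]
    simp
  · have h0 : (Polynomial.Chebyshev.S ℝ (k : ℤ)).eval (2 * Real.cos (2 * (Real.pi / (m : ℝ)))) +
        (Polynomial.Chebyshev.S ℝ ((k : ℤ) - 1)).eval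
          (2 * Real.cos (2 * (Real.pi / (m : ℝ)))) = 0 := by
      have ha := hS (k : ℤ)
      have hb := hS ((k : ℤ) - 1)
      have he : ((k : ℤ) + 1 : ℝ) * (2 * (Real.pi / (m : ℝ))) =
          2 * Real.pi - (((k : ℤ) - 1 : ℤ) + 1 : ℝ) * (2 * (Real.pi / (m : ℝ))) := by
        rw [hk] at hm0 ⊢
        push_cast at hm0 ⊢
        field_simp
        ring
      rw [he, Real.sin_two_pi_sub, ← hb] at ha
      refine (mul_eq_zero.mp ?_).resolve_right hsin
      rw [add_mul, ha, neg_add_cancel]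
    have e1 : ((m : ℤ) - 2) / 2 = (k : ℤ) - 1 := by omega
    have e2 : ((m : ℤ) - 1) / 2 = (k : ℤ) := by omega
    have e3 : ((m : ℤ) - 3) / 2 = (k : ℤ) - 1 := by omega
    have e4 : (m : ℤ) / 2 = (k : ℤ) := by omega
    rw [e1, e2, e3, e4, h0]
    simp

variable {M} {W : Type*} [Group W] (cs : CoxeterSystem M W)

/-- The geometric representation of a Coxeter group. -/
def geomRep : W →* ((B →₀ ℝ) ≃ₗ[ℝ] (B →₀ ℝ)) :=
  cs.lift ⟨simpleReflection M, simpleReflection_liftable M⟩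

/-- The root system `Φ`: all `w(α_i)`. -/
def roots : Set (B →₀ ℝ) := {α | ∃ (w : W) (i : B), α = geomRep cs w (simpleRoot i)}

/-- The positive roots: the roots with nonnegative coordinates in the simple roots. -/
def posRoots : Set (B →₀ ℝ) := {α ∈ roots cs | ∀ i, 0 ≤ α i}

/-- The negative roots. -/
def negRoots : Set (B →₀ ℝ) := {α ∈ roots cs | ∀ i, α i ≤ 0}

end Roots

/-! ### Twisted involutions and Kottwitz' characters -/

section Twisted

variable {B : Type*} {M : CoxeterMatrix B} {W : Type*} [Group W]

/-- An automorphism `w ↦ w^⋄` of `W` with `(w^⋄)^⋄ = w` that permutes the simple reflections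
according to a symmetry `perm` of the Coxeter diagram. -/
structure Diamond (cs : CoxeterSystem M W) where
  toMulEquiv : W ≃* W
  perm : Equiv.Perm B
  map_simple : ∀ i, toMulEquiv (cs.simple i) = cs.simple (perm i)
  matrix_perm : ∀ i j, M (perm i) (perm j) = M i j
  involutive : ∀ w, toMulEquiv (toMulEquiv w) = w

variable {cs : CoxeterSystem M W} (d : Diamond cs)

/-- The induced map `α ↦ α^⋄` on the space spanned by the roots; it permutes the simple roots. -/
def Diamond.onRoots : (B →₀ ℝ) ≃ₗ[ℝ] (B →₀ ℝ) := Finsupp.domLCongr d.perm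

/-- The compatibility `w^⋄(α^⋄) = w(α)^⋄`. -/
theorem Diamond.geomRep_onRoots (w : W) (v : B →₀ ℝ) :
    geomRep cs (d.toMulEquiv w) (d.onRoots v) = d.onRoots (geomRep cs w v) := by
  have hroot (i : B) : d.onRoots (simpleRoot i) = simpleRoot (d.perm i) := by
    simp [Diamond.onRoots, simpleRoot]
  have hco (i : B) (v : B →₀ ℝ) :
      simpleCoroot M (d.perm i) (d.onRoots v) = simpleCoroot M i v := by
    have : (simpleCoroot M (d.perm i)).comp d.onRoots.toLinearMap = simpleCoroot M i := by
      refine Finsupp.lhom_ext' fun j => LinearMap.ext_ring ?_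
      change simpleCoroot M (d.perm i) (d.onRoots (simpleRoot j)) =
        simpleCoroot M i (simpleRoot j)
      rw [hroot, simpleCoroot_simpleRoot, simpleCoroot_simpleRoot, d.matrix_perm]
    exact LinearMap.congr_fun this v
  have hsimple (i : B) : geomRep cs (cs.simple i) = simpleReflection M i :=
    cs.lift_apply_simple (simpleReflection_liftable M) i
  induction w using cs.simple_induction_left generalizing v with
  | one => simp
  | mul_simple_left w i ih =>
    rw [map_mul, map_mul, map_mul, LinearEquiv.mul_apply, LinearEquiv.mul_apply, ih, d.map_simple,
      hsimple, hsimple]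
    simp only [simpleReflection, Module.reflection_apply]
    rw [map_sub, map_smul, hroot, hco]

/-- `w` is a `⋄`-twisted involution. -/
def Diamond.IsTwistedInvolution (w : W) : Prop := d.toMulEquiv w = w⁻¹

/-- `w` and `w'` are `⋄`-conjugate. -/
def Diamond.Conj (w w' : W) : Prop := ∃ x : W, w' = d.toMulEquiv x * w * x⁻¹

/-- The `⋄`-conjugacy class of `w`. -/
def Diamond.conjClass (w : W) : Set W := {w' | d.Conj w w'}

/-- The `⋄`-centraliser `{x | x^⋄ w = w x}`. -/
def Diamond.centralizer (w : W) : Subgroup W where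
  carrier := {x | d.toMulEquiv x * w = w * x}
  mul_mem' := by
    intro a b ha hb
    simp only [Set.mem_ofPred_eq, map_mul] at *
    rw [mul_assoc, hb, ← mul_assoc, ha, mul_assoc]
  one_mem' := by simp
  inv_mem' := by
    intro a ha
    simp only [Set.mem_ofPred_eq, map_inv] at *
    rw [inv_mul_eq_iff_eq_mul, ← mul_assoc, ha, mul_assoc, mul_inv_cancel, mul_one]

/-- `Φ_w`, the set of roots `α` with `w(α) = -α^⋄`. -/
def Diamond.twistedRoots (w : W) : Set (B →₀ ℝ) :=
  {α ∈ roots cs | geomRep cs w α = -d.onRoots α}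

/-- `ε_w(x) = (-1)^k`, with `k` the number of positive `α ∈ Φ_w` such that `x(α)` is negative. -/
def Diamond.sign (w : W) (x : d.centralizer w) : ℤ :=
  (-1) ^ Set.ncard {α | α ∈ posRoots cs ∧ α ∈ d.twistedRoots w ∧
    geomRep cs (x : W) α ∈ negRoots cs}

/-- Kottwitz' character `Υ_w^⋄`, induced from `ε_w`. -/
def Diamond.upsilon [Fintype W] (w : W) : W → ℂ :=
  induced (d.centralizer w) (fun x => (d.sign w x : ℂ))

end Twisted

/-! ### The Hecke algebra and the Kazhdan-Lusztig basis -/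

section Hecke

variable {B : Type*} {M : CoxeterMatrix B} {W : Type*} [Group W] (cs : CoxeterSystem M W)

/-- The ring `ℤ[v, v⁻¹]`. -/
abbrev LaurentRing : Type := LaurentPolynomial ℤ

/-- The power `v ^ n`. -/
def vpow (n : ℤ) : LaurentRing := LaurentPolynomial.T n

/-- The generic Hecke algebra, as the free module with basis `T_w = single w 1`; the product is
`heckeMul`. -/
abbrev HeckeModule (W : Type*) : Type _ := W →₀ LaurentRing

/-- The basis element `T_w`. -/
def stdElt (w : W) : HeckeModule W := Finsupp.single w 1

open scoped Classical in
/-- Left multiplication by `T_s`, `s = s_i`: `T_s T_w` is `T_{sw}` if `ℓ(sw) > ℓ(w)` and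
`T_{sw} + (v - v⁻¹) T_w` otherwise. -/
def leftMulSimple (i : B) : Module.End LaurentRing (HeckeModule W) :=
  Finsupp.linearCombination LaurentRing (fun w =>
    if cs.length w < cs.length (cs.simple i * w) then stdElt (cs.simple i * w)
    else stdElt (cs.simple i * w) + (vpow 1 - vpow (-1)) • stdElt w)

/-- Left multiplication by `T_s⁻¹ = T_s - (v - v⁻¹)`. -/
def leftMulSimpleInv (i : B) : Module.End LaurentRing (HeckeModule W) :=
  leftMulSimple cs i - (vpow 1 - vpow (-1)) • LinearMap.id

/-- A chosen reduced word of `w`. -/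
def redWord (w : W) : List B := Classical.choose (cs.exists_isReduced w)

/-- Left multiplication by `T_w = T_{s_1} ⋯ T_{s_k}`, where `w = s_1 ⋯ s_k` is reduced. -/
def leftMulStd (w : W) : Module.End LaurentRing (HeckeModule W) :=
  ((redWord cs w).map (leftMulSimple cs)).prod

/-- The multiplication of the Hecke algebra. -/
def heckeMul : HeckeModule W →ₗ[LaurentRing] HeckeModule W →ₗ[LaurentRing] HeckeModule W :=
  Finsupp.linearCombination LaurentRing (leftMulStd cs)

/-- The element `T_{w⁻¹}⁻¹ = T_{s_1}⁻¹ ⋯ T_{s_k}⁻¹`, where `w = s_1 ⋯ s_k` is reduced. -/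
def invStd (w : W) : HeckeModule W :=
  ((redWord cs w).map (leftMulSimpleInv cs)).prod (stdElt 1)

/-- The bar involution: `v ↦ v⁻¹`, `T_w ↦ T_{w⁻¹}⁻¹`. -/
def heckeBar (h : HeckeModule W) : HeckeModule W :=
  h.sum (fun w a => LaurentPolynomial.invert a • invStd cs w)

/-- The Bruhat-Chevalley order. -/
def bruhatLE (y w : W) : Prop :=
  Relation.ReflTransGen
    (fun a b => (∃ t, cs.IsReflection t ∧ b = a * t) ∧ cs.length a < cs.length b) y w

/-- The strict Bruhat-Chevalley order. -/
def bruhatLT (y w : W) : Prop := bruhatLE cs y w ∧ y ≠ w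

theorem bruhatLT_length {y w : W} (h : bruhatLT cs y w) : cs.length y < cs.length w := by
  obtain ⟨h, hne⟩ := h
  have : y = w ∨ cs.length y < cs.length w := by
    clear hne
    induction h with
    | refl => exact Or.inl rfl
    | tail _ h2 ih =>
      rcases ih with rfl | ih
      · exact Or.inr h2.2
      · exact Or.inr (ih.trans h2.2)
  exact this.resolve_left hne

/-- The element
`∑_y (-1)^{ℓ(w)+ℓ(y)} v^{ℓ(w)-ℓ(y)} P_y(q⁻¹) T_y`, `q = v²`, for a family of polynomials `P_y` in
the variable `q`. -/
def klSum [Fintype W] (w : W) (P : W → Polynomial ℤ) : HeckeModule W :=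
  ∑ y, ((-1) ^ (cs.length w + cs.length y) *
    vpow ((cs.length w : ℤ) - (cs.length y : ℤ)) *
      Polynomial.aeval (vpow (-2)) (P y)) • stdElt y

/-- The defining property of the family `y ↦ P_{y,w}` of Kazhdan-Lusztig polynomials:
`P_{w,w} = 1`, `P_{y,w} = 0` unless `y ≤ w`, `deg P_{y,w} ≤ (ℓ(w) - ℓ(y) - 1) / 2` for `y < w`,
and the corresponding element of the Hecke algebra is fixed by the bar involution. By Kazhdan and
Lusztig there is exactly one such family. -/
def IsKLFamily [Fintype W] (w : W) (P : W → Polynomial ℤ) : Prop :=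
  P w = 1 ∧ (∀ y, ¬ bruhatLE cs y w → P y = 0) ∧
  (∀ y, bruhatLT cs y w → 2 * (P y).natDegree + 1 + cs.length y ≤ cs.length w) ∧
  heckeBar cs (klSum cs w P) = klSum cs w P

open scoped Classical in
/-- The Kazhdan-Lusztig polynomial `P_{y,w}`. -/
def klPoly [Fintype W] (y w : W) : Polynomial ℤ :=
  if h : ∃ P, IsKLFamily cs w P then Classical.choose h y else if y = w then 1 else 0

/-- The Kazhdan-Lusztig basis element `C_w`. -/
def klElt [Fintype W] (w : W) : HeckeModule W := klSum cs w (fun y => klPoly cs y w)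

theorem klPoly_self [Fintype W] (w : W) : klPoly cs w w = 1 := by
  unfold klPoly
  split_ifs with h
  · exact (Classical.choose_spec h).1
  all_goals simp_all

theorem klPoly_eq_zero [Fintype W] {y w : W} (h : ¬ bruhatLE cs y w) : klPoly cs y w = 0 := by
  unfold klPoly
  split_ifs with h' h''
  · exact (Classical.choose_spec h').2.1 y h
  · exact absurd (h'' ▸ Relation.ReflTransGen.refl) h
  · rfl

theorem klElt_apply [Fintype W] (y w : W) : klElt cs w y =
    (-1) ^ (cs.length w + cs.length y) * vpow ((cs.length w : ℤ) - (cs.length y : ℤ)) *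
      Polynomial.aeval (vpow (-2)) (klPoly cs y w) := by
  classical
  simp only [klElt, klSum, stdElt, Finsupp.coe_finsetSum, Finset.sum_apply, Finsupp.smul_apply,
    Finsupp.single_apply, smul_eq_mul, mul_ite, mul_one, mul_zero]
  rw [Finset.sum_ite_eq' Finset.univ y]
  simp

/-- The elements `C_w` form a basis, by unitriangularity. -/
theorem klElt_isBasis [Fintype W] : LinearIndependent LaurentRing (klElt cs) ∧
    Submodule.span LaurentRing (Set.range (klElt cs)) = ⊤ := by
  classical
  rw [Module.Basis.is_basis_iff_det Finsupp.basisSingleOne, Module.Basis.det_apply]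
  have hent (y w : W) :
      (Finsupp.basisSingleOne (R := LaurentRing)).toMatrix (klElt cs) y w = klElt cs w y := by
    simp [Module.Basis.toMatrix_apply]
  have hzero (y w : W) (h : klElt cs w y ≠ 0) : y = w ∨ cs.length y < cs.length w := by
    by_contra! hc
    refine h ?_
    rw [klElt_apply, klPoly_eq_zero, map_zero, mul_zero]
    exact fun hb => absurd (bruhatLT_length cs ⟨hb, hc.1⟩) (not_lt.mpr hc.2)
  have htri : Matrix.BlockTriangular
      ((Finsupp.basisSingleOne (R := LaurentRing)).toMatrix (klElt cs)) cs.length := by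
    intro y w hlt
    rw [hent]
    by_contra h
    rcases hzero y w h with rfl | h
    · exact lt_irrefl _ hlt
    · exact lt_asymm h hlt
  rw [htri.det]
  have hblock (a : ℕ) : Matrix.toSquareBlock
      ((Finsupp.basisSingleOne (R := LaurentRing)).toMatrix (klElt cs)) cs.length a = 1 := by
    refine Matrix.ext fun ⟨y, hy⟩ ⟨w, hw⟩ => ?_
    change (Finsupp.basisSingleOne (R := LaurentRing)).toMatrix (klElt cs) y w = _
    rw [hent]
    by_cases h : y = w
    · subst h
      rw [Matrix.one_apply_eq, klElt_apply, klPoly_self]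
      simp [vpow, ← two_mul]
    · rw [Matrix.one_apply_ne (by simpa using h)]
      by_contra h0
      rcases hzero y w h0 with h1 | h1
      · exact h h1
      · rw [hy, hw] at h1
        exact lt_irrefl _ h1
  simp [hblock]

/-- The Kazhdan-Lusztig basis `(C_w)`. -/
def klBasis [Fintype W] : Module.Basis W LaurentRing (HeckeModule W) :=
  Module.Basis.mk (klElt_isBasis cs).1 (klElt_isBasis cs).2.ge

/-- The structure constants `h_{x,y,z}`, given by `C_x C_y = ∑_z h_{x,y,z} C_z`. -/
def klStructure [Fintype W] (x y z : W) : LaurentRing :=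
  (klBasis cs).repr (heckeMul cs (klElt cs x) (klElt cs y)) z

/-! ### Left cells and their characters -/

/-- `y ≺ w`: `y < w` and `deg P_{y,w}` has the maximal possible value `(ℓ(w) - ℓ(y) - 1) / 2`. -/
def klPrec [Fintype W] (y w : W) : Prop :=
  bruhatLT cs y w ∧ 2 * (klPoly cs y w).natDegree + 1 + cs.length y = cs.length w

/-- An elementary step of the left preorder: `y` and `w` are joined by an edge of the `W`-graph and
the left descent set of `y` is not contained in that of `w`. -/
def leftStep [Fintype W] (y w : W) : Prop :=
  (klPrec cs y w ∨ klPrec cs w y) ∧ ∃ i, cs.IsLeftDescent y i ∧ ¬ cs.IsLeftDescent w i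

/-- The Kazhdan-Lusztig left preorder `y ≤_L w`. -/
def leftLE [Fintype W] (y w : W) : Prop := Relation.ReflTransGen (leftStep cs) y w

/-- The equivalence relation `y ∼_L w`. -/
def leftEquiv [Fintype W] (y w : W) : Prop := leftLE cs y w ∧ leftLE cs w y

/-- `Γ` is a left cell of `W`. -/
def IsLeftCell [Fintype W] (Γ : Set W) : Prop := ∃ w, Γ = {y | leftEquiv cs y w}

open scoped Classical in
/-- The action of the Hecke algebra on the free module `[Γ]_A` with basis `(e_x)_{x ∈ Γ}`, given by
`C_x e_y = ∑_{z ∈ Γ} h_{x,y,z} e_z`. -/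
def cellAction [Fintype W] (Γ : Set W) :
    HeckeModule W →ₗ[LaurentRing] Module.End LaurentRing (Γ →₀ LaurentRing) :=
  (klBasis cs).constr LaurentRing (fun x =>
    Finsupp.linearCombination LaurentRing (fun y : Γ =>
      ∑ z : Γ, klStructure cs x y z • Finsupp.single z 1))

/-- The specialisation `ℤ[v, v⁻¹] → ℚ`, `v ↦ 1`. -/
def specOne : LaurentRing →+* ℚ := LaurentPolynomial.eval₂ (Int.castRingHom ℚ) 1

open scoped Classical in
/-- The matrix of `w ∈ W` acting on the `ℚ[W]`-module `[Γ]_1`, that is, of `T_w` acting on `[Γ]_A`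
with `v` specialised to `1`. -/
def cellMatrix [Fintype W] (Γ : Set W) (w : W) : Matrix Γ Γ ℚ :=
  (LinearMap.toMatrix Finsupp.basisSingleOne Finsupp.basisSingleOne
    (cellAction cs Γ (stdElt w))).map specOne

open scoped Classical in
/-- The character of `[Γ]_1`. -/
def cellChar [Fintype W] (Γ : Set W) : W → ℂ := fun w => ((cellMatrix cs Γ w).trace : ℂ)

/-- Kottwitz' conjecture for `(W, ⋄)`: `⟨Υ_w^⋄, [Γ]_1⟩ = |C ∩ Γ|` for every `⋄`-twisted
involution `w` with `⋄`-conjugacy class `C` and every left cell `Γ`. -/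
def KottwitzConjecture [Fintype W] (d : Diamond cs) : Prop :=
  ∀ w, d.IsTwistedInvolution w → ∀ Γ, IsLeftCell cs Γ →
    classInner (d.upsilon w) (cellChar cs Γ) = ((d.conjClass w ∩ Γ).ncard : ℂ)

end Hecke

/-! ### Dihedral groups -/

section Dihedral

variable {M : CoxeterMatrix (Fin 2)} {W : Type*} [Group W] (cs : CoxeterSystem M W)

/-- The alternating product `s_i s_j s_i ⋯` with `k` factors. -/
def altProd (i j : Fin 2) : ℕ → W
  | 0 => 1
  | k + 1 => cs.simple i * altProd j i k

/-- The product `1_k = s_1 s_2 s_1 ⋯` with `k` factors. -/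
def word1 (k : ℕ) : W := altProd cs 0 1 k

/-- The product `2_k = s_2 s_1 s_2 ⋯` with `k` factors. -/
def word2 (k : ℕ) : W := altProd cs 1 0 k

/-- `{1_1, 2_2, 1_3, …, 1_{2m-1}}`. -/
def cell1 (m : ℕ) : Set W :=
  {x | ∃ k, 1 ≤ k ∧ k ≤ 2 * m - 1 ∧ x = if Odd k then word1 cs k else word2 cs k}

/-- `{2_1, 1_2, 2_3, …, 2_{2m-1}}`. -/
def cell2 (m : ℕ) : Set W :=
  {x | ∃ k, 1 ≤ k ∧ k ≤ 2 * m - 1 ∧ x = if Odd k then word2 cs k else word1 cs k}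

end Dihedral

end

end TwistedInv

/-! Everything is computed in one coordinate. Let `walk k`, for an integer `k`, be the `k`-th vertex
of the Cayley graph, which is a cycle of length `4m`. Then `walk a * walk b` is `walk (a + b)` for
even `a` and `walk (a - b)` for odd `a`, two indices give the same element iff they agree modulo
`4m`, the length of `walk k` is `|k|` for `|k| ≤ 2m`, and `⋄` is `k ↦ -k`. Hence `x^⋄ x⁻¹` is `walk
(-2a)` for `x = walk a`: the class of `1` consists of all rotations, no reflection is a twisted
involution, and each centraliser is `{1, w₀}` with `w₀ = walk (2m)` central. The coordinates of a
root are `sin(aθ)/sin θ` and `sin(bθ)/sin θ` with `θ = π/2m` and `a`, `b` adjacent integers; being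
opposite would force the odd number `a + b` to be a multiple of `4m`, so `Φ_1` is empty, and then so
is `Φ_w` for every `w` in the class. Thus `Υ` is `2m` on `{1, w₀}` and `0` elsewhere
(`Diamond.upsilon_apply`), and its scalar product with a real-valued `φ` is `(φ(1) + φ(w₀))/2`.

On the Hecke side all Kazhdan-Lusztig polynomials `P_{y,w}` with `y ≤ w` are `1`, because there are
just two elements of each length strictly between `0` and `2m`. The candidate for `C_w` is `ballElt
w`. The action of `T_s` on the candidates is computed directly, which gives `T_{w⁻¹}⁻¹ = barElt w`,
a combination of the `ballElt y`; bar invariance of `ballElt w` follows (`heckeBar_ballElt`), and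
uniqueness (`IsKLFamily.unique`) identifies it with `C_w`. Only operators of left multiplication are
used, so neither associativity of the product nor multiplicativity of the bar map is needed.

The `W`-graph then has an edge exactly between lengths differing by one, and the two large left
cells collect the elements with a given last letter `s_i` (`isLeftCell_iff`). At `v = 1` the
elements `C_y` with `y s_i < y` span the left ideal generated by `1 - s_i`. Adjoining `w₀` to the
cell therefore turns its character into the character induced from the sign of `⟨s_i⟩`, so the cell
character is that induced character minus `ε` (`cellChar_endCell_eq_sum`, `sum_cellTerm_endProd`).
Its values at `1` and `w₀` are `2m - 1` and `-1`, with average `m - 1`, which is also the number of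
rotations in the cell. The decompositions into irreducibles are identities between values, which
reduce to sums of powers of roots of unity. -/

namespace TwistedInv

noncomputable section

/-! ### The dihedral group as a walk on a cycle -/

section Walk

variable {M : CoxeterMatrix (Fin 2)} {W : Type*} [Group W] (cs : CoxeterSystem M W)

/-- The walk `…, s_j s_i, s_j, 1, s_i, s_i s_j, …` through the Cayley graph of a group with two
simple reflections. -/
def walk (i j : Fin 2) (k : ℤ) : W :=
  if Even k then (cs.simple i * cs.simple j) ^ (k / 2)
  else (cs.simple i * cs.simple j) ^ (k / 2) * cs.simple i

variable (i j : Fin 2)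

theorem walk_two_mul (a : ℤ) : walk cs i j (2 * a) = (cs.simple i * cs.simple j) ^ a := by
  simp [walk]

theorem walk_two_mul_add_one (a : ℤ) :
    walk cs i j (2 * a + 1) = (cs.simple i * cs.simple j) ^ a * cs.simple i := by
  have h : (2 * a + 1) / 2 = a := by omega
  rw [walk, if_neg (by simp), h]

@[simp] theorem walk_zero : walk cs i j 0 = 1 := by
  simpa using walk_two_mul cs i j 0

@[simp] theorem walk_one : walk cs i j 1 = cs.simple i := by
  simpa using walk_two_mul_add_one cs i j 0

@[simp] theorem walk_neg_one : walk cs i j (-1) = cs.simple j := by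
  simpa using walk_two_mul_add_one cs i j (-1)

theorem simple_mul_zpow (a : ℤ) :
    cs.simple i * (cs.simple i * cs.simple j) ^ a =
      (cs.simple i * cs.simple j) ^ (-a) * cs.simple i := by
  have h : SemiconjBy (cs.simple i) (cs.simple i * cs.simple j) (cs.simple i * cs.simple j)⁻¹ := by
    simp [SemiconjBy, mul_assoc]
  rw [zpow_neg, ← inv_zpow]
  exact (h.zpow_right a).eq

/-- Left multiplication by a rotation translates the index; by a reflection (next lemma) it reverses
the line. These two rules replace all manipulation of words. -/
theorem walk_mul_of_even {a : ℤ} (ha : Even a) (b : ℤ) :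
    walk cs i j a * walk cs i j b = walk cs i j (a + b) := by
  obtain ⟨a, rfl⟩ := ha.exists_two_nsmul
  rw [nsmul_eq_mul, Nat.cast_ofNat]
  rcases Int.even_or_odd' b with ⟨b, rfl | rfl⟩
  · rw [← mul_add, walk_two_mul, walk_two_mul, walk_two_mul, zpow_add]
  · rw [← add_assoc, ← mul_add, walk_two_mul, walk_two_mul_add_one, walk_two_mul_add_one, zpow_add,
      mul_assoc]

theorem walk_mul_of_odd {a : ℤ} (ha : Odd a) (b : ℤ) :
    walk cs i j a * walk cs i j b = walk cs i j (a - b) := by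
  obtain ⟨a, rfl⟩ := ha
  rcases Int.even_or_odd' b with ⟨b, rfl | rfl⟩
  · rw [show 2 * a + 1 - 2 * b = 2 * (a - b) + 1 by ring, walk_two_mul, walk_two_mul_add_one,
      walk_two_mul_add_one, mul_assoc, simple_mul_zpow, ← mul_assoc, ← zpow_add, sub_eq_add_neg]
  · rw [show 2 * a + 1 - (2 * b + 1) = 2 * (a - b) by ring, walk_two_mul, walk_two_mul_add_one,
      walk_two_mul_add_one, mul_assoc, ← mul_assoc (cs.simple i), simple_mul_zpow, mul_assoc,
      cs.simple_mul_simple_self, mul_one, ← zpow_add, sub_eq_add_neg]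

theorem walk_inv_of_even {a : ℤ} (ha : Even a) : (walk cs i j a)⁻¹ = walk cs i j (-a) := by
  rw [inv_eq_iff_mul_eq_one, walk_mul_of_even cs i j ha, add_neg_cancel, walk_zero]

theorem walk_inv_of_odd {a : ℤ} (ha : Odd a) : (walk cs i j a)⁻¹ = walk cs i j a := by
  rw [inv_eq_iff_mul_eq_one, walk_mul_of_odd cs i j ha, sub_self, walk_zero]

theorem simple_mul_walk (k : ℤ) : cs.simple i * walk cs i j k = walk cs i j (1 - k) := by
  rw [← walk_mul_of_odd cs i j odd_one, walk_one]

theorem simple_mul_walk' (k : ℤ) : cs.simple j * walk cs i j k = walk cs i j (-1 - k) := by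
  rw [← walk_mul_of_odd cs i j (by decide), walk_neg_one]

/-- The rotation `s_j s_i` is inverse to `s_i s_j`, so exchanging the generators reverses the walk.
This transfers statements between the two generators. -/
theorem walk_swap (k : ℤ) : walk cs j i k = walk cs i j (-k) := by
  have h (a : ℤ) : (cs.simple j * cs.simple i) ^ a = (cs.simple i * cs.simple j) ^ (-a) := by
    rw [zpow_neg, ← inv_zpow]; simp
  rcases Int.even_or_odd' k with ⟨a, rfl | rfl⟩
  · rw [walk_two_mul, h, ← mul_neg, walk_two_mul]
  · rw [show -(2 * a + 1) = 2 * (-a - 1) + 1 by ring, walk_two_mul_add_one, walk_two_mul_add_one, h,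
      zpow_sub, zpow_one, mul_inv_rev, cs.inv_simple, cs.inv_simple, mul_assoc, mul_assoc,
      cs.simple_mul_simple_self, mul_one]

theorem altProd_eq_walk (k : ℕ) : altProd cs i j k = walk cs i j k := by
  induction k generalizing i j with
  | zero => simp [altProd]
  | succ k ih =>
    rw [altProd, ih, walk_swap, simple_mul_walk]
    congr 1
    push_cast; ring

variable {i j} (hij : i ≠ j)
include hij

theorem eq_or_eq_of_ne (b : Fin 2) : b = i ∨ b = j := by omega

theorem walk_surjective (w : W) : ∃ k, walk cs i j k = w := by
  induction w using cs.simple_induction_left with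
  | one => exact ⟨0, walk_zero cs i j⟩
  | mul_simple_left w b ih =>
    obtain ⟨k, rfl⟩ := ih
    rcases eq_or_eq_of_ne hij b with rfl | rfl
    · exact ⟨_, (simple_mul_walk cs _ _ k).symm⟩
    · exact ⟨_, (simple_mul_walk' cs _ _ k).symm⟩

theorem exists_walk_of_wordProd (ω : List (Fin 2)) :
    ∃ k : ℤ, k.natAbs ≤ ω.length ∧ walk cs i j k = cs.wordProd ω := by
  induction ω with
  | nil => exact ⟨0, by simp⟩
  | cons b ω ih =>
    obtain ⟨k, hk, h⟩ := ih
    rw [cs.wordProd_cons, ← h, List.length_cons]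
    rcases eq_or_eq_of_ne hij b with rfl | rfl
    · exact ⟨_, by omega, (simple_mul_walk cs _ _ k).symm⟩
    · exact ⟨_, by omega, (simple_mul_walk' cs _ _ k).symm⟩

variable {m : ℕ} (hM : M i j = 2 * m)
include hM

/-- The map onto the dihedral group. -/
theorem exists_toDihedral : ∃ f : W →* DihedralGroup (2 * m),
    f (cs.simple i) = .sr 0 ∧ f (cs.simple j) = .sr 1 := by
  have hl : M.IsLiftable
      (fun b => if b = i then (.sr 0 : DihedralGroup (2 * m)) else .sr 1) := by
    intro a b
    have hji : ¬ j = i := fun h => hij h.symm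
    rcases eq_or_eq_of_ne hij a with rfl | rfl <;> rcases eq_or_eq_of_ne hij b with rfl | rfl
    · simp
    · have := DihedralGroup.r_one_pow_n (n := 2 * m)
      simpa [hM, hji, -DihedralGroup.r_pow] using this
    · have := congrArg (·⁻¹) (DihedralGroup.r_one_pow_n (n := 2 * m))
      rw [M.symmetric, hM]
      simpa [hji, ← inv_pow, -DihedralGroup.r_pow] using this
    · simp [hji]
  refine ⟨cs.lift ⟨_, hl⟩, ?_, ?_⟩
  · rw [cs.lift_apply_simple hl]; simp
  · rw [cs.lift_apply_simple hl]; simp [hij.symm]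

/-- The Coxeter relation gives period `4m`; the map to the dihedral group of order `4m` excludes
further coincidences, since it sends `s_i s_j` to a rotation of exact order `2m` and odd indices to
reflections. -/
theorem walk_eq_walk_iff {a b : ℤ} :
    walk cs i j a = walk cs i j b ↔ (4 * m : ℤ) ∣ a - b := by
  obtain ⟨f, hi, hj⟩ := exists_toDihedral cs hij hM
  have hr : f (cs.simple i * cs.simple j) = .r 1 := by simp [hi, hj]
  have hrz (k : ℤ) : (DihedralGroup.r (1 : ZMod (2 * m))) ^ k = .r (k : ZMod (2 * m)) := by
    simp
  have hone {k : ℤ} : walk cs i j k = 1 ↔ (4 * m : ℤ) ∣ k := by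
    constructor
    · intro h
      have h1 := congrArg f h
      rcases Int.even_or_odd' k with ⟨k, rfl | rfl⟩
      · rw [walk_two_mul, map_zpow, hr, hrz, map_one, DihedralGroup.one_def,
          DihedralGroup.r.injEq, ZMod.intCast_zmod_eq_zero_iff_dvd] at h1
        obtain ⟨c, rfl⟩ := h1
        exact ⟨c, by push_cast; ring⟩
      · rw [walk_two_mul_add_one, map_mul, map_zpow, hr, hrz, hi, map_one,
          DihedralGroup.one_def, DihedralGroup.r_mul_sr] at h1
        cases h1
    · rintro ⟨c, rfl⟩
      have := cs.simple_mul_simple_pow i j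
      rw [show 4 * (m : ℤ) * c = 2 * ((2 * m : ℕ) * c) by push_cast; ring, walk_two_mul, zpow_mul,
        zpow_natCast, ← hM, this, one_zpow]
  have hev {k : ℤ} (hk : (4 * m : ℤ) ∣ k) : Even k :=
    even_iff_two_dvd.mpr (dvd_trans ⟨2 * m, by ring⟩ hk)
  constructor
  · intro h
    rw [← mul_inv_eq_one] at h
    rcases Int.even_or_odd a with ha | ha <;> rcases Int.even_or_odd b with hb | hb
    · rwa [walk_inv_of_even cs i j hb, walk_mul_of_even cs i j ha, hone] at h
    · rw [walk_inv_of_odd cs i j hb, walk_mul_of_even cs i j ha, hone] at h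
      exact absurd (hev h) (by simpa using ha.add_odd hb)
    · rw [walk_inv_of_even cs i j hb, walk_mul_of_odd cs i j ha, hone] at h
      exact absurd (hev h) (by simpa using ha.add_even hb)
    · rwa [walk_inv_of_odd cs i j hb, walk_mul_of_odd cs i j ha, hone] at h
  · intro h
    have := walk_mul_of_even cs i j (hev h) b
    rwa [hone.mpr h, one_mul, sub_add_cancel, eq_comm] at this

variable (hm : 0 < m)
include hm

theorem exists_walk_eq (w : W) : ∃ k : ℤ, -(2 * m : ℤ) < k ∧ k ≤ 2 * m ∧ walk cs i j k = w := by
  obtain ⟨k, rfl⟩ := walk_surjective cs hij w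
  have h4 : (0 : ℤ) < 4 * m := by omega
  have h1 := Int.emod_nonneg (k + 2 * m - 1) h4.ne'
  have h2 := Int.emod_lt_of_pos (k + 2 * m - 1) h4
  -- The shift by `2m - 1` moves the remainders `0, …, 4m - 1` to the window `-2m + 1, …, 2m`.
  refine ⟨(k + 2 * m - 1) % (4 * m) - 2 * m + 1, by omega, by omega, ?_⟩
  rw [walk_eq_walk_iff cs hij hM]
  refine ⟨-((k + 2 * m - 1) / (4 * m)), ?_⟩
  linear_combination Int.emod_add_mul_ediv (k + 2 * m - 1) (4 * m)

-- The walk itself gives a word with `|k|` letters. Conversely a word with `n` letters moves at most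
-- `n` steps, and any other index of the same element differs from `k` by a nonzero multiple of
-- `4m`, so its modulus is at least `2m ≥ |k|`.
omit hm in
theorem length_walk {k : ℤ} (hk : k.natAbs ≤ 2 * m) : cs.length (walk cs i j k) = k.natAbs := by
  apply le_antisymm
  · have (n : ℕ) (i j : Fin 2) : cs.length (walk cs i j n) ≤ n := by
      induction n generalizing i j with
      | zero => simp
      | succ n ih =>
        have h : walk cs i j ((n + 1 : ℕ) : ℤ) = cs.simple i * walk cs j i n := by
          rw [walk_swap cs i j, simple_mul_walk]; congr 1; push_cast; ring
        rw [h]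
        refine (cs.length_mul_le _ _).trans ?_
        have := ih j i
        rw [cs.length_simple]; omega
    rcases Int.natAbs_eq k with h | h
    · conv_lhs => rw [h]
      exact this _ _ _
    · conv_lhs => rw [h, ← walk_swap]
      exact this _ _ _
  · obtain ⟨ω, hω, h⟩ := cs.exists_isReduced (walk cs i j k)
    obtain ⟨l, hl, hw⟩ := exists_walk_of_wordProd cs hij ω
    rw [← h] at hw
    rw [h, hω.eq]
    obtain ⟨c, hc⟩ := (walk_eq_walk_iff cs hij hM).mp hw
    refine le_trans ?_ hl
    rcases lt_trichotomy c 0 with h0 | rfl | h0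
    · have : 4 * (m : ℤ) * c ≤ 4 * m * (-1) := by
        apply mul_le_mul_of_nonneg_left <;> omega
      omega
    · omega
    · have : 4 * (m : ℤ) * 1 ≤ 4 * m * c := by
        apply mul_le_mul_of_nonneg_left <;> omega
      omega

end Walk

/-! ### Twisted conjugacy, twisted roots and the values of `Υ` -/

section TwistedDihedral

variable {m : ℕ} {W : Type*} [Group W] {M : CoxeterMatrix (Fin 2)} (cs : CoxeterSystem M W)

theorem walk_longest_ne_one {i j : Fin 2} (hij : i ≠ j) (hM : M i j = 2 * m) (hm : 0 < m) :
    walk cs i j (2 * m) ≠ 1 := by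
  rw [← walk_zero cs i j, Ne, walk_eq_walk_iff cs hij hM, sub_zero]
  rintro ⟨c, hc⟩
  have : (m : ℤ) * 1 = m * (2 * c) := by linarith
  have := mul_left_cancel₀ (by omega) this
  omega

include cs in
theorem card_eq_four_mul [Fintype W] {i j : Fin 2} (hij : i ≠ j) (hM : M i j = 2 * m)
    (hm : 0 < m) : Fintype.card W = 4 * m := by
  have hbij : Function.Bijective (fun k : Finset.Ico (0 : ℤ) (4 * m) => walk cs i j k) := by
    constructor
    · rintro ⟨a, ha⟩ ⟨b, hb⟩ h
      rw [Finset.mem_Ico] at ha hb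
      have hd : (4 * m : ℤ) ∣ a - b := (walk_eq_walk_iff cs hij hM).mp h
      have := Int.eq_zero_of_abs_lt_dvd hd (abs_lt.mpr ⟨by omega, by omega⟩)
      simp only [Subtype.mk.injEq]; omega
    · intro w
      obtain ⟨k, rfl⟩ := walk_surjective cs hij w
      have h4 : (0 : ℤ) < 4 * m := by omega
      refine ⟨⟨k % (4 * m), Finset.mem_Ico.mpr ⟨Int.emod_nonneg k h4.ne', Int.emod_lt_of_pos k h4⟩⟩,
        ?_⟩
      simp only
      rw [walk_eq_walk_iff cs hij hM]
      exact ⟨-(k / (4 * m)), by linear_combination Int.emod_add_mul_ediv k (4 * m)⟩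
  rw [← Fintype.card_of_bijective hbij, Fintype.card_coe, Int.card_Ico]
  omega

variable {cs} (d : Diamond cs) {i j : Fin 2} (hij : i ≠ j) (hM : M i j = 2 * m) (hm : 0 < m)
  (hd₁ : d.toMulEquiv (cs.simple i) = cs.simple j) (hd₂ : d.toMulEquiv (cs.simple j) = cs.simple i)

section
include hd₁ hd₂

theorem Diamond.map_walk (k : ℤ) : d.toMulEquiv (walk cs i j k) = walk cs i j (-k) := by
  rw [← walk_swap, walk, walk]
  split_ifs <;> simp [hd₁, hd₂]

/-- Both `⋄` and, for even `a`, inversion negate the index, while a reflection is its own inverse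
and subtracts. Either way the result is a double step, whatever the parity of `a`. -/
theorem Diamond.twist_walk (a : ℤ) :
    d.toMulEquiv (walk cs i j a) * (walk cs i j a)⁻¹ = walk cs i j (-(2 * a)) := by
  rw [d.map_walk hd₁ hd₂]
  rcases Int.even_or_odd a with ha | ha
  · rw [walk_inv_of_even cs i j ha, walk_mul_of_even cs i j ha.neg]; congr 1; ring
  · rw [walk_inv_of_odd cs i j ha, walk_mul_of_odd cs i j ha.neg]; congr 1; ring

include hij

theorem Diamond.conj_one_iff (w : W) : d.Conj 1 w ↔ ∃ a : ℤ, w = walk cs i j (2 * a) := by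
  constructor
  · rintro ⟨x, rfl⟩
    obtain ⟨a, rfl⟩ := walk_surjective cs hij x
    exact ⟨-a, by rw [mul_one, d.twist_walk hd₁ hd₂, mul_neg]⟩
  · rintro ⟨a, rfl⟩
    exact ⟨walk cs i j (-a), by rw [mul_one, d.twist_walk hd₁ hd₂]; congr 1; ring⟩

include hM

/-- For rotations both `⋄` and inversion negate the index. A reflection `walk k` equals its inverse,
so the condition would be `4m ∣ 2k` with `k` odd. -/
theorem Diamond.isTwistedInvolution_iff (w : W) : d.IsTwistedInvolution w ↔ d.Conj 1 w := by
  rw [d.conj_one_iff hij hd₁ hd₂]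
  constructor
  · intro h
    obtain ⟨k, rfl⟩ := walk_surjective cs hij w
    rcases Int.even_or_odd' k with ⟨a, rfl | rfl⟩
    · exact ⟨a, rfl⟩
    · rw [Diamond.IsTwistedInvolution, d.map_walk hd₁ hd₂, walk_inv_of_odd cs i j ⟨a, rfl⟩,
        walk_eq_walk_iff cs hij hM] at h
      obtain ⟨c, hc⟩ := h
      exfalso
      have : 2 * a + 1 = 2 * (-(m * c)) := by linarith
      omega
  · rintro ⟨a, rfl⟩
    rw [Diamond.IsTwistedInvolution, d.map_walk hd₁ hd₂, walk_inv_of_even cs i j (even_two_mul a)]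

/-- With `w = walk (2a)`, an even index `k` satisfies the condition iff `2k ≡ 0` modulo `4m`,
independently of `a`; an odd one would need `2k + 4a ≡ 0`, which parity forbids. So the centraliser
is the same along the whole class. -/
theorem Diamond.mem_centralizer_iff {w : W} (hw : d.Conj 1 w) (x : W) :
    x ∈ d.centralizer w ↔ x = 1 ∨ x = walk cs i j (2 * m) := by
  obtain ⟨a, rfl⟩ := (d.conj_one_iff hij hd₁ hd₂ w).mp hw
  obtain ⟨k, rfl⟩ := walk_surjective cs hij x
  have hmod : (4 * m : ℤ) ∣ 2 * k ↔ (4 * m : ℤ) ∣ k ∨ (4 * m : ℤ) ∣ k - 2 * m := by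
    constructor
    · rintro ⟨c, hc⟩
      rcases Int.even_or_odd' c with ⟨c, rfl | rfl⟩
      · exact .inl ⟨c, by linarith⟩
      · exact .inr ⟨c, by linarith⟩
    · rintro (⟨c, hc⟩ | ⟨c, hc⟩)
      · exact ⟨2 * c, by linarith⟩
      · exact ⟨2 * c + 1, by linarith⟩
  rw [← walk_zero cs i j, walk_eq_walk_iff cs hij hM, walk_eq_walk_iff cs hij hM, sub_zero, ← hmod]
  change d.toMulEquiv (walk cs i j k) * walk cs i j (2 * a) =
    walk cs i j (2 * a) * walk cs i j k ↔ _
  rw [d.map_walk hd₁ hd₂, walk_mul_of_even cs i j (even_two_mul a)]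
  rcases Int.even_or_odd k with hk | hk
  · rw [walk_mul_of_even cs i j hk.neg, walk_eq_walk_iff cs hij hM, ← dvd_neg]
    ring_nf
  · rw [walk_mul_of_odd cs i j hk.neg, walk_eq_walk_iff cs hij hM]
    have h2 : ¬ (4 * m : ℤ) ∣ 2 * k := by
      rintro ⟨c, hc⟩
      have : k = 2 * (m * c) := by linarith
      rw [this] at hk
      exact absurd hk (by simp)
    have h3 : ¬ (4 * m : ℤ) ∣ -k - 2 * a - (2 * a + k) := by
      rintro ⟨c, hc⟩
      have : k = 2 * (-(m * c) - a) := by linarith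
      rw [this] at hk
      exact absurd hk (by simp)
    exact iff_of_false h3 h2

theorem Diamond.centralizer_eq {w : W} (hw : d.Conj 1 w) : d.centralizer w = d.centralizer 1 := by
  ext x
  rw [d.mem_centralizer_iff hij hM hd₁ hd₂ hw,
    d.mem_centralizer_iff hij hM hd₁ hd₂ ⟨1, by simp⟩]

end

theorem Diamond.conjClass_eq {w w' : W} (h : d.Conj w w') : d.conjClass w' = d.conjClass w := by
  obtain ⟨x, rfl⟩ := h
  ext u
  constructor
  · rintro ⟨y, rfl⟩
    exact ⟨y * x, by simp [mul_assoc]⟩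
  · rintro ⟨y, rfl⟩
    exact ⟨y * x⁻¹, by simp [mul_assoc]⟩

/-! ### Roots -/

theorem simpleReflection_apply_self (hij : i ≠ j) (hM : M i j = 2 * m) (v : Fin 2 →₀ ℝ) :
    simpleReflection M i v i = -v i + 2 * Real.cos (Real.pi / (2 * m)) * v j := by
  have hu : (Finset.univ : Finset (Fin 2)) = {i, j} := by
    ext b; simpa using eq_or_eq_of_ne hij b
  rw [simpleReflection, Module.reflection_apply, simpleCoroot, Finsupp.linearCombination_apply,
    Finsupp.sum_fintype _ _ (by simp), hu, Finset.sum_pair hij]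
  simp [simpleRoot, hM]
  ring

theorem simpleReflection_apply_of_ne (hij : i ≠ j) (v : Fin 2 →₀ ℝ) :
    simpleReflection M i v j = v j := by
  simp [simpleReflection, Module.reflection_apply, simpleRoot, hij]

/-- A simple reflection changes one coordinate, replacing `a` by `2b - a`; for adjacent `a` and `b`
this is the identity `sin((b+1)θ) + sin((b-1)θ) = 2 cos θ sin(bθ)`. Adjacency is preserved, which
later supplies the parity argument. -/
theorem roots_coordinates (hij : i ≠ j) (hM : M i j = 2 * m) {α : Fin 2 →₀ ℝ}
    (hα : α ∈ roots cs) : ∃ a b : ℤ, (a - b = 1 ∨ a - b = -1) ∧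
      α i * Real.sin (Real.pi / (2 * m)) = Real.sin (a * (Real.pi / (2 * m))) ∧
      α j * Real.sin (Real.pi / (2 * m)) = Real.sin (b * (Real.pi / (2 * m))) := by
  obtain ⟨w, b, rfl⟩ := hα
  have hsimple (i : Fin 2) : geomRep cs (cs.simple i) = simpleReflection M i :=
    cs.lift_apply_simple (simpleReflection_liftable M) i
  have hM' : M j i = 2 * m := by rw [M.symmetric, hM]
  have hstep (a b : ℤ) (θ : ℝ) : -Real.sin (a * θ) + 2 * Real.cos θ * Real.sin (b * θ) =
      Real.sin ((2 * b - a : ℤ) * θ) ∨ ¬ (a - b = 1 ∨ a - b = -1) := by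
    refine or_iff_not_imp_right.mpr fun h => ?_
    rw [not_not] at h
    have h1 := Real.sin_add (b * θ) θ
    have h2 := Real.sin_sub (b * θ) θ
    rcases h with h | h
    · obtain rfl : a = b + 1 := by omega
      rw [show ((2 * b - (b + 1) : ℤ) : ℝ) * θ = b * θ - θ by push_cast; ring, h2,
        show ((b + 1 : ℤ) : ℝ) * θ = b * θ + θ by push_cast; ring, h1]
      ring
    · obtain rfl : a = b - 1 := by omega
      rw [show ((2 * b - (b - 1) : ℤ) : ℝ) * θ = b * θ + θ by push_cast; ring, h1,
        show ((b - 1 : ℤ) : ℝ) * θ = b * θ - θ by push_cast; ring, h2]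
      ring
  induction w using cs.simple_induction_left with
  | one =>
    rcases eq_or_eq_of_ne hij b with rfl | rfl
    · exact ⟨1, 0, by simp [simpleRoot, hij]⟩
    · exact ⟨0, 1, by simp [simpleRoot, hij.symm]⟩
  | mul_simple_left w c ih =>
    obtain ⟨a, e, hae, h1, h2⟩ := ih
    rw [map_mul, LinearEquiv.mul_apply, hsimple]
    set v := geomRep cs w (simpleRoot b)
    rcases eq_or_eq_of_ne hij c with rfl | rfl
    · refine ⟨2 * e - a, e, by omega, ?_, ?_⟩
      · rw [simpleReflection_apply_self hij hM,
          ← (hstep a e _).resolve_right (not_not.mpr hae), ← h1, ← h2]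
        ring
      · rw [simpleReflection_apply_of_ne hij, h2]
    · refine ⟨a, 2 * a - e, by omega, ?_, ?_⟩
      · rw [simpleReflection_apply_of_ne hij.symm, h1]
      · rw [simpleReflection_apply_self hij.symm hM',
          ← (hstep e a _).resolve_right (not_not.mpr (by omega)), ← h1, ← h2]
        ring

include hij hM hm hd₁

/-- A root with `α = -α^⋄` has opposite coordinates, so `sin(aθ) + sin(bθ) = 0`. As `a` and `b` are
adjacent, the cosine factor of the sum is `cos(θ/2) ≠ 0`, and the sine factor forces `a + b` to be a
multiple of `4m`; but `a + b` is odd. -/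
theorem Diamond.twistedRoots_one : d.twistedRoots (1 : W) = ∅ := by
  refine Set.eq_empty_iff_forall_notMem.mpr ?_
  rintro α ⟨hα, h⟩
  have hperm : d.perm i = j := by
    -- If the diagram symmetry fixed `i`, then `s_i = s_j`, that is, `4m` would divide `-2`.
    refine (eq_or_eq_of_ne hij (d.perm i)).resolve_left fun h => ?_
    have h1 := d.map_simple i
    rw [h, hd₁, ← walk_one cs i j, ← walk_neg_one cs i j, walk_eq_walk_iff cs hij hM] at h1
    obtain ⟨c, hc⟩ := h1
    have : (1 : ℤ) = 2 * (-(m * c)) := by linarith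
    omega
  have hij0 : α j = -α i := by
    have := DFunLike.congr_fun h j
    simpa [Diamond.onRoots, ← hperm] using this
  obtain ⟨a, b, hab, h1, h2⟩ := roots_coordinates hij hM hα
  set θ := Real.pi / (2 * m) with hθ
  have hm0 : (0 : ℝ) < m := by exact_mod_cast hm
  have hs : Real.sin (a * θ) + Real.sin (b * θ) = 0 := by rw [← h1, ← h2, hij0]; ring
  rw [Real.sin_add_sin] at hs
  have hcos : Real.cos ((a * θ - b * θ) / 2) ≠ 0 := by
    have hc : Real.cos ((a * θ - b * θ) / 2) = Real.cos (θ / 2) := by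
      rw [← sub_mul]
      rcases hab with h | h
      · rw [show ((a : ℝ) - b) = 1 by exact_mod_cast h, one_mul]
      · rw [show ((a : ℝ) - b) = -1 by exact_mod_cast h, ← Real.cos_neg]; congr 1; ring
    rw [hc]
    have hθ1 : θ / 2 < Real.pi / 2 := by
      rw [hθ, div_lt_div_iff_of_pos_right two_pos, div_lt_iff₀ (by positivity)]
      have : (1 : ℝ) ≤ m := by exact_mod_cast hm
      nlinarith [Real.pi_pos]
    have : 0 < θ := by positivity
    exact (Real.cos_pos_of_mem_Ioo ⟨by linarith [Real.pi_pos], hθ1⟩).ne'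
  have hsin : Real.sin ((a * θ + b * θ) / 2) = 0 := by
    rcases mul_eq_zero.mp hs with h | h
    · linarith
    · exact absurd h hcos
  obtain ⟨n, hn⟩ := Real.sin_eq_zero_iff.mp hsin
  have : ((a + b : ℤ) : ℝ) = (4 * m * n : ℤ) := by
    push_cast
    have hpi := Real.pi_ne_zero
    rw [hθ] at hn
    field_simp at hn
    linarith
  have hab' : a + b = 4 * m * n := by exact_mod_cast this
  have : a + b = 2 * (2 * m * n) := by rw [hab']; ring
  omega

/-- For `w = x^⋄ x⁻¹` the element `x⁻¹` carries `Φ_w` into `Φ_1`, by the compatibility of `⋄` with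
the geometric representation. -/
theorem Diamond.twistedRoots_eq_empty {w : W} (hw : d.Conj 1 w) : d.twistedRoots w = ∅ := by
  obtain ⟨x, rfl⟩ := hw
  refine Set.eq_empty_iff_forall_notMem.mpr ?_
  rintro α ⟨hα, h⟩
  have h1 := d.twistedRoots_one hij hM hm hd₁
  refine Set.eq_empty_iff_forall_notMem.mp h1 (geomRep cs x⁻¹ α) ⟨?_, ?_⟩
  · obtain ⟨y, b, rfl⟩ := hα
    exact ⟨x⁻¹ * y, b, by rw [map_mul]; rfl⟩
  · rw [map_one, LinearEquiv.coe_one, id_eq, ← d.geomRep_onRoots, map_inv d.toMulEquiv, map_inv _ (d.toMulEquiv x),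
      ← map_neg, ← h, mul_one, map_mul, LinearEquiv.mul_apply]
    exact ((geomRep cs (d.toMulEquiv x)).symm_apply_apply _).symm

theorem Diamond.sign_eq_one {w : W} (hw : d.Conj 1 w) (x : d.centralizer w) : d.sign w x = 1 := by
  simp [Diamond.sign, d.twistedRoots_eq_empty hij hM hm hd₁ hw]

variable [Fintype W]

include hd₂

theorem Diamond.upsilon_eq_induced {w : W} (hw : d.Conj 1 w) :
    d.upsilon w = induced (d.centralizer 1) (fun _ => 1) := by
  have h (H K : Subgroup W) (hHK : H = K) :
      induced H (fun _ => (1 : ℂ)) = induced K (fun _ => 1) := by subst hHK; rfl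
  rw [← h _ _ (d.centralizer_eq hij hM hd₁ hd₂ hw), Diamond.upsilon]
  congr 1
  ext x
  simp [d.sign_eq_one hij hM hm hd₁ hw]

-- Both elements of the centraliser are central in `W`, so the inducing sum has either all of its
-- terms equal to `1` or none; the constant is `4m / 2`.
open scoped Classical in
theorem Diamond.upsilon_apply {w : W} (hw : d.Conj 1 w) (g : W) :
    d.upsilon w g = if g = 1 ∨ g = walk cs i j (2 * m) then (2 * m : ℂ) else 0 := by
  have hone : d.Conj 1 1 := ⟨1, by simp⟩
  rw [d.upsilon_eq_induced hij hM hm hd₁ hd₂ hw]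
  have hmem := d.mem_centralizer_iff hij hM hd₁ hd₂ hone
  have hne := walk_longest_ne_one cs hij hM hm
  have hcard : Nat.card (d.centralizer 1) = 2 := by
    have : (d.centralizer 1 : Set W) = {1, walk cs i j (2 * m)} := by ext x; exact hmem x
    rw [← SetLike.coe_sort_coe, this, Nat.card_coe_set_eq, Set.ncard_pair hne.symm]
  have hcomm (x : W) : Commute x (walk cs i j (2 * m)) := by
    obtain ⟨k, rfl⟩ := walk_surjective cs hij x
    rw [Commute, SemiconjBy, walk_mul_of_even cs i j (even_two_mul _)]
    rcases Int.even_or_odd k with hk | hk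
    · rw [walk_mul_of_even cs i j hk, add_comm]
    · rw [walk_mul_of_odd cs i j hk, walk_eq_walk_iff cs hij hM]
      exact ⟨-1, by ring⟩
  have hconj (x : W) : x⁻¹ * g * x ∈ d.centralizer 1 ↔ g = 1 ∨ g = walk cs i j (2 * m) := by
    rw [hmem, mul_assoc, inv_mul_eq_iff_eq_mul, inv_mul_eq_iff_eq_mul, mul_one, (hcomm x).eq,
      mul_left_inj]
    simp
  simp only [induced, hcard, hconj, dite_eq_ite]
  split_ifs with h
  · simp [card_eq_four_mul cs hij hM hm]; ring
  · simp

theorem Diamond.classInner_upsilon {w : W} (hw : d.Conj 1 w) (φ : W → ℂ) :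
    classInner (d.upsilon w) φ =
      (starRingEnd ℂ (φ 1) + starRingEnd ℂ (φ (walk cs i j (2 * m)))) / 2 := by
  classical
  have hne := walk_longest_ne_one cs hij hM hm
  have hs : (Finset.univ.filter fun g : W => g = 1 ∨ g = walk cs i j (2 * m)) =
      {1, walk cs i j (2 * m)} := by ext; simp
  have hm0 : (m : ℂ) ≠ 0 := by exact_mod_cast hm.ne'
  simp only [classInner, d.upsilon_apply hij hM hm hd₁ hd₂ hw, ite_mul, zero_mul]
  rw [← Finset.sum_filter, hs, Finset.sum_pair hne.symm, card_eq_four_mul cs hij hM hm]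
  push_cast
  field_simp
  ring

end TwistedDihedral

/-! ### Laurent coefficients, the bar map and uniqueness of Kazhdan-Lusztig families -/

theorem vpow_mul_vpow (a b : ℤ) : vpow a * vpow b = vpow (a + b) :=
  (LaurentPolynomial.T_add a b).symm

@[simp] theorem vpow_zero : vpow 0 = 1 := rfl

theorem vpow_one_mul_vpow_neg_one : vpow 1 * vpow (-1) = 1 := by
  rw [vpow_mul_vpow]; rfl

theorem invert_vpow (a : ℤ) : LaurentPolynomial.invert (vpow a) = vpow (-a) :=
  LaurentPolynomial.invert_T a

section General

variable {B : Type*} {M : CoxeterMatrix B} {W : Type*} [Group W] (cs : CoxeterSystem M W)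

theorem leftMulSimple_stdElt_of_lt {i : B} {w : W}
    (h : cs.length w < cs.length (cs.simple i * w)) :
    leftMulSimple cs i (stdElt w) = stdElt (cs.simple i * w) := by
  conv_lhs => rw [leftMulSimple, stdElt]
  rw [Finsupp.linearCombination_single, one_smul, if_pos h]

theorem leftMulSimple_stdElt_of_not_lt {i : B} {w : W}
    (h : ¬ cs.length w < cs.length (cs.simple i * w)) :
    leftMulSimple cs i (stdElt w) =
      stdElt (cs.simple i * w) + (vpow 1 - vpow (-1)) • stdElt w := by
  conv_lhs => rw [leftMulSimple, stdElt]
  rw [Finsupp.linearCombination_single, one_smul, if_neg h]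

omit [Group W] in
theorem stdElt_apply [DecidableEq W] (w y : W) :
    (stdElt w : HeckeModule W) y = if w = y then 1 else 0 := by
  rw [stdElt, Finsupp.single_apply]

theorem heckeBar_add (h h' : HeckeModule W) :
    heckeBar cs (h + h') = heckeBar cs h + heckeBar cs h' :=
  Finsupp.sum_add_index' (by simp) (by simp [add_smul])

theorem heckeBar_smul (a : LaurentRing) (h : HeckeModule W) :
    heckeBar cs (a • h) = LaurentPolynomial.invert a • heckeBar cs h := by
  rw [heckeBar, Finsupp.sum_smul_index (by simp), heckeBar, Finsupp.smul_sum]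
  simp [mul_smul]

theorem heckeBar_stdElt (w : W) : heckeBar cs (stdElt w) = invStd cs w := by
  rw [heckeBar, stdElt, Finsupp.sum_single_index (by simp)]
  simp

theorem heckeBar_zero : heckeBar cs 0 = 0 := Finsupp.sum_zero_index

theorem heckeBar_sub (h h' : HeckeModule W) :
    heckeBar cs (h - h') = heckeBar cs h - heckeBar cs h' := by
  have := heckeBar_smul cs (-1) h'
  rw [neg_one_smul, map_neg, map_one, neg_one_smul] at this
  rw [sub_eq_add_neg, heckeBar_add, this, sub_eq_add_neg]

/-- An element that is fixed by the bar involution and whose coefficients lie in `v ℤ[v]`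
vanishes, if the bar involution is unitriangular. -/
theorem eq_zero_of_heckeBar_eq_self
    (hdiag : ∀ w, invStd cs w w = 1)
    (htri : ∀ w y, cs.length w ≤ cs.length y → y ≠ w → invStd cs w y = 0)
    {D : HeckeModule W} (hD : heckeBar cs D = D) (hpos : ∀ y, ∀ n ≤ 0, (D y).coeff n = 0) :
    D = 0 := by
  by_contra hne
  -- At a `y` of maximal length in the support only the diagonal term of the bar image contributes.
  -- So the coefficient at `y` is symmetric under `v ↦ v⁻¹`; having no exponents `≤ 0`, it vanishes.
  obtain ⟨y, hy, hmax⟩ := D.support.exists_max_image cs.length (Finsupp.support_nonempty_iff.mpr hne)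
  have h1 : heckeBar cs D y = LaurentPolynomial.invert (D y) := by
    rw [heckeBar, Finsupp.sum, Finsupp.finsetSum_apply, Finset.sum_eq_single y]
    · simp [hdiag]
    · intro w hw hwy
      simp [htri w y (hmax w hw) hwy.symm]
    · intro h; exact absurd hy h
  rw [hD] at h1
  refine Finsupp.mem_support_iff.mp hy ?_
  refine LaurentPolynomial.ext fun n => ?_
  rcases le_or_gt n 0 with hn | hn
  · simpa using hpos y n hn
  · rw [h1, LaurentPolynomial.invert_apply, hpos y _ (by omega)]; rfl

theorem coeff_vpow_mul_aeval (a n : ℤ) (p : Polynomial ℤ) :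
    (vpow a * Polynomial.aeval (vpow (-2)) p).coeff n =
      ∑ k ∈ Finset.range (p.natDegree + 1), if a - 2 * k = n then p.coeff k else 0 := by
  rw [Polynomial.aeval_eq_sum_range, Finset.mul_sum]
  have h (k : ℕ) : vpow a * (p.coeff k • vpow (-2) ^ k) = p.coeff k • vpow (a - 2 * k) := by
    have : vpow (-2) ^ k = vpow (-2 * k) := by
      rw [vpow, LaurentPolynomial.T_pow, mul_comm]; rfl
    rw [this, mul_smul_comm, vpow_mul_vpow, show a + -2 * (k : ℤ) = a - 2 * k by ring]
  simp only [h]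
  simp only [AddMonoidAlgebra.coeff_sum, Finsupp.finsetSum_apply, vpow,
    AddMonoidAlgebra.coeff_smul, Finsupp.smul_apply, LaurentPolynomial.T_apply, smul_eq_mul,
    mul_ite, mul_one, mul_zero]

theorem aeval_vpow_injective : Function.Injective (Polynomial.aeval (R := ℤ) (vpow (-2))) := by
  rw [injective_iff_map_eq_zero]
  intro p hp
  ext k
  have h := coeff_vpow_mul_aeval 0 (-2 * k) p
  rw [hp, mul_zero] at h
  have h2 (l : ℕ) : ((0 : ℤ) - 2 * l = -2 * k) ↔ k = l := by omega
  simp only [h2, Finset.sum_ite_eq, Finset.mem_range] at h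
  split_ifs at h with hk
  · simpa using h.symm
  · rw [Polynomial.coeff_eq_zero_of_natDegree_lt (by omega)]; rfl

variable [Fintype W]

theorem klSum_apply (w y : W) (P : W → Polynomial ℤ) : klSum cs w P y =
    (-1) ^ (cs.length w + cs.length y) * vpow ((cs.length w : ℤ) - (cs.length y : ℤ)) *
      Polynomial.aeval (vpow (-2)) (P y) := by
  classical
  simp only [klSum, stdElt, Finsupp.coe_finsetSum, Finset.sum_apply, Finsupp.smul_apply,
    Finsupp.single_apply, smul_eq_mul, mul_ite, mul_one, mul_zero]
  rw [Finset.sum_ite_eq' Finset.univ y]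
  simp

/-- Below `w` the degree bound makes every exponent `ℓ(w) - ℓ(y) - 2k` positive, and at `w` the two
families agree. The difference of the two sums is thus bar invariant with coefficients in `v ℤ[v]`,
hence zero; the polynomials are recovered by cancelling the unit in front. -/
theorem IsKLFamily.unique
    (hdiag : ∀ w, invStd cs w w = 1)
    (htri : ∀ w y, cs.length w ≤ cs.length y → y ≠ w → invStd cs w y = 0)
    {w : W} {P Q : W → Polynomial ℤ} (hP : IsKLFamily cs w P) (hQ : IsKLFamily cs w Q) : P = Q := by
  have hsub : klSum cs w P - klSum cs w Q = 0 := by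
    refine eq_zero_of_heckeBar_eq_self cs hdiag htri ?_ ?_
    · rw [heckeBar_sub, hP.2.2.2, hQ.2.2.2]
    · intro y n hn
      have key (P : W → Polynomial ℤ) (hP : IsKLFamily cs w P) (hy : bruhatLT cs y w) :
          (klSum cs w P y).coeff n = 0 := by
        have hdeg := hP.2.2.1 y hy
        have hz : (vpow ((cs.length w : ℤ) - (cs.length y : ℤ)) *
            Polynomial.aeval (vpow (-2)) (P y)).coeff n = 0 := by
          rw [coeff_vpow_mul_aeval]
          refine Finset.sum_eq_zero fun k hk => if_neg ?_
          have := Finset.mem_range.mp hk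
          omega
        rw [klSum_apply, mul_assoc]
        rcases neg_one_pow_eq_or LaurentRing (cs.length w + cs.length y) with h | h <;>
          simp [h, hz]
      rw [Finsupp.sub_apply, AddMonoidAlgebra.coeff_sub, Finsupp.sub_apply]
      by_cases hle : bruhatLE cs y w
      · by_cases hyw : y = w
        · subst hyw
          rw [klSum_apply, klSum_apply, hP.1, hQ.1, sub_self]
        · rw [key P hP ⟨hle, hyw⟩, key Q hQ ⟨hle, hyw⟩, sub_self]
      · rw [klSum_apply, klSum_apply, hP.2.1 y hle, hQ.2.1 y hle, sub_self]
  funext y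
  refine aeval_vpow_injective ?_
  have h := DFunLike.congr_fun (sub_eq_zero.mp hsub) y
  rw [klSum_apply, klSum_apply] at h
  have hu : IsUnit ((-1 : LaurentRing) ^ (cs.length w + cs.length y) *
      vpow ((cs.length w : ℤ) - (cs.length y : ℤ))) :=
    (isUnit_one.neg.pow _).mul (LaurentPolynomial.isUnit_T _)
  exact hu.mul_left_cancel h

/-- The element `∑_{ℓ(y) < n} (-v)^{n-1-ℓ(y)} T_y`. -/
def signedBall (n : ℕ) : HeckeModule W :=
  ∑ y with cs.length y < n, (-vpow 1) ^ (n - 1 - cs.length y) • stdElt y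

@[simp] theorem signedBall_zero : signedBall cs 0 = 0 := by simp [signedBall]

/-- The recursion by spheres, rather than the closed form, drives the computations with `T_s`. -/
theorem signedBall_succ (n : ℕ) : signedBall cs (n + 1) =
    ∑ y with cs.length y = n, stdElt y - vpow 1 • signedBall cs n := by
  classical
  have hs : (Finset.univ.filter fun y : W => cs.length y < n + 1) =
      (Finset.univ.filter fun y : W => cs.length y = n) ∪
        (Finset.univ.filter fun y : W => cs.length y < n) := by
    ext y; simp; omega
  rw [signedBall, hs, Finset.sum_union, signedBall, Finset.smul_sum, sub_eq_add_neg,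
    ← Finset.sum_neg_distrib]
  · congr 1
    · refine Finset.sum_congr rfl fun y hy => ?_
      simp [(Finset.mem_filter.mp hy).2]
    · refine Finset.sum_congr rfl fun y hy => ?_
      have := (Finset.mem_filter.mp hy).2
      rw [show n + 1 - 1 - cs.length y = n - 1 - cs.length y + 1 by omega, pow_succ', mul_smul,
        neg_smul]
  · refine Finset.disjoint_filter.mpr fun y _ h1 h2 => by omega

theorem signedBall_apply (n : ℕ) (y : W) : signedBall cs n y =
    if cs.length y < n then (-vpow 1) ^ (n - 1 - cs.length y) else 0 := by
  classical
  rw [signedBall, Finsupp.finsetSum_apply]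
  simp only [Finsupp.smul_apply, stdElt_apply, smul_eq_mul, mul_ite, mul_one, mul_zero]
  rw [Finset.sum_ite_eq']
  simp

/-- The element `∑ (-v)^{ℓ(w)-ℓ(y)} T_y`, over `y = w` and all `y` shorter than `w`. -/
def ballElt (w : W) : HeckeModule W := stdElt w - vpow 1 • signedBall cs (cs.length w)

theorem ballElt_apply [DecidableEq W] (w y : W) : ballElt cs w y =
    if w = y then 1 else if cs.length y < cs.length w then
      (-vpow 1) ^ (cs.length w - cs.length y) else 0 := by
  rw [ballElt, Finsupp.sub_apply, Finsupp.smul_apply, stdElt_apply, signedBall_apply, smul_eq_mul]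
  split_ifs with h1 h2 h2
  · subst h1; omega
  · simp
  · rw [show cs.length w - cs.length y = cs.length w - 1 - cs.length y + 1 by omega, pow_succ']
    ring
  · simp

/-- The element `∑_{ℓ(y) < n} v^{-(n-1-ℓ(y))} C_y`, for `C` the family `ballElt`. -/
def barBall (n : ℕ) : HeckeModule W :=
  ∑ y with cs.length y < n, vpow (-1) ^ (n - 1 - cs.length y) • ballElt cs y

@[simp] theorem barBall_zero : barBall cs 0 = 0 := by simp [barBall]

theorem barBall_succ (n : ℕ) : barBall cs (n + 1) =
    ∑ y with cs.length y = n, ballElt cs y + vpow (-1) • barBall cs n := by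
  classical
  have hs : (Finset.univ.filter fun y : W => cs.length y < n + 1) =
      (Finset.univ.filter fun y : W => cs.length y = n) ∪
        (Finset.univ.filter fun y : W => cs.length y < n) := by
    ext y; simp; omega
  rw [barBall, hs, Finset.sum_union, barBall, Finset.smul_sum]
  · congr 1
    · refine Finset.sum_congr rfl fun y hy => ?_
      simp [(Finset.mem_filter.mp hy).2]
    · refine Finset.sum_congr rfl fun y hy => ?_
      have := (Finset.mem_filter.mp hy).2
      rw [show n + 1 - 1 - cs.length y = n - 1 - cs.length y + 1 by omega, pow_succ', mul_smul]
  · refine Finset.disjoint_filter.mpr fun y _ h1 h2 => by omega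

/-- The element `∑ v^{-(ℓ(w)-ℓ(y))} C_y`, over `y = w` and all `y` shorter than `w`. -/
def barElt (w : W) : HeckeModule W := ballElt cs w + vpow (-1) • barBall cs (cs.length w)

theorem barBall_apply_eq_zero {n : ℕ} {y : W} (h : n ≤ cs.length y) : barBall cs n y = 0 := by
  classical
  rw [barBall, Finsupp.finsetSum_apply]
  refine Finset.sum_eq_zero fun z hz => ?_
  have hz := (Finset.mem_filter.mp hz).2
  rw [Finsupp.smul_apply, ballElt_apply, if_neg (by rintro rfl; omega), if_neg (by omega),
    smul_zero]

theorem barElt_apply_self (w : W) : barElt cs w w = 1 := by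
  classical
  rw [barElt, Finsupp.add_apply, Finsupp.smul_apply, barBall_apply_eq_zero cs le_rfl, ballElt_apply]
  simp

theorem barElt_apply_eq_zero {w y : W} (h : cs.length w ≤ cs.length y) (hne : y ≠ w) :
    barElt cs w y = 0 := by
  classical
  rw [barElt, Finsupp.add_apply, Finsupp.smul_apply, barBall_apply_eq_zero cs h, ballElt_apply,
    if_neg hne.symm, if_neg (by omega)]
  simp

end General

/-! ### The action of `T_s` and bar invariance of the ball elements -/

section DihedralHecke

variable {m : ℕ} {W : Type*} [Group W] {M : CoxeterMatrix (Fin 2)} (cs : CoxeterSystem M W)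
  {i j : Fin 2} (hij : i ≠ j) (hM : M i j = 2 * m)

theorem simple_mul_altProd_succ (i j : Fin 2) (n : ℕ) :
    cs.simple i * altProd cs i j (n + 1) = altProd cs j i n :=
  cs.simple_mul_simple_cancel_left i

include hij hM

theorem length_altProd {n : ℕ} (hn : n ≤ 2 * m) : cs.length (altProd cs i j n) = n := by
  rw [altProd_eq_walk, length_walk cs hij hM (by omega)]; omega

theorem length_altProd' {n : ℕ} (hn : n ≤ 2 * m) : cs.length (altProd cs j i n) = n :=
  length_altProd cs hij.symm (by rw [M.symmetric, hM]) hn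

theorem altProd_longest : altProd cs i j (2 * m) = altProd cs j i (2 * m) := by
  rw [altProd_eq_walk, altProd_eq_walk, walk_swap cs i j, walk_eq_walk_iff cs hij hM]
  exact ⟨1, by push_cast; ring⟩

theorem altProd_ne {n : ℕ} (h1 : 1 ≤ n) (h2 : n < 2 * m) :
    altProd cs i j n ≠ altProd cs j i n := by
  rw [altProd_eq_walk, altProd_eq_walk, walk_swap cs i j, Ne, walk_eq_walk_iff cs hij hM]
  intro h
  obtain ⟨c, hc⟩ := h
  have h3 : 0 < c := pos_of_mul_pos_right (a := (4 * m : ℤ)) (by omega) (by omega)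
  have h4 : c < 1 := lt_of_mul_lt_mul_left (a := (4 * m : ℤ)) (by omega) (by omega)
  omega

theorem exists_altProd (hm : 0 < m) (w : W) :
    cs.length w ≤ 2 * m ∧
      (w = altProd cs i j (cs.length w) ∨ w = altProd cs j i (cs.length w)) := by
  obtain ⟨k, h1, h2, rfl⟩ := exists_walk_eq cs hij hM hm w
  rw [length_walk cs hij hM (by omega), altProd_eq_walk, altProd_eq_walk, walk_swap cs i j]
  refine ⟨by omega, ?_⟩
  rcases le_total 0 k with h | h
  · left; congr 1; omega
  · right; congr 1; omega

/-- An element `w` of a dihedral group with `s_i w > w` is an alternating product that starts with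
`s_j`. -/
theorem eq_altProd_of_lt (hm : 0 < m) {w : W}
    (hlt : cs.length w < cs.length (cs.simple i * w)) :
    cs.length w < 2 * m ∧ w = altProd cs j i (cs.length w) := by
  have h2 := (exists_altProd cs hij hM hm (cs.simple i * w)).1
  refine ⟨by omega, ?_⟩
  obtain ⟨h1, h | h'⟩ := exists_altProd cs hij hM hm w
  · generalize hn : cs.length w = n at *
    cases n with
    | zero => rw [h]; rfl
    | succ n =>
      rw [h, simple_mul_altProd_succ, length_altProd' cs hij hM (by omega)] at hlt
      omega
  · exact h'

theorem leftMulSimple_altProd (n : ℕ) (hn : n < 2 * m) :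
    leftMulSimple cs i (stdElt (altProd cs j i n)) = stdElt (altProd cs i j (n + 1)) := by
  rw [leftMulSimple_stdElt_of_lt]
  · rfl
  · change _ < cs.length (altProd cs i j (n + 1))
    rw [length_altProd cs hij hM (by omega), length_altProd' cs hij hM (by omega)]
    omega

theorem leftMulSimple_altProd_succ (n : ℕ) (hn : n < 2 * m) :
    leftMulSimple cs i (stdElt (altProd cs i j (n + 1))) =
      stdElt (altProd cs j i n) + (vpow 1 - vpow (-1)) • stdElt (altProd cs i j (n + 1)) := by
  rw [leftMulSimple_stdElt_of_not_lt, simple_mul_altProd_succ]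
  rw [simple_mul_altProd_succ, length_altProd cs hij hM (by omega),
    length_altProd' cs hij hM (by omega)]
  omega

variable [Fintype W]

/-- A sphere of radius strictly between `0` and `2m` has exactly two points. This makes the
recursions for the balls explicit. -/
theorem sum_length_eq {A : Type*} [AddCommMonoid A] (f : W → A) {n : ℕ} (h1 : 1 ≤ n)
    (h2 : n < 2 * m) :
    ∑ y with cs.length y = n, f y = f (altProd cs i j n) + f (altProd cs j i n) := by
  classical
  have hs : (Finset.univ.filter fun y : W => cs.length y = n) =
      {altProd cs i j n, altProd cs j i n} := by
    ext y
    simp only [Finset.mem_filter, Finset.mem_univ, true_and, Finset.mem_insert,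
      Finset.mem_singleton]
    constructor
    · rintro rfl
      exact (exists_altProd cs hij hM (by omega) y).2
    · rintro (rfl | rfl)
      · exact length_altProd cs hij hM h2.le
      · exact length_altProd' cs hij hM h2.le
  rw [hs, Finset.sum_pair (altProd_ne cs hij hM h1 h2)]

omit hij hM in
theorem sum_length_eq_zero {A : Type*} [AddCommMonoid A] (f : W → A) :
    ∑ y with cs.length y = 0, f y = f 1 := by
  classical
  have hs : (Finset.univ.filter fun y : W => cs.length y = 0) = {1} := by
    ext y; simp [cs.length_eq_zero_iff]
  rw [hs, Finset.sum_singleton]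

omit hij hM in
theorem signedBall_one : signedBall cs 1 = stdElt 1 := by
  rw [signedBall_succ, sum_length_eq_zero]; simp

theorem leftMulSimple_signedBall_one (hm : 0 < m) :
    leftMulSimple cs i (signedBall cs 1) = stdElt (altProd cs i j 1) := by
  rw [signedBall_one]
  exact leftMulSimple_altProd cs hij hM 0 (by omega)

/-- Left multiplication by `s_i` pairs up the ball except for one boundary element, so only terms of
the two top lengths and a smaller ball survive. -/
theorem leftMulSimple_signedBall (n : ℕ) (hn : n + 1 < 2 * m) :
    leftMulSimple cs i (signedBall cs (n + 2)) = stdElt (altProd cs i j (n + 2)) -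
      vpow (-1) • stdElt (altProd cs i j (n + 1)) + signedBall cs (n + 1) := by
  induction n with
  | zero =>
    rw [signedBall_succ, sum_length_eq cs hij hM _ le_rfl hn, map_sub, map_add, map_smul,
      leftMulSimple_signedBall_one cs hij hM (by omega),
      leftMulSimple_altProd cs hij hM _ hn,
      leftMulSimple_altProd_succ cs hij hM _ (by omega), signedBall_one]
    simp only [altProd]
    module
  | succ n ih =>
    rw [signedBall_succ, sum_length_eq cs hij hM _ (by omega) hn, map_sub, map_add, map_smul,
      ih (by omega), leftMulSimple_altProd cs hij hM _ hn,
      leftMulSimple_altProd_succ cs hij hM _ (by omega), signedBall_succ cs (n + 1),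
      sum_length_eq cs hij hM _ (by omega) (by omega)]
    have := vpow_one_mul_vpow_neg_one
    linear_combination (norm := module) this • stdElt (altProd cs i j (n + 1))

/-- When `s w < w`, the terms of the ball element group into multiples of `T_{sy} - v T_y` with `sy
> y`, and each such pair is an eigenvector of `T_s` with eigenvalue `-v⁻¹`. -/
theorem leftMulSimple_ballElt_succ (n : ℕ) (hn : n < 2 * m) :
    leftMulSimple cs i (ballElt cs (altProd cs i j (n + 1))) =
      -vpow (-1) • ballElt cs (altProd cs i j (n + 1)) := by
  have huv := vpow_one_mul_vpow_neg_one
  rw [ballElt, length_altProd cs hij hM (by omega), map_sub, map_smul,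
    leftMulSimple_altProd_succ cs hij hM _ hn]
  cases n with
  | zero =>
    rw [leftMulSimple_signedBall_one cs hij hM (by omega), signedBall_one]
    simp only [altProd]
    linear_combination (norm := module) -huv • (stdElt 1 : HeckeModule W)
  | succ n =>
    rw [leftMulSimple_signedBall cs hij hM _ hn, signedBall_succ cs (n + 1),
      sum_length_eq cs hij hM _ (by omega) hn]
    linear_combination (norm := module) huv • (vpow 1 • signedBall cs (n + 1) -
      stdElt (altProd cs j i (n + 1)))

theorem leftMulSimple_ballElt_one (hm : 0 < m) :
    leftMulSimple cs i (ballElt cs 1) =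
      vpow 1 • ballElt cs 1 + ballElt cs (altProd cs i j 1) := by
  have h := leftMulSimple_signedBall_one cs hij hM hm
  rw [signedBall_one] at h
  rw [ballElt, ballElt, length_altProd cs hij hM (by omega), cs.length_one, signedBall_zero,
    smul_zero, sub_zero, h, signedBall_one]
  module

theorem leftMulSimple_ballElt_simple (hm : 0 < m) :
    leftMulSimple cs i (ballElt cs (altProd cs j i 1)) =
      vpow 1 • ballElt cs (altProd cs j i 1) + ballElt cs (altProd cs i j 2) := by
  rw [ballElt, ballElt, length_altProd cs hij hM (by omega), length_altProd' cs hij hM (by omega),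
    map_sub, map_smul, leftMulSimple_altProd cs hij hM _ (by omega),
    leftMulSimple_signedBall_one cs hij hM hm, signedBall_succ cs 1,
    sum_length_eq cs hij hM _ le_rfl (by omega)]
  module

/-- This is the `W`-graph rule for `s w > w`: besides `sw`, the only neighbour with left descent `s`
is the one of length `ℓ(w) - 1`. -/
theorem leftMulSimple_ballElt (n : ℕ) (hn : n + 2 < 2 * m) :
    leftMulSimple cs i (ballElt cs (altProd cs j i (n + 2))) =
      vpow 1 • ballElt cs (altProd cs j i (n + 2)) + ballElt cs (altProd cs i j (n + 3)) +
        ballElt cs (altProd cs i j (n + 1)) := by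
  have huv := vpow_one_mul_vpow_neg_one
  rw [ballElt, ballElt, ballElt, length_altProd cs hij hM (by omega),
    length_altProd cs hij hM (by omega), length_altProd' cs hij hM (by omega),
    map_sub, map_smul, leftMulSimple_altProd cs hij hM _ (by omega),
    leftMulSimple_signedBall cs hij hM _ (by omega), signedBall_succ cs (n + 2),
    sum_length_eq cs hij hM _ (by omega) (by omega), signedBall_succ cs (n + 1),
    sum_length_eq cs hij hM _ (by omega) (by omega)]
  linear_combination (norm := module) huv • stdElt (altProd cs i j (n + 1))

omit hij hM in
theorem barBall_one : barBall cs 1 = ballElt cs 1 := by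
  rw [barBall_succ, sum_length_eq_zero]; simp

omit hij hM [Fintype W] in
theorem leftMulSimpleInv_apply (i : Fin 2) (h : HeckeModule W) : leftMulSimpleInv cs i h =
    leftMulSimple cs i h - (vpow 1 - vpow (-1)) • h := rfl

theorem leftMulSimpleInv_barBall_one (hm : 0 < m) :
    leftMulSimpleInv cs i (barBall cs 1) =
      ballElt cs (altProd cs i j 1) + vpow (-1) • barBall cs 1 := by
  rw [leftMulSimpleInv_apply, barBall_one, leftMulSimple_ballElt_one cs hij hM hm]
  module

theorem leftMulSimpleInv_barBall (n : ℕ) (hn : n + 1 < 2 * m) :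
    leftMulSimpleInv cs i (barBall cs (n + 2)) = ballElt cs (altProd cs i j (n + 2)) +
      vpow (-1) • barBall cs (n + 2) - vpow 1 • ballElt cs (altProd cs i j (n + 1)) := by
  have huv := vpow_one_mul_vpow_neg_one
  induction n with
  | zero =>
    have h1 := leftMulSimpleInv_barBall_one cs hij hM (by omega)
    rw [barBall_succ, sum_length_eq cs hij hM _ le_rfl hn, map_add, map_add, map_smul, h1,
      leftMulSimpleInv_apply, leftMulSimpleInv_apply,
      leftMulSimple_ballElt_simple cs hij hM (by omega),
      leftMulSimple_ballElt_succ cs hij hM _ (by omega)]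
    module
  | succ n ih =>
    rw [barBall_succ, sum_length_eq cs hij hM _ (by omega) hn, map_add, map_add, map_smul,
      ih (by omega), leftMulSimpleInv_apply, leftMulSimpleInv_apply,
      leftMulSimple_ballElt cs hij hM _ (by omega),
      leftMulSimple_ballElt_succ cs hij hM _ (by omega)]
    linear_combination (norm := module) -huv • ballElt cs (altProd cs i j (n + 1))

/-- The inductive step for `T_{w⁻¹}⁻¹`: applying `T_s⁻¹` at an ascent `w < sw` extends the ball in
the basis of ball elements by one sphere. -/
theorem leftMulSimpleInv_barElt (n : ℕ) (hn : n < 2 * m) :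
    leftMulSimpleInv cs i (barElt cs (altProd cs j i n)) =
      barElt cs (altProd cs i j (n + 1)) := by
  have huv := vpow_one_mul_vpow_neg_one
  rw [barElt, barElt, length_altProd cs hij hM (by omega), length_altProd' cs hij hM (by omega),
    map_add, map_smul]
  -- In lengths `0` and `1` the rule for `T_s` on a ball element has no lower neighbour, hence the
  -- separate cases.
  match n, hn with
  | 0, hn =>
    rw [barBall_zero, map_zero, smul_zero, add_zero, zero_add, ← leftMulSimpleInv_barBall_one cs hij
      hM (by omega), barBall_one]
    rfl
  | 1, hn =>
    rw [leftMulSimpleInv_barBall_one cs hij hM (by omega), leftMulSimpleInv_apply,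
      leftMulSimple_ballElt_simple cs hij hM (by omega), barBall_succ cs 1,
      sum_length_eq cs hij hM _ le_rfl hn]
    module
  | n + 2, hn =>
    rw [leftMulSimpleInv_barBall cs hij hM _ (by omega), leftMulSimpleInv_apply,
      leftMulSimple_ballElt cs hij hM _ (by omega), barBall_succ cs (n + 2),
      sum_length_eq cs hij hM _ (by omega) hn]
    linear_combination (norm := module) -huv • ballElt cs (altProd cs i j (n + 1))

/-- The claim covers every reduced word because the word used by `invStd` is an arbitrary choice,
and the induction passes to the tails of a word. -/
theorem prod_leftMulSimpleInv_apply_one (hm : 0 < m) (ω : List (Fin 2)) (hω : cs.IsReduced ω) :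
    (ω.map (leftMulSimpleInv cs)).prod (stdElt 1) = barElt cs (cs.wordProd ω) := by
  induction ω with
  | nil => simp [barElt, ballElt]
  | cons b ω ih =>
    have hω' : cs.IsReduced ω := by simpa using hω.drop 1
    rw [List.map_cons, List.prod_cons, Module.End.mul_apply, ih hω', cs.wordProd_cons]
    have hlt : cs.length (cs.wordProd ω) < cs.length (cs.simple b * cs.wordProd ω) := by
      rw [← cs.wordProd_cons, hω.eq, hω'.eq]; simp
    rcases eq_or_eq_of_ne hij b with rfl | rfl
    · obtain ⟨h1, h2⟩ := eq_altProd_of_lt cs hij hM hm hlt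
      rw [h2]
      exact leftMulSimpleInv_barElt cs hij hM _ h1
    · have hM' : M b i = 2 * m := by rw [M.symmetric, hM]
      obtain ⟨h1, h2⟩ := eq_altProd_of_lt cs hij.symm hM' hm hlt
      rw [h2]
      exact leftMulSimpleInv_barElt cs hij.symm hM' _ h1

theorem invStd_eq_barElt (hm : 0 < m) (w : W) : invStd cs w = barElt cs w := by
  have h := Classical.choose_spec (cs.exists_isReduced w)
  rw [invStd, redWord, prod_leftMulSimpleInv_apply_one cs hij hM hm _ h.1]
  exact congrArg _ h.2.symm

/-- Each of the two elements on a new sphere contributes `v⁻¹` times the old bar ball, and the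
recursion subtracts one copy. The remaining single copy is what the recursion for `barBall` asks
for. -/
theorem heckeBar_signedBall (hm : 0 < m) {n : ℕ} (hn : n ≤ 2 * m) :
    heckeBar cs (signedBall cs n) = barBall cs n := by
  match n, hn with
  | 0, _ => simp [heckeBar_zero]
  | 1, _ =>
    rw [signedBall_one, heckeBar_stdElt, invStd_eq_barElt cs hij hM hm, barBall_one, barElt]
    simp
  | n + 2, hn =>
    rw [signedBall_succ, sum_length_eq cs hij hM _ (by omega) (by omega), heckeBar_sub,
      heckeBar_add, heckeBar_smul, heckeBar_signedBall hm (n := n + 1) (by omega), invert_vpow,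
      heckeBar_stdElt, heckeBar_stdElt, invStd_eq_barElt cs hij hM hm,
      invStd_eq_barElt cs hij hM hm, barElt, barElt, length_altProd cs hij hM (by omega),
      length_altProd' cs hij hM (by omega), barBall_succ cs (n + 1),
      sum_length_eq cs hij hM _ (by omega) (by omega)]
    module

theorem heckeBar_ballElt (hm : 0 < m) (w : W) : heckeBar cs (ballElt cs w) = ballElt cs w := by
  rw [ballElt, heckeBar_sub, heckeBar_smul, invert_vpow, heckeBar_stdElt,
    invStd_eq_barElt cs hij hM hm, barElt,
    heckeBar_signedBall cs hij hM hm (exists_altProd cs hij hM hm w).1, ballElt]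
  module

end DihedralHecke

/-! ### The Bruhat order, and all Kazhdan-Lusztig polynomials equal to one -/

section DihedralCells

variable {m : ℕ} {W : Type*} [Group W] {M : CoxeterMatrix (Fin 2)} (cs : CoxeterSystem M W)
  {i j : Fin 2} (hij : i ≠ j) (hM : M i j = 2 * m) (hm : 0 < m)

theorem isReflection_walk_of_odd (i j : Fin 2) {k : ℤ} (hk : Odd k) :
    cs.IsReflection (walk cs i j k) := by
  obtain ⟨a, rfl⟩ := hk
  rcases Int.even_or_odd a with ha | ha
  · refine ⟨walk cs i j a, i, ?_⟩
    rw [← walk_one cs i j, walk_inv_of_even cs i j ha, walk_mul_of_even cs i j ha,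
      walk_mul_of_odd cs i j (ha.add_odd odd_one)]
    congr 1; ring
  · refine ⟨walk cs i j a, j, ?_⟩
    rw [← walk_neg_one cs i j, walk_inv_of_odd cs i j ha, walk_mul_of_odd cs i j ha,
      walk_mul_of_even cs i j (ha.sub_odd (by decide))]
    congr 1; ring

include hij hM hm

theorem isReflection_of_odd_length {w : W} (h : Odd (cs.length w)) : cs.IsReflection w := by
  obtain ⟨k, h1, h2, rfl⟩ := exists_walk_eq cs hij hM hm w
  rw [length_walk cs hij hM (by omega)] at h
  exact isReflection_walk_of_odd cs i j (Int.natAbs_odd.mp h)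

/-- Elements of odd length are reflections, so elements whose lengths have opposite parity are
comparable in one step. For equal parity the chain passes through an element of length `ℓ(w) - 1`,
which parity keeps strictly above `y`. -/
theorem bruhatLE_iff {y w : W} : bruhatLE cs y w ↔ y = w ∨ cs.length y < cs.length w := by
  have hstep {y w : W} (h : cs.length y < cs.length w) (ho : Odd (cs.length y + cs.length w)) :
      bruhatLE cs y w := by
    refine Relation.ReflTransGen.single ⟨⟨y⁻¹ * w, ?_, by simp⟩, h⟩
    refine isReflection_of_odd_length cs hij hM hm ?_
    have := cs.length_mul_mod_two y⁻¹ w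
    rw [cs.length_inv] at this
    rw [Nat.odd_iff] at *
    omega
  constructor
  · intro h
    by_cases hyw : y = w
    · exact .inl hyw
    · exact .inr (bruhatLT_length cs ⟨h, hyw⟩)
  · rintro (rfl | h)
    · exact Relation.ReflTransGen.refl
    · rcases Nat.even_or_odd (cs.length y + cs.length w) with he | ho
      · have h2 := (exists_altProd cs hij hM hm w).1
        have hz : cs.length (altProd cs i j (cs.length w - 1)) = cs.length w - 1 :=
          length_altProd cs hij hM (by omega)
        have hy : cs.length y ≠ cs.length w - 1 := by
          intro hy
          rw [Nat.even_iff] at he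
          omega
        refine Relation.ReflTransGen.trans
          (hstep (w := altProd cs i j (cs.length w - 1)) (by omega) ?_)
          (hstep (by omega) ?_)
        · rw [Nat.even_iff] at he
          rw [Nat.odd_iff]; omega
        · rw [Nat.odd_iff]; omega
      · exact hstep h ho

variable [Fintype W]

open scoped Classical in
theorem klSum_indicator (w : W) :
    klSum cs w (fun y => if bruhatLE cs y w then 1 else 0) = ballElt cs w := by
  ext1 y
  rw [klSum_apply, ballElt_apply, bruhatLE_iff cs hij hM hm]
  by_cases h : w = y
  · subst h; simp [← two_mul]
  · by_cases hlt : cs.length y < cs.length w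
    · have h1 : vpow ((cs.length w : ℤ) - cs.length y) =
          vpow 1 ^ (cs.length w - cs.length y) := by
        rw [vpow, vpow, LaurentPolynomial.T_pow]
        congr 1; omega
      have h2 : (-1 : LaurentRing) ^ (cs.length w + cs.length y) =
          (-1) ^ (cs.length w - cs.length y) := by
        rw [show cs.length w + cs.length y = cs.length w - cs.length y + 2 * cs.length y by omega,
          pow_add, pow_mul]
        simp
      rw [if_pos (.inr hlt), if_neg h, if_pos hlt, h1, h2, map_one, mul_one, ← mul_pow,
        neg_one_mul]
    · rw [if_neg (by tauto), if_neg h, if_neg hlt, map_zero, mul_zero]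

open scoped Classical in
theorem isKLFamily_indicator (w : W) :
    IsKLFamily cs w (fun y => if bruhatLE cs y w then 1 else 0) := by
  refine ⟨if_pos Relation.ReflTransGen.refl, fun y hy => if_neg hy, fun y hy => ?_, ?_⟩
  · have := bruhatLT_length cs hy
    simp only [if_pos hy.1, Polynomial.natDegree_one]
    omega
  · rw [klSum_indicator cs hij hM hm, heckeBar_ballElt cs hij hM hm]

open scoped Classical in
theorem klPoly_eq (y w : W) : klPoly cs y w = if bruhatLE cs y w then 1 else 0 := by
  have h : ∃ P, IsKLFamily cs w P := ⟨_, isKLFamily_indicator cs hij hM hm w⟩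
  have huniq := IsKLFamily.unique cs
    (fun w => by rw [invStd_eq_barElt cs hij hM hm, barElt_apply_self])
    (fun w y h1 h2 => by rw [invStd_eq_barElt cs hij hM hm, barElt_apply_eq_zero cs h1 h2])
    (Classical.choose_spec h) (isKLFamily_indicator cs hij hM hm w)
  rw [klPoly, dif_pos h, huniq]

theorem klElt_eq_ballElt (w : W) : klElt cs w = ballElt cs w := by
  rw [klElt, ← klSum_indicator cs hij hM hm]
  simp only [klPoly_eq cs hij hM hm]

/-- The polynomial is `1`, of degree `0`, so the degree is maximal only when the lengths differ by
one. -/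
theorem klPrec_iff {y w : W} : klPrec cs y w ↔ cs.length w = cs.length y + 1 := by
  rw [klPrec, klPoly_eq cs hij hM hm]
  constructor
  · rintro ⟨h1, h2⟩
    rw [if_pos h1.1, Polynomial.natDegree_one] at h2
    omega
  · intro h
    have hlt : bruhatLT cs y w :=
      ⟨(bruhatLE_iff cs hij hM hm).mpr (.inr (by omega)), by rintro rfl; omega⟩
    refine ⟨hlt, ?_⟩
    rw [if_pos hlt.1, Polynomial.natDegree_one]
    omega

end DihedralCells

/-! ### The left cells -/

section LeftCells

variable {m : ℕ} {W : Type*} [Group W] {M : CoxeterMatrix (Fin 2)} (cs : CoxeterSystem M W)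
  {i j : Fin 2} (hij : i ≠ j) (hM : M i j = 2 * m) (hm : 0 < m)

/-- The alternating product with `k` factors that ends in `s_i`. -/
def endProd (i j : Fin 2) (k : ℕ) : W := if Odd k then altProd cs i j k else altProd cs j i k

/-- The set of nontrivial elements other than the longest one that end in `s_i`. -/
def endCell (i j : Fin 2) (m : ℕ) : Set W :=
  {x | ∃ k, 1 ≤ k ∧ k ≤ 2 * m - 1 ∧ x = endProd cs i j k}

include hij hM

theorem length_endProd {k : ℕ} (hk : k ≤ 2 * m) : cs.length (endProd cs i j k) = k := by
  rw [endProd]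
  split_ifs
  · exact length_altProd cs hij hM hk
  · exact length_altProd' cs hij hM hk

theorem isLeftDescent_altProd_iff {k : ℕ} (h1 : 1 ≤ k) (h2 : k < 2 * m) (b : Fin 2) :
    cs.IsLeftDescent (altProd cs i j k) b ↔ b = i := by
  obtain ⟨k, rfl⟩ := Nat.exists_eq_succ_of_ne_zero (by omega : k ≠ 0)
  have h3 := length_altProd cs hij hM h2.le
  rw [CoxeterSystem.IsLeftDescent, h3]
  rcases eq_or_eq_of_ne hij b with rfl | rfl
  · rw [simple_mul_altProd_succ, length_altProd' cs hij hM (by omega)]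
    simp
  · change cs.length (altProd cs b i (k.succ + 1)) < _ ↔ _
    rw [length_altProd' cs hij hM (by omega)]
    simp [hij.symm]

theorem isLeftDescent_endProd_iff {k : ℕ} (h1 : 1 ≤ k) (h2 : k < 2 * m) (b : Fin 2) :
    cs.IsLeftDescent (endProd cs i j k) b ↔ b = if Odd k then i else j := by
  rw [endProd]
  split_ifs
  · exact isLeftDescent_altProd_iff cs hij hM h1 h2 b
  · exact isLeftDescent_altProd_iff cs hij.symm (by rw [M.symmetric, hM]) h1 h2 b

theorem eq_endProd_of_length {w : W} (h : cs.length w ≠ 2 * m) (hm : 0 < m) :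
    cs.length w < 2 * m ∧
      (w = endProd cs i j (cs.length w) ∨ w = endProd cs j i (cs.length w)) := by
  obtain ⟨h1, h2⟩ := exists_altProd cs hij hM hm w
  refine ⟨by omega, ?_⟩
  rw [endProd, endProd]
  split_ifs
  · exact h2
  · exact h2.symm

include hm

theorem eq_longest_iff {w : W} : w = altProd cs i j (2 * m) ↔ cs.length w = 2 * m := by
  constructor
  · rintro rfl
    exact length_altProd cs hij hM le_rfl
  · intro h
    obtain ⟨-, h1 | h1⟩ := exists_altProd cs hij hM hm w
    · rw [h1, h]
    · rw [h1, h, altProd_longest cs hij hM]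

theorem mem_endCell_iff {w : W} : w ∈ endCell cs i j m ↔
    1 ≤ cs.length w ∧ cs.length w < 2 * m ∧ w = endProd cs i j (cs.length w) := by
  constructor
  · rintro ⟨k, h1, h2, rfl⟩
    rw [length_endProd cs hij hM (by omega)]
    exact ⟨h1, by omega, rfl⟩
  · rintro ⟨h1, h2, h⟩
    exact ⟨_, h1, by omega, h⟩

theorem isLeftDescent_of_length {w : W} (h : cs.length w = 2 * m) (b : Fin 2) :
    cs.IsLeftDescent w b := by
  have h1 := (exists_altProd cs hij hM hm (cs.simple b * w)).1
  rw [← h] at h1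
  exact lt_of_le_of_ne h1 (cs.length_simple_mul_ne w b)

variable [Fintype W]

/-- With the last letter fixed, consecutive lengths have different first letters. The left descent
sets are then distinct singletons, and the step is possible in both directions. -/
theorem leftStep_endProd {k l : ℕ} (hk : 1 ≤ k) (hk' : k < 2 * m) (hl : 1 ≤ l) (hl' : l < 2 * m)
    (h : l = k + 1 ∨ k = l + 1) : leftStep cs (endProd cs i j k) (endProd cs i j l) := by
  refine ⟨?_, if Odd k then i else j, ?_, ?_⟩
  · rw [klPrec_iff cs hij hM hm, klPrec_iff cs hij hM hm, length_endProd cs hij hM hk'.le,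
      length_endProd cs hij hM hl'.le]
    exact h
  · rw [isLeftDescent_endProd_iff cs hij hM hk hk']
  · rw [isLeftDescent_endProd_iff cs hij hM hl hl']
    rcases h with rfl | rfl
    · by_cases hk : Odd k <;> simp [hk, Nat.odd_add_one, hij, hij.symm]
    · by_cases hk : Odd l <;> simp [hk, Nat.odd_add_one, hij, hij.symm]

theorem leftLE_endProd_one {k : ℕ} (hk : 1 ≤ k) (hk' : k < 2 * m) :
    leftEquiv cs (endProd cs i j k) (endProd cs i j 1) := by
  induction k, hk using Nat.le_induction with
  | base => exact ⟨Relation.ReflTransGen.refl, Relation.ReflTransGen.refl⟩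
  | succ k hk ih =>
    obtain ⟨h1, h2⟩ := ih (by omega)
    exact ⟨Relation.ReflTransGen.head
        (leftStep_endProd cs hij hM hm (by omega) hk' hk (by omega) (.inr rfl)) h1,
      Relation.ReflTransGen.tail h2
        (leftStep_endProd cs hij hM hm hk (by omega) (by omega) hk' (.inl rfl))⟩

/-- The target is not `w₀`, which has every left descent. A neighbour with the other last letter has
the same first letter as `y`, so no left descent of `y` is lost. -/
theorem leftStep_of_mem_endCell {y w : W} (hy : y ∈ endCell cs i j m) (h : leftStep cs y w) :
    w = 1 ∨ w ∈ endCell cs i j m := by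
  obtain ⟨h1, b, h2, h3⟩ := h
  rw [klPrec_iff cs hij hM hm, klPrec_iff cs hij hM hm] at h1
  obtain ⟨hy1, hy2, hy⟩ := (mem_endCell_iff cs hij hM hm).mp hy
  refine or_iff_not_imp_left.mpr fun hw1 => ?_
  rw [← cs.length_eq_zero_iff] at hw1
  have hw2 : cs.length w ≠ 2 * m := fun h => h3 (isLeftDescent_of_length cs hij hM hm h b)
  obtain ⟨hw2, hw⟩ := eq_endProd_of_length cs hij hM hw2 hm
  rw [mem_endCell_iff cs hij hM hm]
  refine ⟨by omega, hw2, hw.resolve_right fun hw => ?_⟩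
  rw [hy, isLeftDescent_endProd_iff cs hij hM hy1 hy2] at h2
  rw [hw, isLeftDescent_endProd_iff cs hij.symm (by rw [M.symmetric, hM]) (by omega) hw2, h2] at h3
  rcases h1 with h1 | h1 <;> rw [h1] at h3
  · by_cases hk : Odd (cs.length y) <;> simp [hk, Nat.odd_add_one] at h3
  · by_cases hk : Odd (cs.length w) <;> simp [hk, Nat.odd_add_one] at h3

omit hij hM hm in
theorem eq_one_of_leftLE {w : W} (h : leftLE cs 1 w) : w = 1 := by
  induction h with
  | refl => rfl
  | tail _ h ih =>
    subst ih
    obtain ⟨-, b, h, -⟩ := h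
    exact absurd h (cs.not_isLeftDescent_one b)

theorem eq_of_leftLE_longest {y w : W} (hw : cs.length w = 2 * m) (h : leftLE cs y w) : y = w := by
  rcases Relation.ReflTransGen.cases_tail h with h | ⟨z, -, -, b, -, h⟩
  · exact h.symm
  · exact absurd (isLeftDescent_of_length cs hij hM hm hw b) h

theorem leftLE_of_mem_endCell {y w : W} (hy : y ∈ endCell cs i j m) (h : leftLE cs y w) :
    w = 1 ∨ w ∈ endCell cs i j m := by
  induction h with
  | refl => exact .inr hy
  | tail _ h ih =>
    rcases ih with rfl | ih
    · exact .inl (eq_one_of_leftLE cs (Relation.ReflTransGen.single h))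
    · exact leftStep_of_mem_endCell cs hij hM hm ih h

/-- Steps out of the set lead only to `1`, and there is no way back from `1`, which has no left
descent. -/
theorem leftClass_of_mem_endCell {w : W} (hw : w ∈ endCell cs i j m) :
    {y | leftEquiv cs y w} = endCell cs i j m := by
  ext y
  constructor
  · rintro ⟨h1, h2⟩
    refine (leftLE_of_mem_endCell cs hij hM hm hw h2).resolve_left ?_
    rintro rfl
    rw [eq_one_of_leftLE cs h1, mem_endCell_iff cs hij hM hm, cs.length_one] at hw
    omega
  · rintro ⟨k, h1, h2, rfl⟩
    obtain ⟨l, h3, h4, rfl⟩ := hw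
    have hk := leftLE_endProd_one cs hij hM hm h1 (by omega)
    have hl := leftLE_endProd_one cs hij hM hm h3 (by omega)
    exact ⟨hk.1.trans hl.2, hl.1.trans hk.2⟩

theorem isLeftCell_endCell : IsLeftCell cs (endCell cs i j m) :=
  ⟨endProd cs i j 1, (leftClass_of_mem_endCell cs hij hM hm ⟨1, le_rfl, by omega, rfl⟩).symm⟩

theorem isLeftCell_iff (Γ : Set W) : IsLeftCell cs Γ ↔ Γ = {1} ∨ Γ = endCell cs i j m ∨
    Γ = endCell cs j i m ∨ Γ = {altProd cs i j (2 * m)} := by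
  have hM' : M j i = 2 * m := by rw [M.symmetric, hM]
  have hone : ({1} : Set W) = {y | leftEquiv cs y 1} := by
    ext y
    constructor
    · rintro rfl
      exact ⟨Relation.ReflTransGen.refl, Relation.ReflTransGen.refl⟩
    · rintro ⟨-, h⟩
      exact eq_one_of_leftLE cs h
  have hlong (w : W) (hw : cs.length w = 2 * m) : ({w} : Set W) = {y | leftEquiv cs y w} := by
    ext y
    constructor
    · rintro rfl
      exact ⟨Relation.ReflTransGen.refl, Relation.ReflTransGen.refl⟩
    · rintro ⟨h, -⟩
      exact eq_of_leftLE_longest cs hij hM hm hw h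
  constructor
  · rintro ⟨w, rfl⟩
    by_cases h1 : w = 1
    · subst h1
      exact .inl hone.symm
    by_cases h2 : cs.length w = 2 * m
    · refine .inr (.inr (.inr ?_))
      rw [← hlong w h2, (eq_longest_iff cs hij hM hm).mpr h2]
    · rw [← cs.length_eq_zero_iff] at h1
      obtain ⟨h2, h | h⟩ := eq_endProd_of_length cs hij hM h2 hm
      · exact .inr (.inl (leftClass_of_mem_endCell cs hij hM hm ⟨_, by omega, by omega, h⟩))
      · exact .inr (.inr (.inl
          (leftClass_of_mem_endCell cs hij.symm hM' hm ⟨_, by omega, by omega, h⟩)))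
  · rintro (rfl | rfl | rfl | rfl)
    · exact ⟨1, hone⟩
    · exact isLeftCell_endCell cs hij hM hm
    · exact isLeftCell_endCell cs hij.symm hM' hm
    · exact ⟨_, hlong _ (length_altProd cs hij hM le_rfl)⟩

theorem ncard_leftCells : {Γ : Set W | IsLeftCell cs Γ}.ncard = 4 := by
  have hM' : M j i = 2 * m := by rw [M.symmetric, hM]
  have hset : {Γ : Set W | IsLeftCell cs Γ} = {{1}, endCell cs i j m, endCell cs j i m,
      {altProd cs i j (2 * m)}} := by
    ext Γ
    simpa using isLeftCell_iff cs hij hM hm Γ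
  have h1 : (1 : W) ∉ endCell cs i j m := by simp [mem_endCell_iff cs hij hM hm]
  have h2 : (1 : W) ∉ endCell cs j i m := by simp [mem_endCell_iff cs hij.symm hM' hm]
  have hl := length_altProd cs hij hM le_rfl
  have h3 : altProd cs i j (2 * m) ∉ endCell cs i j m := by
    rw [mem_endCell_iff cs hij hM hm]; omega
  have h4 : altProd cs i j (2 * m) ∉ endCell cs j i m := by
    rw [mem_endCell_iff cs hij.symm hM' hm]; omega
  have h5 : altProd cs i j (2 * m) ≠ 1 := by
    rw [Ne, ← cs.length_eq_zero_iff]; omega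
  have h6 : altProd cs i j 1 ∈ endCell cs i j m := ⟨1, le_rfl, by omega, by simp [endProd]⟩
  have h7 : altProd cs i j 1 ∉ endCell cs j i m := by
    rw [mem_endCell_iff cs hij.symm hM' hm, length_altProd cs hij hM (by omega)]
    simpa [endProd] using fun _ => altProd_ne cs hij hM le_rfl (by omega)
  rw [hset, Set.ncard_insert_of_notMem, Set.ncard_insert_of_notMem, Set.ncard_pair]
  · intro h; exact h4 (h ▸ rfl)
  · simp only [Set.mem_insert_iff, Set.mem_singleton_iff, not_or]
    exact ⟨fun h => h7 (h ▸ h6), fun h => h3 (h ▸ rfl)⟩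
  · simp only [Set.mem_insert_iff, Set.mem_singleton_iff, not_or]
    exact ⟨fun h => h1 (h ▸ rfl), fun h => h2 (h ▸ rfl), fun h => h5.symm (by simpa using h)⟩

-- The rotations in the cell are its elements of even length `2, 4, …, 2m - 2`, one for each length.
omit [Fintype W] in
theorem ncard_rotations_inter_endCell :
    ({w | ∃ a : ℤ, w = walk cs i j (2 * a)} ∩ endCell cs i j m).ncard = m - 1 := by
  have hset : {w | ∃ a : ℤ, w = walk cs i j (2 * a)} ∩ endCell cs i j m =
      (fun a : ℕ => altProd cs j i (2 * a)) '' Finset.Icc 1 (m - 1) := by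
    ext w
    constructor
    · rintro ⟨⟨a, rfl⟩, k, h1, h2, h⟩
      rcases Nat.even_or_odd' k with ⟨k, rfl | rfl⟩
      · refine ⟨k, ?_, ?_⟩
        · simp; omega
        · rw [h, endProd, if_neg (by simp)]
      · rw [endProd, if_pos (by simp), altProd_eq_walk, walk_eq_walk_iff cs hij hM] at h
        obtain ⟨c, hc⟩ := h
        have : (1 : ℤ) = 2 * (a - k - 2 * m * c) := by
          push_cast at hc
          linarith
        omega
    · rintro ⟨a, ha, rfl⟩
      simp only [Finset.coe_Icc, Set.mem_Icc] at ha
      refine ⟨⟨-a, ?_⟩, 2 * a, by omega, by omega, ?_⟩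
      · simp only
        rw [altProd_eq_walk, walk_swap cs i j]
        congr 1; push_cast; ring
      · rw [endProd, if_neg (by simp)]
  rw [hset, Set.InjOn.ncard_image, Set.ncard_coe_finset]
  · simp
  · intro a ha b hb h
    simp only [Finset.coe_Icc, Set.mem_Icc] at ha hb
    have h' := congrArg cs.length h
    simp only at h'
    rw [length_altProd' cs hij hM (by omega), length_altProd' cs hij hM (by omega)] at h'
    omega

end LeftCells

/-! ### Specialisation at `v = 1` and a trace formula for cells -/

@[simp] theorem specOne_vpow (n : ℤ) : specOne (vpow n) = 1 := by
  rw [specOne, vpow, LaurentPolynomial.eval₂_T, one_zpow, Units.val_one]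

section General

variable {B : Type*} {M : CoxeterMatrix B} {W : Type*} [Group W] (cs : CoxeterSystem M W)

/-- The correction `v - v⁻¹` dies at `v = 1`, so `T_s` becomes left translation of the group
algebra. -/
theorem specOne_leftMulSimple (i : B) (h : HeckeModule W) (z : W) :
    specOne (leftMulSimple cs i h z) = specOne (h (cs.simple i * z)) := by
  classical
  induction h using Finsupp.induction_linear with
  | zero => simp
  | add h h' ih ih' => simp [ih, ih']
  | single w a =>
    have hw : (Finsupp.single w a : HeckeModule W) = a • stdElt w := by
      rw [stdElt, Finsupp.smul_single, smul_eq_mul, mul_one]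
    have hz : cs.simple i * w = z ↔ w = cs.simple i * z := by
      constructor
      · rintro rfl; simp
      · rintro rfl; simp
    rw [hw, map_smul]
    by_cases hlt : cs.length w < cs.length (cs.simple i * w)
    · rw [leftMulSimple_stdElt_of_lt cs hlt]
      simp only [Finsupp.smul_apply, stdElt_apply, hz]
    · rw [leftMulSimple_stdElt_of_not_lt cs hlt]
      simp only [Finsupp.smul_apply, Finsupp.add_apply, stdElt_apply, hz, smul_eq_mul, map_mul,
        map_add, map_sub, specOne_vpow, sub_self, zero_mul, add_zero]

theorem specOne_leftMulStd (w : W) (h : HeckeModule W) (z : W) :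
    specOne (leftMulStd cs w h z) = specOne (h (w⁻¹ * z)) := by
  have key (ω : List B) : ∀ z, specOne ((ω.map (leftMulSimple cs)).prod h z) =
      specOne (h ((cs.wordProd ω)⁻¹ * z)) := by
    induction ω with
    | nil => simp
    | cons b ω ih =>
      intro z
      rw [List.map_cons, List.prod_cons, Module.End.mul_apply, specOne_leftMulSimple, ih,
        cs.wordProd_cons]
      simp [mul_assoc]
  have hw : cs.wordProd (redWord cs w) = w := (Classical.choose_spec (cs.exists_isReduced w)).2.symm
  rw [leftMulStd, key, hw]

theorem heckeMul_stdElt (w : W) : heckeMul cs (stdElt w) = leftMulStd cs w := by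
  rw [heckeMul, stdElt, Finsupp.linearCombination_single, one_smul]

variable [Fintype W]

theorem klBasis_apply (w : W) : klBasis cs w = klElt cs w := by
  rw [klBasis, Module.Basis.mk_apply]

-- Both sides are linear in `h` and agree at the elements `C_x`. The formula lets `T_w` act without
-- being expanded in the Kazhdan-Lusztig basis.
open scoped Classical in
theorem cellAction_apply (Γ : Set W) (h : HeckeModule W) (y : Γ) :
    cellAction cs Γ h (Finsupp.single y 1) =
      ∑ z : Γ, (klBasis cs).repr (heckeMul cs h (klElt cs y)) z • Finsupp.single z 1 := by
  let F : HeckeModule W →ₗ[LaurentRing] (Γ →₀ LaurentRing) :=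
    ∑ z : Γ, ((klBasis cs).coord z ∘ₗ (heckeMul cs).flip (klElt cs y)).smulRight
      (Finsupp.single z 1)
  have hF : (cellAction cs Γ).flip (Finsupp.single y 1) = F := by
    refine (klBasis cs).ext fun x => ?_
    rw [LinearMap.flip_apply, cellAction, Module.Basis.constr_basis,
      Finsupp.linearCombination_single, one_smul]
    simp [F, klStructure, klBasis_apply]
  have := LinearMap.congr_fun hF h
  rw [LinearMap.flip_apply] at this
  rw [this]
  simp [F]

/-- The coordinate of an element with respect to `C_y`, at `v = 1`. -/
def klCoord (y : W) (h : HeckeModule W) : ℚ := specOne ((klBasis cs).repr h y)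

theorem klCoord_add (y : W) (h h' : HeckeModule W) :
    klCoord cs y (h + h') = klCoord cs y h + klCoord cs y h' := by simp [klCoord]

theorem klCoord_sub (y : W) (h h' : HeckeModule W) :
    klCoord cs y (h - h') = klCoord cs y h - klCoord cs y h' := by simp [klCoord]

theorem klCoord_smul (y : W) (a : LaurentRing) (h : HeckeModule W) :
    klCoord cs y (a • h) = specOne a * klCoord cs y h := by simp [klCoord]

theorem klCoord_eq_sum (y : W) (h : HeckeModule W) :
    klCoord cs y h = ∑ z, specOne (h z) * klCoord cs y (stdElt z) := by
  have hh : h = ∑ z, h z • (stdElt z : HeckeModule W) := by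
    conv_lhs => rw [← Finsupp.sum_single h]
    rw [Finsupp.sum_fintype _ _ (by simp)]
    simp [stdElt]
  conv_lhs => rw [hh]
  simp [klCoord]

open scoped Classical in
theorem klCoord_klElt (y w : W) : klCoord cs y (klElt cs w) = if w = y then 1 else 0 := by
  rw [klCoord, ← klBasis_apply, Module.Basis.repr_self, Finsupp.single_apply]
  split_ifs <;> simp

-- At `v = 1` the diagonal entry at `y` is the `C_y`-coordinate of `w C_y`; expanding `C_y` in the
-- standard basis leaves only coordinates of group elements.
open scoped Classical in
theorem cellMatrix_trace (Γ : Set W) (w : W) : (cellMatrix cs Γ w).trace =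
    ∑ y with y ∈ Γ, ∑ x, specOne (klElt cs y x) * klCoord cs y (stdElt (w * x)) := by
  have hentry (y : Γ) : cellMatrix cs Γ w y y =
      ∑ x, specOne (klElt cs (y : W) x) * klCoord cs y (stdElt (w * x)) := by
    have h1 : cellMatrix cs Γ w y y = klCoord cs y (leftMulStd cs w (klElt cs y)) := by
      rw [cellMatrix, Matrix.map_apply, LinearMap.toMatrix_apply, Finsupp.coe_basisSingleOne,
        cellAction_apply, heckeMul_stdElt, klCoord]
      congr 1
      simp [Finsupp.finsetSum_apply, Finsupp.single_apply]
    rw [h1, klCoord_eq_sum, ← Equiv.sum_comp (Equiv.mulLeft w)]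
    simp [specOne_leftMulStd]
  rw [Matrix.trace, Finset.sum_subtype (p := (· ∈ Γ)) (Finset.univ.filter (· ∈ Γ)) (by simp)]
  exact Finset.sum_congr rfl fun y _ => hentry y

end General

/-! ### Cell characters as induced sign characters -/

section CellCharacters

variable {m : ℕ} {W : Type*} [Group W] {M : CoxeterMatrix (Fin 2)} (cs : CoxeterSystem M W)
  {i j : Fin 2} (hij : i ≠ j) (hM : M i j = 2 * m) (hm : 0 < m)

theorem endProd_mul_simple {k : ℕ} (i j : Fin 2) :
    endProd cs i j (k + 1) * cs.simple i = endProd cs j i k := by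
  rw [endProd, endProd]
  rcases Nat.even_or_odd k with hk | hk
  · rw [if_pos hk.add_one, if_neg (by simpa using hk), altProd_eq_walk, altProd_eq_walk,
      ← walk_one cs i j, walk_mul_of_odd cs i j (by exact_mod_cast hk.add_one)]
    congr 1; push_cast; ring
  · rw [if_neg (by simpa using hk.add_one), if_pos hk, altProd_eq_walk, altProd_eq_walk,
      ← walk_neg_one cs j i, walk_mul_of_even cs j i (by exact_mod_cast hk.add_one)]
    congr 1; push_cast; ring

@[simp] theorem endProd_zero (i j : Fin 2) : endProd cs i j 0 = 1 := by
  simp [endProd, altProd]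

include hij hM

theorem endProd_ne {n : ℕ} (h1 : 1 ≤ n) (h2 : n < 2 * m) :
    endProd cs i j n ≠ endProd cs j i n := by
  rw [endProd, endProd]
  split_ifs
  · exact altProd_ne cs hij hM h1 h2
  · exact (altProd_ne cs hij hM h1 h2).symm

theorem endProd_longest : endProd cs i j (2 * m) = altProd cs i j (2 * m) := by
  rw [endProd, if_neg (by simp), altProd_longest cs hij hM]

include hm

theorem exists_endProd (w : W) : ∃ k, 1 ≤ k ∧ k ≤ 2 * m ∧
    (w = endProd cs i j k ∨ w = endProd cs i j k * cs.simple i) := by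
  by_cases h : cs.length w = 2 * m
  · refine ⟨2 * m, by omega, le_rfl, .inl ?_⟩
    rw [endProd_longest cs hij hM, eq_longest_iff cs hij hM hm, h]
  · obtain ⟨h1, h2⟩ := eq_endProd_of_length cs hij hM h hm
    rcases Nat.eq_zero_or_pos (cs.length w) with h0 | h0
    · refine ⟨1, le_rfl, by omega, .inr ?_⟩
      rw [endProd_mul_simple cs, endProd_zero, ← cs.length_eq_zero_iff, h0]
    · rcases h2 with h2 | h2
      · exact ⟨_, h0, h1.le, .inl h2⟩
      · refine ⟨cs.length w + 1, by omega, by omega, .inr ?_⟩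
        rw [endProd_mul_simple cs, ← h2]

variable [Fintype W]

/-- The elements ending in `s_i`, with `w₀` included, are the longer representatives of the left
cosets of `{1, s_i}`. -/
theorem sum_eq_sum_endProd {A : Type*} [AddCommMonoid A] (f : W → A) :
    ∑ x, f x = ∑ k ∈ Finset.Icc 1 (2 * m),
      (f (endProd cs i j k) + f (endProd cs i j k * cs.simple i)) := by
  classical
  have hM' : M j i = 2 * m := by rw [M.symmetric, hM]
  have hlen {k : ℕ} (h1 : 1 ≤ k) (h2 : k ≤ 2 * m) :
      cs.length (endProd cs i j k * cs.simple i) + 1 = k := by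
    obtain ⟨k, rfl⟩ := Nat.exists_eq_succ_of_ne_zero (by omega : k ≠ 0)
    rw [endProd_mul_simple cs, length_endProd cs hij.symm hM' (by omega)]
  rw [Finset.sum_add_distrib, ← Finset.sum_image (f := f) (g := fun k => endProd cs i j k),
    ← Finset.sum_image (f := f) (g := fun k => endProd cs i j k * cs.simple i),
    ← Finset.sum_union]
  · refine (Finset.sum_congr ?_ fun _ _ => rfl)
    refine (Finset.eq_univ_iff_forall.mpr fun w => ?_).symm
    obtain ⟨k, h1, h2, h | h⟩ := exists_endProd cs hij hM hm w
    · exact Finset.mem_union_left _ (Finset.mem_image.mpr ⟨k, by simp; omega, h.symm⟩)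
    · exact Finset.mem_union_right _ (Finset.mem_image.mpr ⟨k, by simp; omega, h.symm⟩)
  · rw [Finset.disjoint_left]
    intro w hw hw'
    obtain ⟨k, hk, rfl⟩ := Finset.mem_image.mp hw
    obtain ⟨l, hl, h⟩ := Finset.mem_image.mp hw'
    rw [Finset.mem_Icc] at hk hl
    have h3 := hlen hl.1 hl.2
    rw [h, length_endProd cs hij hM hk.2] at h3
    subst h3
    rw [endProd_mul_simple cs] at h
    exact endProd_ne cs hij hM hk.1 (by omega) h.symm
  · intro k hk l hl h
    simp only [Finset.coe_Icc, Set.mem_Icc] at hk hl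
    have h3 := hlen hk.1 hk.2
    have h4 := hlen hl.1 hl.2
    simp only at h
    rw [h] at h3
    omega
  · intro k hk l hl h
    simp only [Finset.coe_Icc, Set.mem_Icc] at hk hl
    have := congrArg cs.length h
    simp only at this
    rwa [length_endProd cs hij hM hk.2, length_endProd cs hij hM hl.2] at this

/-- The signs disappear in this basis: rewriting the two standard elements of a sphere contributes
two copies of the inner ball, against the one subtracted by the recursion. -/
theorem klCoord_signedBall (y : W) {n : ℕ} (hn : n ≤ 2 * m) :
    klCoord cs y (signedBall cs n) = if cs.length y < n then 1 else 0 := by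
  classical
  have hstd (z : W) : (stdElt z : HeckeModule W) =
      klElt cs z + vpow 1 • signedBall cs (cs.length z) := by
    rw [klElt_eq_ballElt cs hij hM hm, ballElt]; simp
  induction n with
  | zero => simp [klCoord]
  | succ n ih =>
    rw [signedBall_succ, klCoord_sub, klCoord_smul, specOne_vpow, one_mul, ih (by omega)]
    rcases Nat.eq_zero_or_pos n with rfl | h0
    · rw [sum_length_eq_zero, hstd, cs.length_one, signedBall_zero, smul_zero, add_zero,
        klCoord_klElt]
      simp only [Nat.lt_one_iff, cs.length_eq_zero_iff, zero_add, Nat.not_lt_zero, if_false,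
        sub_zero, eq_comm]
    · rw [sum_length_eq cs hij hM _ h0 (by omega), klCoord_add, hstd, hstd, klCoord_add,
        klCoord_add, klCoord_smul, klCoord_smul, klCoord_klElt, klCoord_klElt, specOne_vpow,
        length_altProd cs hij hM (by omega), length_altProd' cs hij hM (by omega),
        ih (by omega)]
      have hne := altProd_ne cs hij hM h0 (by omega)
      have a1 : altProd cs i j n = y → cs.length y = n := by
        rintro rfl; exact length_altProd cs hij hM (by omega)
      have a2 : altProd cs j i n = y → cs.length y = n := by
        rintro rfl; exact length_altProd' cs hij hM (by omega)
      rcases lt_trichotomy (cs.length y) n with h | h | h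
      · rw [if_neg (mt a1 h.ne), if_neg (mt a2 h.ne), if_pos h, if_pos (by omega)]
        norm_num
      · rw [if_neg (by omega : ¬ cs.length y < n), if_pos (by omega : cs.length y < n + 1)]
        rcases (exists_altProd cs hij hM hm y).2 with h' | h' <;> rw [h] at h'
        · rw [if_pos h'.symm, if_neg (by rw [h']; exact hne.symm)]; norm_num
        · rw [if_neg (by rw [h']; exact hne), if_pos h'.symm]; norm_num
      · rw [if_neg (mt a1 h.ne'), if_neg (mt a2 h.ne'), if_neg (by omega : ¬ cs.length y < n),
          if_neg (by omega)]
        norm_num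

open scoped Classical in
theorem klCoord_stdElt (y z : W) : klCoord cs y (stdElt z) =
    if y = z ∨ cs.length y < cs.length z then 1 else 0 := by
  have hstd : (stdElt z : HeckeModule W) =
      klElt cs z + vpow 1 • signedBall cs (cs.length z) := by
    rw [klElt_eq_ballElt cs hij hM hm, ballElt]; simp
  rw [hstd, klCoord_add, klCoord_smul, klCoord_klElt, specOne_vpow,
    klCoord_signedBall cs hij hM hm y (exists_altProd cs hij hM hm z).1]
  by_cases h : y = z
  · subst h; simp
  · simp [h, Ne.symm h]

open scoped Classical in
theorem specOne_klElt (y x : W) : specOne (klElt cs y x) =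
    if y = x then 1 else if cs.length x < cs.length y then
      (-1) ^ (cs.length y - cs.length x) else 0 := by
  rw [klElt_eq_ballElt cs hij hM hm, ballElt_apply]
  split_ifs <;> simp

open scoped Classical in
/-- The contribution of `y` to the trace of `w` on the cell that contains `y`. -/
def cellTerm (w y : W) : ℚ := ∑ x, specOne (klElt cs y x) * klCoord cs y (stdElt (w * x))

omit hij hM hm in
theorem cellChar_singleton (w y : W) : cellChar cs {y} w = (cellTerm cs w y : ℂ) := by
  classical
  have hset (s : Finset W) (hs : ∀ x, x ∈ s ↔ x = y) : s = {y} := by ext; simp [hs]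
  rw [cellChar, cellMatrix_trace, hset (Finset.filter _ _) (by simp), Finset.sum_singleton,
    cellTerm]

theorem cellTerm_one (w : W) : cellTerm cs w 1 = 1 := by
  classical
  rw [cellTerm, Finset.sum_eq_single 1]
  · rw [specOne_klElt cs hij hM hm, klCoord_stdElt cs hij hM hm, if_pos rfl, if_pos, one_mul]
    rcases Nat.eq_zero_or_pos (cs.length w) with h | h
    · rw [cs.length_eq_zero_iff] at h; simp [h]
    · right; simpa using h
  · intro x _ hx
    rw [specOne_klElt cs hij hM hm, if_neg hx.symm, if_neg (by simp), zero_mul]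
  · simp

/-- No element is longer than `w₀`, so only the `x` with `w x = w₀` contributes, with sign
`(-1)^(ℓ(w₀) - ℓ(x))`; as `ℓ(w₀) = 2m` is even, this is the sign of `w`. -/
theorem cellTerm_longest (w : W) :
    cellTerm cs w (altProd cs i j (2 * m)) = (-1) ^ cs.length w := by
  classical
  set y := altProd cs i j (2 * m) with hy
  have hl : cs.length y = 2 * m := length_altProd cs hij hM le_rfl
  have hmax (x : W) := (exists_altProd cs hij hM hm x).1
  have hpar := cs.length_mul_mod_two w⁻¹ y
  rw [cs.length_inv, hl] at hpar
  have hsign (n : ℕ) (hn : n % 2 = cs.length w % 2) : (-1 : ℚ) ^ n = (-1) ^ cs.length w := by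
    rw [neg_one_pow_eq_pow_mod_two, hn, ← neg_one_pow_eq_pow_mod_two]
  rw [cellTerm, Finset.sum_eq_single (w⁻¹ * y)]
  · rw [specOne_klElt cs hij hM hm, klCoord_stdElt cs hij hM hm, 
      if_pos (show y = w * (w⁻¹ * y) ∨ _ from .inl (by simp)), mul_one]
    have := hmax (w⁻¹ * y)
    split_ifs with h1 h2
    · rw [← hsign 0, pow_zero]
      rw [← h1, hl] at hpar
      omega
    · exact hsign _ (by omega)
    · exact absurd ((eq_longest_iff cs hij hM hm).mpr (by omega)).symm h1
  · intro x _ hx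
    rw [klCoord_stdElt cs hij hM hm, if_neg, mul_zero]
    rintro (h | h)
    · exact hx (by rw [h]; simp)
    · have := hmax (w * x); omega
  · simp

/-- Adjoining `w₀` completes the cell to all elements with right descent `s_i`, whose total trace
has a closed form; the added term is the sign character. -/
theorem cellChar_endCell_eq_sum (w : W) : cellChar cs (endCell cs i j m) w =
    ((∑ k ∈ Finset.Icc 1 (2 * m), cellTerm cs w (endProd cs i j k) - (-1) ^ cs.length w : ℚ) : ℂ) := by
  classical
  have hinj : Set.InjOn (fun k => endProd cs i j k) (Finset.Icc 1 (2 * m - 1) : Finset ℕ) := by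
    intro k hk l hl h
    simp only [Finset.coe_Icc, Set.mem_Icc] at hk hl
    have := congrArg cs.length h
    simp only at this
    rwa [length_endProd cs hij hM (by omega), length_endProd cs hij hM (by omega)] at this
  have hset : (Finset.univ.filter (· ∈ endCell cs i j m)) =
      (Finset.Icc 1 (2 * m - 1)).image (fun k => endProd cs i j k) := by
    ext w
    simp only [Finset.mem_filter, Finset.mem_univ, true_and, Finset.mem_image, Finset.mem_Icc,
      and_assoc, eq_comm (b := w)]
    exact Iff.rfl
  have hIcc : Finset.Icc 1 (2 * m) = insert (2 * m) (Finset.Icc 1 (2 * m - 1)) := by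
    ext k; simp; omega
  rw [cellChar, cellMatrix_trace, hset, Finset.sum_image hinj, hIcc,
    Finset.sum_insert (by simp; omega), endProd_longest cs hij hM, cellTerm_longest cs hij hM hm]
  simp only [cellTerm]
  ring_nf

/-- For `y` ending in `s_i`, the coefficients of `C_y` at `x` and `x s_i` are opposite at `v = 1`,
so the sum over `W` becomes a sum over cosets of `{1, s_i}`. -/
theorem cellTerm_endProd (w : W) {k : ℕ} (hk : k ∈ Finset.Icc 1 (2 * m)) :
    cellTerm cs w (endProd cs i j k) = ∑ l ∈ Finset.Icc 1 (2 * m), if l ≤ k then (-1) ^ (k + l) *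
      (klCoord cs (endProd cs i j k) (stdElt (w * endProd cs i j l)) -
        klCoord cs (endProd cs i j k) (stdElt (w * endProd cs i j l * cs.simple i))) else 0 := by
  have hM' : M j i = 2 * m := by rw [M.symmetric, hM]
  rw [cellTerm, sum_eq_sum_endProd cs hij hM hm]
  refine Finset.sum_congr rfl fun l hl => ?_
  rw [Finset.mem_Icc] at hk hl
  obtain ⟨l, rfl⟩ := Nat.exists_eq_succ_of_ne_zero (by omega : l ≠ 0)
  rw [Nat.succ_eq_add_one] at *
  have h1 : specOne (klElt cs (endProd cs i j k) (endProd cs i j (l + 1))) =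
      if l + 1 ≤ k then (-1) ^ (k + (l + 1)) else 0 := by
    rw [specOne_klElt cs hij hM hm, length_endProd cs hij hM hk.2, length_endProd cs hij hM hl.2]
    rcases lt_trichotomy k (l + 1) with h | rfl | h
    · rw [if_neg, if_neg (by omega), if_neg (by omega)]
      intro h'
      have := congrArg cs.length h'
      rw [length_endProd cs hij hM hk.2, length_endProd cs hij hM hl.2] at this
      omega
    · rw [if_pos rfl, if_pos le_rfl, ← two_mul, pow_mul]; norm_num
    · rw [if_neg, if_pos h, if_pos h.le, show k + (l + 1) = k - (l + 1) + 2 * (l + 1) by omega,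
        pow_add, pow_mul]
      · norm_num
      · intro h'
        have := congrArg cs.length h'
        rw [length_endProd cs hij hM hk.2, length_endProd cs hij hM hl.2] at this
        omega
  have h2 : specOne (klElt cs (endProd cs i j k) (endProd cs i j (l + 1) * cs.simple i)) =
      if l + 1 ≤ k then -(-1) ^ (k + (l + 1)) else 0 := by
    rw [endProd_mul_simple cs, specOne_klElt cs hij hM hm, length_endProd cs hij hM hk.2,
      length_endProd cs hij.symm hM' (by omega)]
    rw [if_neg]
    · by_cases h : l < k
      · rw [if_pos h, if_pos (show l + 1 ≤ k from h), show k + (l + 1) = k - l + 1 + 2 * l by omega, pow_add, pow_mul,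
          pow_succ]
        norm_num
      · rw [if_neg h, if_neg (by omega)]
    · intro h'
      have := congrArg cs.length h'
      rw [length_endProd cs hij hM hk.2, length_endProd cs hij.symm hM' (by omega)] at this
      subst this
      exact endProd_ne cs hij hM hk.1 (by omega) h'
  rw [h1, h2, mul_assoc]
  split_ifs <;> ring

-- The alternating triangular matrix inverts the bidiagonal matrix of ones: two neighbouring terms
-- cancel unless `l = n`. The term `k = n - 1` may leave the range when `n = 1`, but then `l ≤ k`
-- fails anyway.
omit hij hM hm [Fintype W] in
theorem sum_alternating (N : ℕ) {l n : ℕ} (hl : 1 ≤ l) (hn : 1 ≤ n) (hn' : n ≤ N) :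
    ∑ k ∈ Finset.Icc 1 N, (if l ≤ k then (-1 : ℚ) ^ (k + l) *
      ((if k = n then 1 else 0) + if k + 1 = n then 1 else 0) else 0) =
      if l = n then 1 else 0 := by
  have h (k : ℕ) : (if l ≤ k then (-1 : ℚ) ^ (k + l) *
      ((if k = n then 1 else 0) + if k + 1 = n then 1 else 0) else 0) =
      (if k = n then (if l ≤ n then (-1 : ℚ) ^ (n + l) else 0) else 0) +
      (if k = n - 1 then (if l ≤ n - 1 then (-1 : ℚ) ^ (n - 1 + l) else 0) else 0) := by
    have e : k + 1 = n ↔ k = n - 1 := by omega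
    simp only [e]
    by_cases h1 : k = n
    · subst h1
      simp [show ¬ k = k - 1 by omega]
    · rw [if_neg h1, if_neg h1]
      by_cases h2 : k = n - 1
      · subst h2; simp
      · simp [h2]
  simp only [h]
  rw [Finset.sum_add_distrib, Finset.sum_ite_eq', Finset.sum_ite_eq', if_pos (by simp; omega)]
  rcases lt_trichotomy l n with h1 | rfl | h1
  · rw [if_pos h1.le, if_pos (by simp; omega), if_pos (by omega), if_neg h1.ne,
      show n + l = n - 1 + l + 1 by omega, pow_succ]
    ring
  · rw [if_pos le_rfl, ← two_mul, pow_mul]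
    simp; omega
  · rw [if_neg (by omega), if_neg (by omega : ¬ l ≤ n - 1), if_neg h1.ne']
    simp

-- The difference of the coordinates at `u` and `u s_i` is, up to sign, nonzero only for two
-- adjacent values of `k`. Summing with alternating signs isolates the coset of `u`, with a sign
-- that tells `u` from `u s_i`.
open scoped Classical in
theorem sum_klCoord_endProd (u : W) {l : ℕ} (hl : 1 ≤ l) (hl' : l ≤ 2 * m) :
    ∑ k ∈ Finset.Icc 1 (2 * m), (if l ≤ k then (-1) ^ (k + l) *
      (klCoord cs (endProd cs i j k) (stdElt u) -
        klCoord cs (endProd cs i j k) (stdElt (u * cs.simple i))) else 0) =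
      (if u = endProd cs i j l then 1 else 0) -
        if u * cs.simple i = endProd cs i j l then 1 else 0 := by
  have hM' : M j i = 2 * m := by rw [M.symmetric, hM]
  have hinj {k n : ℕ} (hk : k ≤ 2 * m) (hn : n ≤ 2 * m) :
      endProd cs i j k = endProd cs i j n ↔ k = n := by
    refine ⟨fun h => ?_, fun h => h ▸ rfl⟩
    have := congrArg cs.length h
    rwa [length_endProd cs hij hM hk, length_endProd cs hij hM hn] at this
  have hne {k n : ℕ} (hk : 1 ≤ k) (hk' : k ≤ 2 * m) (hn : n < 2 * m) :
      endProd cs i j k ≠ endProd cs j i n := by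
    intro h
    have := congrArg cs.length h
    rw [length_endProd cs hij hM hk', length_endProd cs hij.symm hM' hn.le] at this
    subst this
    exact endProd_ne cs hij hM hk hn h
  have key (n : ℕ) (hn : n + 1 ≤ 2 * m) {k : ℕ} (hk : k ∈ Finset.Icc 1 (2 * m)) :
      klCoord cs (endProd cs i j k) (stdElt (endProd cs i j (n + 1))) -
        klCoord cs (endProd cs i j k) (stdElt (endProd cs j i n)) =
      (if k = n + 1 then 1 else 0) + if k + 1 = n + 1 then 1 else 0 := by
    rw [Finset.mem_Icc] at hk
    rw [klCoord_stdElt cs hij hM hm, klCoord_stdElt cs hij hM hm, length_endProd cs hij hM hk.2,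
      length_endProd cs hij hM hn, length_endProd cs hij.symm hM' (by omega), hinj hk.2 hn]
    simp only [hne hk.1 hk.2 hn, false_or]
    rcases lt_trichotomy k n with h | h | h
    · rw [if_pos (by omega), if_pos h, if_neg (by omega), if_neg (by omega)]; norm_num
    · rw [if_pos (by omega), if_neg (by omega), if_neg (by omega), if_pos (by omega)]; norm_num
    · rw [if_neg (by omega : ¬ k < n), if_neg (by omega : ¬ k + 1 = n + 1)]
      by_cases h' : k = n + 1
      · rw [if_pos (.inl h'), if_pos h']; norm_num
      · rw [if_neg (by omega), if_neg h']; norm_num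
  have hneg (k : ℕ) (c : ℚ) : (if l ≤ k then (-1) ^ (k + l) * -c else 0) =
      -(if l ≤ k then (-1) ^ (k + l) * c else 0) := by split_ifs <;> ring
  obtain ⟨n, hn, hn', rfl | rfl⟩ := exists_endProd cs hij hM hm u <;>
    obtain ⟨n, rfl⟩ := Nat.exists_eq_succ_of_ne_zero (by omega : n ≠ 0) <;>
    rw [Nat.succ_eq_add_one] at *
  · rw [endProd_mul_simple cs, if_neg (hne hl hl' (by omega)).symm, sub_zero, hinj hn' hl',
      Finset.sum_congr rfl fun k hk => by rw [key n hn' hk],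
      sum_alternating (2 * m) hl hn hn']
    simp only [eq_comm]
  · rw [cs.simple_mul_simple_cancel_right, endProd_mul_simple cs,
      if_neg (hne hl hl' (by omega)).symm, zero_sub, hinj hn' hl',
      Finset.sum_congr rfl fun k hk => by rw [← neg_sub, key n hn' hk, hneg],
      Finset.sum_neg_distrib, sum_alternating (2 * m) hl hn hn']
    simp only [eq_comm]

-- The right-hand side is the character induced from the sign of `⟨s_i⟩`: over the `2m` coset
-- representatives `x`, the identity counts `1` and each solution of `w = x s_i x⁻¹` counts `-1`.
open scoped Classical in
theorem sum_cellTerm_endProd (w : W) :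
    ∑ k ∈ Finset.Icc 1 (2 * m), cellTerm cs w (endProd cs i j k) =
      (if w = 1 then (2 * m : ℚ) else 0) - ((Finset.Icc 1 (2 * m)).filter fun l =>
        w = endProd cs i j l * cs.simple i * (endProd cs i j l)⁻¹).card := by
  rw [Finset.sum_congr rfl fun k hk => cellTerm_endProd cs hij hM hm w hk, Finset.sum_comm,
    Finset.sum_congr rfl fun l hl => sum_klCoord_endProd cs hij hM hm (w * endProd cs i j l)
      (Finset.mem_Icc.mp hl).1 (Finset.mem_Icc.mp hl).2, Finset.sum_sub_distrib]
  congr 1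
  · simp
  · rw [Finset.sum_boole]
    congr 3
    ext l
    rw [mul_assoc, ← eq_mul_inv_iff_mul_eq, mul_inv_rev, cs.inv_simple, ← mul_assoc]

end CellCharacters

/-! ### Explicit values of the cell characters -/

section CellCharacterValues

variable {m : ℕ} {W : Type*} [Group W] {M : CoxeterMatrix (Fin 2)} (cs : CoxeterSystem M W)
  {i j : Fin 2} (hij : i ≠ j) (hM : M i j = 2 * m) (hm : 0 < m)

/-- In both cases the index is `1` modulo `4`: the conjugates of `s_i` and those of `s_j` are
separated by the index modulo `4`. -/
theorem endProd_conj (i j : Fin 2) (l : ℕ) :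
    endProd cs i j l * cs.simple i * (endProd cs i j l)⁻¹ =
      walk cs i j (if Odd l then 2 * l - 1 else 1 - 2 * l) := by
  rw [endProd]
  split_ifs with h
  · have h' : Odd (l : ℤ) := by exact_mod_cast h
    rw [altProd_eq_walk, ← walk_one cs i j, walk_inv_of_odd cs i j h', walk_mul_of_odd cs i j h',
      walk_mul_of_even cs i j (h'.sub_odd odd_one)]
    congr 1; ring
  · have h' : Even (-l : ℤ) := by
      rw [even_neg]; exact_mod_cast Nat.not_odd_iff_even.mp h
    rw [altProd_eq_walk, walk_swap cs i j, ← walk_one cs i j, walk_inv_of_even cs i j h',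
      walk_mul_of_even cs i j h', walk_mul_of_odd cs i j (h'.add_odd odd_one)]
    congr 1; ring

include hij hM hm

theorem neg_one_pow_length_walk {R : Type*} [Ring R] (k : ℤ) :
    (-1 : R) ^ cs.length (walk cs i j k) = if Even k then 1 else -1 := by
  obtain ⟨l, h1, h2, h⟩ := exists_walk_eq cs hij hM hm (walk cs i j k)
  obtain ⟨c, hc⟩ := (walk_eq_walk_iff cs hij hM).mp h
  have hpar : Even k ↔ Even l.natAbs := by
    rw [Int.natAbs_even, show l = k + 2 * (2 * m * c) by linarith, Int.even_add]
    simp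
  rw [← h, length_walk cs hij hM (by omega)]
  split_ifs with he
  · exact (hpar.mp he).neg_one_pow
  · exact (Nat.not_even_iff_odd.mp (mt hpar.mpr he)).neg_one_pow

variable [Fintype W]

open scoped Classical in
theorem cellChar_endCell_apply (w : W) : cellChar cs (endCell cs i j m) w =
    (if w = 1 then (2 * m : ℂ) else 0) - ((Finset.Icc 1 (2 * m)).filter fun l : ℕ =>
        w = walk cs i j (if Odd l then 2 * l - 1 else 1 - 2 * l)).card -
      (-1) ^ cs.length w := by
  rw [cellChar_endCell_eq_sum cs hij hM hm, sum_cellTerm_endProd cs hij hM hm]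
  simp only [endProd_conj]
  push_cast
  split_ifs <;> simp

theorem cellChar_endCell_rotation (a : ℤ) : cellChar cs (endCell cs i j m) (walk cs i j (2 * a)) =
    (if (2 * m : ℤ) ∣ a then (2 * m : ℂ) else 0) - 1 := by
  classical
  have hone : walk cs i j (2 * a) = 1 ↔ (2 * m : ℤ) ∣ a := by
    rw [← walk_zero cs i j, walk_eq_walk_iff cs hij hM, sub_zero,
      show (4 * m : ℤ) = 2 * (2 * m) by ring, mul_dvd_mul_iff_left two_ne_zero]
  have hempty : ((Finset.Icc 1 (2 * m)).filter fun l : ℕ =>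
      walk cs i j (2 * a) = walk cs i j (if Odd l then 2 * l - 1 else 1 - 2 * l)) = ∅ := by
    refine Finset.filter_eq_empty_iff.mpr fun l _ h => ?_
    obtain ⟨c, hc⟩ := (walk_eq_walk_iff cs hij hM).mp h
    have hc' : (4 * m : ℤ) * c = 2 * (2 * m * c) := by ring
    split_ifs at hc <;> omega
  rw [cellChar_endCell_apply cs hij hM hm, hempty, neg_one_pow_length_walk cs hij hM hm,
    if_pos (even_two_mul a)]
  simp [hone]

theorem cellChar_endCell_reflection (b : ℤ) :
    cellChar cs (endCell cs i j m) (walk cs i j (4 * b + 1)) = -1 := by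
  classical
  have hb1 := Int.emod_nonneg b (by omega : (m : ℤ) ≠ 0)
  have hb2 := Int.emod_lt_of_pos b (by omega : (0 : ℤ) < m)
  -- Reducing `b` modulo `m` lets the solutions `l` in `1, …, 2m` be written down.
  have hb : walk cs i j (4 * b + 1) = walk cs i j (4 * (b % m) + 1) := by
    rw [walk_eq_walk_iff cs hij hM]
    exact ⟨b / m, by linear_combination -4 * Int.emod_add_mul_ediv b m⟩
  rw [hb]
  obtain ⟨n, hn⟩ := Int.eq_ofNat_of_zero_le hb1
  rw [hn] at hb1 hb2 ⊢
  have hodd : ¬ Even (4 * (n : ℤ) + 1) := by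
    rw [Int.not_even_iff_odd]; exact ⟨2 * n, by ring⟩
  have hone : walk cs i j (4 * n + 1) ≠ 1 := by
    rw [← walk_zero cs i j, Ne, walk_eq_walk_iff cs hij hM, sub_zero]
    rintro ⟨c, hc⟩
    have hc' : (4 * m : ℤ) * c = 4 * (m * c) := by ring
    omega
  -- Each conjugate of `s_i` arises from two cosets of `⟨s_i⟩`, which differ by the central element
  -- `w₀`; one of the two values of `l` is odd and the other even.
  have hset : ((Finset.Icc 1 (2 * m)).filter fun l : ℕ =>
      walk cs i j (4 * n + 1) = walk cs i j (if Odd l then 2 * l - 1 else 1 - 2 * l)) =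
      {2 * n + 1, 2 * m - 2 * n} := by
    ext l
    rw [Finset.mem_filter, Finset.mem_Icc, walk_eq_walk_iff cs hij hM, Finset.mem_insert,
      Finset.mem_singleton]
    constructor
    · rintro ⟨⟨h1, h2⟩, c, hc⟩
      have hpos {x : ℤ} (hx : x = m * c) (h1 : -(m : ℤ) < x) (h2 : x < m) : x = 0 := by
        exact Int.eq_zero_of_abs_lt_dvd ⟨c, hx⟩ (abs_lt.mpr ⟨h1, h2⟩)
      have hpos' {x : ℤ} (hx : x = m * (c - 1)) (h1 : -(m : ℤ) < x) (h2 : x < m) : x = 0 := by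
        exact Int.eq_zero_of_abs_lt_dvd ⟨c - 1, hx⟩ (abs_lt.mpr ⟨h1, h2⟩)
      rcases Nat.even_or_odd' l with ⟨l, rfl | rfl⟩
      · rw [if_neg (by simp)] at hc
        have := hpos' (x := n + l - m) (by push_cast at hc; linarith) (by omega) (by omega)
        omega
      · rw [if_pos (by simp)] at hc
        have := hpos (x := n - l) (by push_cast at hc; linarith) (by omega) (by omega)
        omega
    · rintro (rfl | rfl)
      · refine ⟨by omega, 0, ?_⟩
        rw [if_pos (by simp)]; push_cast; ring
      · refine ⟨by omega, 1, ?_⟩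
        rw [if_neg (by rw [← Nat.mul_sub]; simp), Nat.cast_sub (by omega)]; push_cast; ring
  rw [cellChar_endCell_apply cs hij hM hm, hset, neg_one_pow_length_walk cs hij hM hm,
    if_neg hodd, if_neg hone, Finset.card_pair (by omega)]
  norm_num

theorem cellChar_endCell_reflection' (b : ℤ) :
    cellChar cs (endCell cs i j m) (walk cs i j (4 * b - 1)) = 1 := by
  classical
  have hodd : ¬ Even (4 * b - 1) := by
    rw [Int.not_even_iff_odd]; exact ⟨2 * b - 1, by ring⟩
  have hone : walk cs i j (4 * b - 1) ≠ 1 := by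
    rw [← walk_zero cs i j, Ne, walk_eq_walk_iff cs hij hM, sub_zero]
    rintro ⟨c, hc⟩
    have hc' : (4 * m : ℤ) * c = 4 * (m * c) := by ring
    omega
  have hempty : ((Finset.Icc 1 (2 * m)).filter fun l : ℕ =>
      walk cs i j (4 * b - 1) = walk cs i j (if Odd l then 2 * l - 1 else 1 - 2 * l)) = ∅ := by
    refine Finset.filter_eq_empty_iff.mpr fun l _ h => ?_
    obtain ⟨c, hc⟩ := (walk_eq_walk_iff cs hij hM).mp h
    have hc' : (4 * m : ℤ) * c = 4 * (m * c) := by ring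
    rcases Nat.even_or_odd' l with ⟨l, rfl | rfl⟩
    · rw [if_neg (by simp)] at hc; push_cast at hc; omega
    · rw [if_pos (by simp)] at hc; push_cast at hc; omega
  rw [cellChar_endCell_apply cs hij hM hm, hempty, neg_one_pow_length_walk cs hij hM hm,
    if_neg hodd, if_neg hone]
  norm_num

theorem cellChar_one : cellChar cs {1} = fun _ => 1 := by
  funext w
  rw [cellChar_singleton, cellTerm_one cs hij hM hm]; simp

theorem cellChar_longest : cellChar cs {altProd cs i j (2 * m)} = fun w => (-1) ^ cs.length w := by
  funext w
  rw [cellChar_singleton, cellTerm_longest cs hij hM hm]; simp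

end CellCharacterValues

/-! ### Invariant subspaces and eigenvectors -/

section Irreducible

variable {G V : Type*} [Group G] [AddCommGroup V] [Module ℂ V] (ρ : Representation ℂ G V)

theorem isIrreducible_of_forall_submodule [Nontrivial V]
    (h : ∀ S : Submodule ℂ V, (∀ g, ∀ x ∈ S, ρ g x ∈ S) → S ≠ ⊥ → S = ⊤) : ρ.IsIrreducible := by
  have : Nontrivial (Subrepresentation ρ) :=
    ⟨⊥, ⊤, fun h => bot_ne_top (α := Submodule ℂ V) (congrArg Subrepresentation.toSubmodule h)⟩
  refine ⟨fun S => or_iff_not_imp_left.mpr fun hS => ?_⟩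
  refine Subrepresentation.toSubmodule_injective (h S.toSubmodule ?_ ?_)
  · exact fun g x hx => S.apply_mem_toSubmodule g hx
  · exact fun h => hS (Subrepresentation.toSubmodule_injective h)

theorem eq_top_of_isIrreducible (hρ : ρ.IsIrreducible) {S : Submodule ℂ V}
    (hS : ∀ g, ∀ x ∈ S, ρ g x ∈ S) (hne : S ≠ ⊥) : S = ⊤ := by
  rcases hρ.eq_bot_or_eq_top ⟨S, fun g _ hx => hS g _ hx⟩ with h | h
  · exact absurd (congrArg Subrepresentation.toSubmodule h) hne
  · exact congrArg Subrepresentation.toSubmodule h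

theorem nontrivial_of_isIrreducible (hρ : ρ.IsIrreducible) : Nontrivial V := by
  by_contra h
  rw [not_nontrivial_iff_subsingleton] at h
  refine bot_ne_top (α := Subrepresentation ρ) (Subrepresentation.toSubmodule_injective ?_)
  exact Subsingleton.elim _ _

theorem apply_apply_inv (g : G) (x : V) : ρ g (ρ g⁻¹ x) = x := by
  rw [← Module.End.mul_apply, ← map_mul, mul_inv_cancel, map_one, Module.End.one_apply]

theorem eigenvalue_ne_zero {g : G} {v : V} (hv : v ≠ 0) {ζ : ℂ} (h : ρ g v = ζ • v) : ζ ≠ 0 := by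
  rintro rfl
  refine hv ?_
  have := apply_apply_inv ρ g⁻¹ v
  rwa [inv_inv, h, zero_smul, map_zero, eq_comm] at this

theorem zpow_apply_eigenvector {g : G} {v : V} (hv : v ≠ 0) {ζ : ℂ} (h : ρ g v = ζ • v) (a : ℤ) :
    ρ (g ^ a) v = ζ ^ a • v := by
  have h0 := eigenvalue_ne_zero ρ hv h
  have hinv : ρ g⁻¹ v = ζ⁻¹ • v := by
    have := apply_apply_inv ρ g⁻¹ v
    rw [inv_inv, h, map_smul] at this
    rw [eq_inv_smul_iff₀ h0, this]
  induction a with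
  | zero => simp
  | succ a ih =>
    rw [zpow_add_one, map_mul, Module.End.mul_apply, h, map_smul, ih, zpow_add_one₀ h0, smul_smul,
      mul_comm]
  | pred a ih =>
    rw [zpow_sub_one, map_mul, Module.End.mul_apply, hinv, map_smul, ih, zpow_sub_one₀ h0,
      smul_smul, mul_comm]

theorem linear_mem_irrChars (f : G →* ℤˣ) :
    (fun g => (((f g : ℤˣ) : ℤ) : ℂ)) ∈ irrChars G := by
  let ρ : Representation ℂ G (Fin 1 → ℂ) :=
    { toFun := fun g => (((f g : ℤˣ) : ℤ) : ℂ) • LinearMap.id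
      map_one' := by simp; rfl
      map_mul' := fun g h => by
        simp only [map_mul, Units.val_mul, Int.cast_mul]
        rw [Module.End.mul_eq_comp, LinearMap.smul_comp, LinearMap.comp_smul, smul_smul]
        rfl }
  refine ⟨1, ρ, ?_, ?_⟩
  · refine isIrreducible_of_forall_submodule ρ fun S _ hne => ?_
    obtain ⟨x, hx, hx0⟩ := S.ne_bot_iff.mp hne
    rw [eq_top_iff]
    intro y _
    have h0 : x 0 ≠ 0 := by
      intro h
      refine hx0 ?_
      ext a
      rw [Subsingleton.elim a 0, h]; rfl
    convert S.smul_mem (y 0 / x 0) hx using 1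
    ext a
    rw [Subsingleton.elim a 0, Pi.smul_apply, smul_eq_mul, div_mul_cancel₀ _ h0]
  · funext g
    have hg : ρ g = (((f g : ℤˣ) : ℤ) : ℂ) • LinearMap.id := rfl
    rw [Representation.character, hg, map_smul, LinearMap.trace_id]
    simp

end Irreducible

/-! ### Irreducible representations of the dihedral group -/

section DihedralIrreducible

variable {m : ℕ} {W : Type*} [Group W] {M : CoxeterMatrix (Fin 2)} (cs : CoxeterSystem M W)
  {i j : Fin 2}

theorem simple_mul_zpow_apply {V : Type*} [AddCommGroup V] [Module ℂ V]
    (ρ : Representation ℂ W V) {v : V} (hv : v ≠ 0) {ζ : ℂ}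
    (hr : ρ (cs.simple i * cs.simple j) v = ζ • v) (a : ℤ) :
    ρ ((cs.simple i * cs.simple j) ^ a) (ρ (cs.simple i) v) = ζ ^ (-a) • ρ (cs.simple i) v := by
  rw [← Module.End.mul_apply, ← map_mul]
  have := simple_mul_zpow cs i j (-a)
  rw [neg_neg] at this
  rw [← this, map_mul, Module.End.mul_apply, zpow_apply_eigenvector ρ hv hr, map_smul]

theorem trace_eq_of_basis {V : Type*} [AddCommGroup V] [Module ℂ V] (b : Module.Basis (Fin 2) ℂ V)
    (f : V →ₗ[ℂ] V) : LinearMap.trace ℂ V f = b.repr (f (b 0)) 0 + b.repr (f (b 1)) 1 := by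
  rw [LinearMap.trace_eq_matrix_trace ℂ b, Matrix.trace, Fin.sum_univ_two]
  simp [LinearMap.toMatrix_apply]

/-- In a basis `v, s_i v` with `v` an eigenvector of `s_i s_j`, rotations are diagonal with inverse
entries and reflections are antidiagonal. -/
theorem character_of_basis {V : Type*} [AddCommGroup V] [Module ℂ V]
    (ρ : Representation ℂ W V) (b : Module.Basis (Fin 2) ℂ V) {ζ : ℂ}
    (hr : ρ (cs.simple i * cs.simple j) (b 0) = ζ • b 0) (hs : ρ (cs.simple i) (b 0) = b 1)
    (a : ℤ) : ρ.character (walk cs i j (2 * a)) = ζ ^ a + ζ ^ (-a) ∧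
      ρ.character (walk cs i j (2 * a + 1)) = 0 := by
  have h0 := zpow_apply_eigenvector ρ (b.ne_zero 0) hr a
  have h1 := simple_mul_zpow_apply cs ρ (b.ne_zero 0) hr a
  rw [hs] at h1
  have hs' : ρ (cs.simple i) (b 1) = b 0 := by
    rw [← hs, ← Module.End.mul_apply, ← map_mul, cs.simple_mul_simple_self, map_one,
      Module.End.one_apply]
  constructor
  · rw [walk_two_mul, Representation.character, trace_eq_of_basis b, h0, h1]
    simp
  · rw [walk_two_mul_add_one, Representation.character, trace_eq_of_basis b, map_mul,
      Module.End.mul_apply, Module.End.mul_apply, hs, hs', h0, h1]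
    simp

variable (hij : i ≠ j)

include hij

theorem forall_apply_mem {V : Type*} [AddCommGroup V] [Module ℂ V]
    (ρ : Representation ℂ W V) {S : Submodule ℂ V} (hi : ∀ x ∈ S, ρ (cs.simple i) x ∈ S)
    (hj : ∀ x ∈ S, ρ (cs.simple j) x ∈ S) (g : W) : ∀ x ∈ S, ρ g x ∈ S := by
  induction g using cs.simple_induction_left with
  | one => simp
  | mul_simple_left w b ih =>
    intro x hx
    rw [map_mul, Module.End.mul_apply]
    rcases eq_or_eq_of_ne hij b with rfl | rfl
    · exact hi _ (ih x hx)
    · exact hj _ (ih x hx)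

variable (hM : M i j = 2 * m)

include hM

theorem isLiftable_of_pow_eq_one {N : Type*} [Monoid N] (x y : N) (hx : x * x = 1) (hy : y * y = 1)
    (hxy : (x * y) ^ (2 * m) = 1) : M.IsLiftable (fun b => if b = i then x else y) := by
  have hyx : (y * x) ^ (2 * m) = 1 := by
    have h1 : (x * y) * (y * x) = 1 := by rw [mul_assoc, ← mul_assoc y, hy, one_mul, hx]
    have h2 : (y * x) * (x * y) = 1 := by rw [mul_assoc, ← mul_assoc x, hx, one_mul, hy]
    have hc : Commute (x * y) (y * x) := h1.trans h2.symm
    have := hc.mul_pow (2 * m)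
    rwa [h1, one_pow, hxy, one_mul, eq_comm] at this
  intro a b
  rcases eq_or_eq_of_ne hij a with rfl | rfl <;> rcases eq_or_eq_of_ne hij b with rfl | rfl
  · simp [hx]
  · simpa only [hM, if_true, hij.symm, if_false] using hxy
  · rw [M.symmetric, hM]
    simpa only [if_true, hij.symm, if_false] using hyx
  · simp [hij.symm, hy]

theorem exists_signHom (α β : ℤˣ) : ∃ f : W →* ℤˣ, f (cs.simple i) = α ∧ f (cs.simple j) = β := by
  have hl := isLiftable_of_pow_eq_one hij hM α β (Int.units_mul_self α) (Int.units_mul_self β)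
    (by rw [pow_mul, Int.units_sq, one_pow])
  refine ⟨cs.lift ⟨_, hl⟩, ?_, ?_⟩
  · rw [cs.lift_apply_simple hl, if_pos rfl]
  · rw [cs.lift_apply_simple hl, if_neg hij.symm]

theorem exists_dihedralRepresentation {ζ : ℂ} (hζ : ζ ^ (2 * m) = 1) (hm : 0 < m) :
    ∃ ρ : Representation ℂ W (Fin 2 → ℂ),
      (∀ a : ℤ, ρ.character (walk cs i j (2 * a)) = ζ ^ a + ζ ^ (-a)) ∧
      (∀ a : ℤ, ρ.character (walk cs i j (2 * a + 1)) = 0) ∧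
      (ζ ^ 2 ≠ 1 → ρ.IsIrreducible) := by
  have h0 : ζ ≠ 0 := by
    rintro rfl
    rw [zero_pow (by omega)] at hζ
    exact zero_ne_one hζ
  have hxy : !![0, 1; 1, 0] * !![0, ζ⁻¹; ζ, 0] = Matrix.diagonal ![ζ, ζ⁻¹] := by
    ext a b; fin_cases a <;> fin_cases b <;> simp [Matrix.mul_apply]
  have hl := isLiftable_of_pow_eq_one hij hM (!![0, 1; 1, 0] : Matrix (Fin 2) (Fin 2) ℂ)
    !![0, ζ⁻¹; ζ, 0] (by ext a b; fin_cases a <;> fin_cases b <;> simp [Matrix.mul_apply])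
    (by ext a b; fin_cases a <;> fin_cases b <;> simp [Matrix.mul_apply, h0])
    (by
      rw [hxy, Matrix.diagonal_pow]
      ext a b; fin_cases a <;> fin_cases b <;> simp [hζ])
  let ρ : Representation ℂ W (Fin 2 → ℂ) :=
    (Matrix.toLinAlgEquiv' (R := ℂ) (n := Fin 2)).toAlgHom.toMonoidHom.comp (cs.lift ⟨_, hl⟩)
  have hi (x : Fin 2 → ℂ) : ρ (cs.simple i) x = ![x 1, x 0] := by
    change Matrix.toLinAlgEquiv' (cs.lift ⟨_, hl⟩ (cs.simple i)) x = _
    rw [cs.lift_apply_simple hl, if_pos rfl, Matrix.toLinAlgEquiv'_apply]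
    ext a; fin_cases a <;> simp [Matrix.mulVec, dotProduct]
  have hj (x : Fin 2 → ℂ) : ρ (cs.simple j) x = ![ζ⁻¹ * x 1, ζ * x 0] := by
    change Matrix.toLinAlgEquiv' (cs.lift ⟨_, hl⟩ (cs.simple j)) x = _
    rw [cs.lift_apply_simple hl, if_neg hij.symm, Matrix.toLinAlgEquiv'_apply]
    ext a; fin_cases a <;> simp [Matrix.mulVec, dotProduct]
  have hr (x : Fin 2 → ℂ) : ρ (cs.simple i * cs.simple j) x = ![ζ * x 0, ζ⁻¹ * x 1] := by
    rw [map_mul, Module.End.mul_apply, hj, hi]; simp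
  have hchar := character_of_basis cs ρ (Pi.basisFun ℂ (Fin 2)) (i := i) (j := j) (ζ := ζ)
    (by rw [hr]; ext a; fin_cases a <;> simp) (by rw [hi]; ext a; fin_cases a <;> simp)
  refine ⟨ρ, fun a => (hchar a).1, fun a => (hchar a).2, fun h2 => ?_⟩
  refine isIrreducible_of_forall_submodule ρ fun S hS hne => ?_
  obtain ⟨x, hx, hx0⟩ := S.ne_bot_iff.mp hne
  have hsub : ζ - ζ⁻¹ ≠ 0 := by
    intro h
    refine h2 ?_
    rw [sq]
    nth_rewrite 2 [sub_eq_zero.mp h]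
    exact mul_inv_cancel₀ h0
  have hrx := hS (cs.simple i * cs.simple j) x hx
  rw [hr] at hrx
  have swap {y : Fin 2 → ℂ} (hy : y ∈ S) : ![y 1, y 0] ∈ S := by
    have := hS (cs.simple i) y hy
    rwa [hi] at this
  -- The operator `s_i s_j - ζ⁻¹` kills the second coordinate and scales the first by `ζ - ζ⁻¹ ≠ 0`.
  -- If the first coordinate of `x` is zero, swapping the coordinates of `x` already gives the
  -- vector.
  have he : ![(1 : ℂ), 0] ∈ S := by
    by_cases h : x 0 = 0
    · have h1 : x 1 ≠ 0 := by
        intro h1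
        refine hx0 ?_
        ext a; fin_cases a
        · exact h
        · exact h1
      have := swap (S.smul_mem (x 1)⁻¹ hx)
      convert this using 1
      ext a; fin_cases a <;> simp [h, h1]
    · have := S.smul_mem ((ζ - ζ⁻¹) * x 0)⁻¹ (S.sub_mem hrx (S.smul_mem ζ⁻¹ hx))
      convert this using 1
      ext a; fin_cases a
      · simp only [Fin.zero_eta, Matrix.cons_val_zero, Pi.smul_apply, Pi.sub_apply, smul_eq_mul,
          ← sub_mul]
        rw [inv_mul_cancel₀ (mul_ne_zero hsub h)]
      · simp only [Fin.mk_one, Matrix.cons_val_one, Matrix.cons_val_fin_one, Pi.smul_apply,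
          Pi.sub_apply, smul_eq_mul, sub_self, mul_zero]
  have he' := swap he
  rw [eq_top_iff]
  intro y _
  have := S.add_mem (S.smul_mem (y 0) he) (S.smul_mem (y 1) he')
  convert this using 1
  ext a; fin_cases a <;> simp

/-- Let `v` be an eigenvector of `s_i s_j` and `u = s_i v`. The span of `v` and `u` is invariant,
hence everything. If they are independent the degree is `2` and the eigenvalue determines the
character; otherwise `v` spans an invariant line on which both generators act by signs. -/
theorem irrChars_classification {ψ : W → ℂ} (hψ : ψ ∈ irrChars W) :
    (∃ f : W →* ℤˣ, ψ = fun g => (((f g : ℤˣ) : ℤ) : ℂ)) ∨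
    ∃ ζ : ℂ, ζ ^ (2 * m) = 1 ∧ ζ ^ 2 ≠ 1 ∧ (∀ a : ℤ, ψ (walk cs i j (2 * a)) = ζ ^ a + ζ ^ (-a)) ∧
      ∀ a : ℤ, ψ (walk cs i j (2 * a + 1)) = 0 := by
  obtain ⟨n, ρ, hρ, rfl⟩ := hψ
  have := nontrivial_of_isIrreducible ρ hρ
  obtain ⟨ζ, hζ⟩ := Module.End.exists_eigenvalue (ρ (cs.simple i * cs.simple j))
  obtain ⟨v, hv⟩ := hζ.exists_hasEigenvector
  have hv0 : v ≠ 0 := hv.2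
  have hr : ρ (cs.simple i * cs.simple j) v = ζ • v := hv.apply_eq_smul
  have h0 := eigenvalue_ne_zero ρ hv0 hr
  have hinvol (b : Fin 2) (x : Fin n → ℂ) : ρ (cs.simple b) (ρ (cs.simple b) x) = x := by
    rw [← Module.End.mul_apply, ← map_mul, cs.simple_mul_simple_self, map_one,
      Module.End.one_apply]
  set u := ρ (cs.simple i) v with hu
  have hjv : ρ (cs.simple j) v = ζ • u := by
    rw [hu, ← map_smul, ← hr, map_mul, Module.End.mul_apply, hinvol]
  have hju : ρ (cs.simple j) u = ζ⁻¹ • v := by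
    rw [eq_inv_smul_iff₀ h0, ← map_smul, ← hjv, hinvol]
  by_cases hlin : LinearIndependent ℂ ![v, u]
  · right
    have htop : Submodule.span ℂ {v, u} = ⊤ := by
      refine eq_top_of_isIrreducible ρ hρ (forall_apply_mem cs hij ρ ?_ ?_) ?_
      · intro x hx
        obtain ⟨a, b, rfl⟩ := Submodule.mem_span_pair.mp hx
        rw [map_add, map_smul, map_smul, ← hu, hu, hinvol, ← hu]
        exact Submodule.mem_span_pair.mpr ⟨b, a, by rw [add_comm]⟩
      · intro x hx
        obtain ⟨a, b, rfl⟩ := Submodule.mem_span_pair.mp hx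
        rw [map_add, map_smul, map_smul, hjv, hju]
        exact Submodule.mem_span_pair.mpr ⟨b * ζ⁻¹, a * ζ, by simp only [mul_smul]; rw [add_comm]⟩
      · rw [Submodule.ne_bot_iff]
        exact ⟨v, Submodule.subset_span (by simp), hv0⟩
    have hspan : ⊤ ≤ Submodule.span ℂ (Set.range ![v, u]) := by
      rw [Matrix.range_cons_cons_empty, htop]
    have hb0 : Module.Basis.mk hlin hspan 0 = v := by simp
    have hb1 : Module.Basis.mk hlin hspan 1 = u := by simp
    have hchar := character_of_basis cs ρ (Module.Basis.mk hlin hspan) (i := i) (j := j) (ζ := ζ)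
      (by rw [hb0, hr]) (by rw [hb0, hb1])
    refine ⟨ζ, ?_, fun h2 => ?_, fun a => (hchar a).1, fun a => (hchar a).2⟩
    · have h1 := zpow_apply_eigenvector ρ hv0 hr (2 * m : ℕ)
      rw [zpow_natCast, zpow_natCast, ← hM, cs.simple_mul_simple_pow, map_one,
        Module.End.one_apply, hM] at h1
      by_contra hne
      refine hv0 ((smul_eq_zero.mp (?_ : (ζ ^ (2 * m) - 1) • v = 0)).resolve_left
        (sub_ne_zero.mpr hne))
      rw [sub_smul, ← h1, one_smul, sub_self]
    -- If `ζ² = 1`, then `v + u` is a common eigenvector of both generators, contradicting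
    -- irreducibility in degree `2`.
    · have hinv : ζ⁻¹ = ζ := inv_eq_of_mul_eq_one_right (by rw [← sq, h2])
      have hne : v + u ≠ 0 := by
        intro h
        have := (LinearIndependent.pair_iff.mp hlin 1 1 (by simpa using h)).1
        exact one_ne_zero this
      have htop' : Submodule.span ℂ {v + u} = ⊤ := by
        refine eq_top_of_isIrreducible ρ hρ (forall_apply_mem cs hij ρ ?_ ?_) ?_
        · intro x hx
          obtain ⟨a, rfl⟩ := Submodule.mem_span_singleton.mp hx
          rw [map_smul, map_add, ← hu, hu, hinvol, ← hu, add_comm]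
          exact Submodule.mem_span_singleton.mpr ⟨a, rfl⟩
        · intro x hx
          obtain ⟨a, rfl⟩ := Submodule.mem_span_singleton.mp hx
          rw [map_smul, map_add, hjv, hju, hinv, ← smul_add, smul_smul, add_comm u]
          exact Submodule.mem_span_singleton.mpr ⟨_, rfl⟩
        · rw [Submodule.ne_bot_iff]
          exact ⟨v + u, Submodule.subset_span rfl, hne⟩
      obtain ⟨a, ha⟩ := Submodule.mem_span_singleton.mp
        (htop' ▸ Submodule.mem_top : v ∈ Submodule.span ℂ {v + u})
      have h3 := LinearIndependent.pair_iff.mp hlin (a - 1) a (by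
        rw [smul_add] at ha
        linear_combination (norm := module) ha)
      rw [h3.2] at h3
      norm_num at h3
  · left
    obtain ⟨α, hα⟩ : ∃ α : ℂ, u = α • v := by
      rw [LinearIndependent.pair_iff' hv0] at hlin
      push Not at hlin
      obtain ⟨α, hα⟩ := hlin
      exact ⟨α, hα.symm⟩
    have hunit (γ : ℂ) (b : Fin 2) (h : ρ (cs.simple b) v = γ • v) :
        ∃ η : ℤˣ, γ = ((η : ℤ) : ℂ) := by
      have h1 := hinvol b v
      rw [h, map_smul, h, smul_smul] at h1
      have h2 : γ * γ = 1 := by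
        by_contra hne
        refine hv0 ((smul_eq_zero.mp (?_ : (γ * γ - 1) • v = 0)).resolve_left
          (sub_ne_zero.mpr hne))
        rw [sub_smul, h1, one_smul, sub_self]
      rcases mul_self_eq_one_iff.mp h2 with rfl | rfl
      · exact ⟨1, by simp⟩
      · exact ⟨-1, by simp⟩
    obtain ⟨η, rfl⟩ := hunit α i (hu ▸ hα)
    rw [hα, smul_smul] at hjv
    obtain ⟨θ, hθ⟩ := hunit _ j hjv
    rw [hθ] at hjv
    obtain ⟨f, hf1, hf2⟩ := exists_signHom cs hij hM η θ
    have hfv (g : W) : ρ g v = ((f g : ℤ) : ℂ) • v := by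
      induction g using cs.simple_induction_left with
      | one => simp
      | mul_simple_left w b ih =>
        rw [map_mul, Module.End.mul_apply, ih, map_smul, map_mul]
        rcases eq_or_eq_of_ne hij b with rfl | rfl
        · rw [← hu, hα, hf1, smul_smul]; push_cast; rw [mul_comm]
        · rw [hjv, hf2, smul_smul]; push_cast; rw [mul_comm]
    have hS (x) (hx : x ∈ Submodule.span ℂ {v}) (g : W) : ρ g x = ((f g : ℤ) : ℂ) • x := by
      obtain ⟨a, rfl⟩ := Submodule.mem_span_singleton.mp hx
      rw [map_smul, hfv, smul_comm]
    have htop : Submodule.span ℂ {v} = ⊤ := by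
      refine eq_top_of_isIrreducible ρ hρ (fun g x hx => ?_) ?_
      · rw [hS x hx]
        exact Submodule.smul_mem _ _ hx
      · rw [Submodule.ne_bot_iff]
        exact ⟨v, Submodule.subset_span rfl, hv0⟩
    have hrank : Module.finrank ℂ (Fin n → ℂ) = 1 :=
      finrank_eq_one v hv0 fun w => Submodule.mem_span_singleton.mp (htop ▸ Submodule.mem_top)
    refine ⟨f, funext fun g => ?_⟩
    have hg : ρ g = ((f g : ℤ) : ℂ) • LinearMap.id :=
      LinearMap.ext fun x => hS x (htop ▸ Submodule.mem_top) g
    rw [Representation.character, hg, map_smul, LinearMap.trace_id, hrank]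
    simp

end DihedralIrreducible

/-! ### Sums of powers of a root of unity -/

section RootOfUnitySums

theorem sub_one_mul_sum_pow_add_inv {z : ℂ} (hz : z ≠ 0) (n : ℕ) :
    (z - 1) * (1 + ∑ k ∈ Finset.Icc 1 n, (z ^ k + (z ^ k)⁻¹)) = z ^ (n + 1) - (z ^ n)⁻¹ := by
  induction n with
  | zero => simp
  | succ n ih =>
    rw [Finset.sum_Icc_succ_top (by omega), ← add_assoc, mul_add, ih]
    field_simp
    ring

/-- The left side is the sum of `z ^ k` over all residues `k` modulo `2n`; the residues `0` and `n`
are their own negatives and so stand alone. -/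
theorem sum_pow_add_inv_of_even {z : ℂ} {n : ℕ} (hn : 0 < n) (hz : z ^ (2 * n) = 1) :
    1 + z ^ n + ∑ k ∈ Finset.Icc 1 (n - 1), (z ^ k + (z ^ k)⁻¹) =
      if z = 1 then (2 * n : ℂ) else 0 := by
  obtain ⟨n, rfl⟩ := Nat.exists_eq_succ_of_ne_zero hn.ne'
  have h0 : z ≠ 0 := by rintro rfl; simp at hz
  rw [Nat.succ_eq_add_one, Nat.add_sub_cancel] at *
  split_ifs with h
  · subst h
    simp
    ring
  · have h1 := sub_one_mul_sum_pow_add_inv h0 n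
    refine (mul_eq_zero.mp (?_ : (z - 1) * _ = 0)).resolve_left (sub_ne_zero.mpr h)
    -- After the shift of `n` the exponent in `hz` is `2n + 2`.
    have h2 : (z ^ n)⁻¹ = z ^ (n + 2) := by
      rw [inv_eq_iff_eq_inv, eq_comm]
      refine inv_eq_of_mul_eq_one_left ?_
      rw [← pow_add, ← hz]
      congr 1; ring
    rw [h2] at h1
    linear_combination h1

theorem sum_pow_add_inv_of_odd {z : ℂ} {n : ℕ} (hz : z ^ (2 * n + 1) = 1) :
    1 + ∑ k ∈ Finset.Icc 1 n, (z ^ k + (z ^ k)⁻¹) =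
      if z = 1 then (2 * n + 1 : ℂ) else 0 := by
  have h0 : z ≠ 0 := by rintro rfl; simp at hz
  split_ifs with h
  · subst h
    simp
    ring
  · have h1 := sub_one_mul_sum_pow_add_inv h0 n
    refine (mul_eq_zero.mp (?_ : (z - 1) * _ = 0)).resolve_left (sub_ne_zero.mpr h)
    have h2 : (z ^ n)⁻¹ = z ^ (n + 1) := by
      rw [inv_eq_iff_eq_inv, eq_comm]
      refine inv_eq_of_mul_eq_one_left ?_
      rw [← pow_add, ← hz]
      congr 1; ring
    rw [h1, h2, sub_self]

theorem exp_pow_add_inv (m k : ℕ) :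
    Complex.exp (2 * Real.pi * Complex.I / (2 * m : ℕ)) ^ k +
      (Complex.exp (2 * Real.pi * Complex.I / (2 * m : ℕ)) ^ k)⁻¹ =
      ((2 * Real.cos (Real.pi * k / m) : ℝ) : ℂ) := by
  have h : (k : ℂ) * (2 * Real.pi * Complex.I / (2 * m : ℕ)) =
      (Real.pi * k / m : ℂ) * Complex.I := by
    push_cast
    rw [mul_assoc 2, mul_div_mul_left _ _ two_ne_zero]
    ring
  rw [← Complex.exp_nat_mul, h, ← Complex.exp_neg]
  push_cast
  rw [Complex.cos]
  ring_nf

end RootOfUnitySums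

/-! ### Decomposition of the cell characters -/

section DihedralCharacters

variable {m : ℕ} {W : Type*} [Group W] {M : CoxeterMatrix (Fin 2)} (cs : CoxeterSystem M W)
  {i j : Fin 2} (hij : i ≠ j) (hM : M i j = 2 * m) (hm : 0 < m)

theorem signHom_walk (f : W →* ℤˣ) (a : ℤ) :
    f (walk cs i j (2 * a)) = (f (cs.simple i) * f (cs.simple j)) ^ a ∧
    f (walk cs i j (2 * a + 1)) = (f (cs.simple i) * f (cs.simple j)) ^ a * f (cs.simple i) := by
  rw [walk_two_mul, walk_two_mul_add_one]
  simp

include hij hM hm in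
theorem signHom_eq_neg_one_pow_length {f : W →* ℤˣ} (hi : f (cs.simple i) = -1)
    (hj : f (cs.simple j) = -1) (g : W) : (((f g : ℤˣ) : ℤ) : ℂ) = (-1) ^ cs.length g := by
  obtain ⟨k, rfl⟩ := walk_surjective cs hij g
  rw [neg_one_pow_length_walk cs hij hM hm]
  rcases Int.even_or_odd' k with ⟨a, rfl | rfl⟩
  · rw [(signHom_walk cs f a).1, hi, hj]; simp
  · rw [(signHom_walk cs f a).2, hi, hj]; simp

theorem intCast_neg_one_zpow (a : ℤ) : ((((-1 : ℤˣ) ^ a : ℤˣ) : ℤ) : ℂ) = (-1) ^ a := by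
  rcases Int.even_or_odd' a with ⟨b, rfl | rfl⟩
  · simp [zpow_mul]
  · simp [zpow_add₀, zpow_add, zpow_mul]

theorem zpow_pow_add_inv (ω : ℂ) (k : ℕ) (a : ℤ) :
    (ω ^ k) ^ a + (ω ^ k) ^ (-a) = (ω ^ a) ^ k + ((ω ^ a) ^ k)⁻¹ := by
  have h : (ω ^ k) ^ a = (ω ^ a) ^ k := by
    rw [← zpow_natCast, ← zpow_natCast, ← zpow_mul, ← zpow_mul, mul_comm]
  rw [zpow_neg, h]

variable {ω : ℂ} (hω : IsPrimitiveRoot ω (2 * m)) {χ : ℕ → W → ℂ}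
  (hχ₀ : ∀ k (a : ℤ), χ k (walk cs i j (2 * a)) = (ω ^ k) ^ a + (ω ^ k) ^ (-a))
  (hχ₁ : ∀ k (a : ℤ), χ k (walk cs i j (2 * a + 1)) = 0)

include hm hω in
theorem primitiveRoot_pow_half : ω ^ m = -1 := by
  have h1 : ω ^ m * ω ^ m = 1 := by rw [← sq, ← pow_mul, mul_comm, hω.pow_eq_one]
  exact (mul_self_eq_one_iff.mp h1).resolve_left
    (hω.pow_ne_one_of_pos_of_lt hm.ne' (by omega))

-- On rotations this is the even sum with `z = ω ^ a`, in which the lone term `z ^ m = (-1) ^ a` is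
-- the linear character. On reflections the `χ k` vanish and the index modulo `4` gives the sign.
include hij hM hm hω hχ₀ hχ₁ in
theorem cellChar_endCell_eq [Fintype W] {f : W →* ℤˣ} (hi : f (cs.simple i) = -1)
    (hj : f (cs.simple j) = 1) : cellChar cs (endCell cs i j m) =
      (fun g => (((f g : ℤˣ) : ℤ) : ℂ)) + ∑ k ∈ Finset.Icc 1 (m - 1), χ k := by
  funext g
  rw [Pi.add_apply, Finset.sum_apply]
  obtain ⟨k, rfl⟩ := walk_surjective cs hij g
  rcases Int.even_or_odd' k with ⟨a, rfl | rfl⟩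
  · rw [cellChar_endCell_rotation cs hij hM hm, (signHom_walk cs f a).1, hi, hj]
    simp only [hχ₀, zpow_pow_add_inv]
    have hz : (ω ^ a) ^ (2 * m) = 1 := by
      rw [← zpow_natCast, ← zpow_mul, mul_comm, zpow_mul, zpow_natCast, hω.pow_eq_one, one_zpow]
    have hz' : (ω ^ a) ^ m = (-1) ^ a := by
      rw [← zpow_natCast, ← zpow_mul, mul_comm, zpow_mul, zpow_natCast,
        primitiveRoot_pow_half hm hω]
    have h := sum_pow_add_inv_of_even hm hz
    have hone : ω ^ a = 1 ↔ (2 * m : ℤ) ∣ a := by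
      rw [hω.zpow_eq_one_iff_dvd]; push_cast; rfl
    simp only [hone] at h
    rw [← h, hz', mul_one, intCast_neg_one_zpow]
    ring
  · simp only [hχ₁, Finset.sum_const_zero, add_zero]
    rw [(signHom_walk cs f a).2, hi, hj]
    rcases Int.even_or_odd' a with ⟨b, rfl | rfl⟩
    · rw [show 2 * (2 * b) + 1 = 4 * b + 1 by ring, cellChar_endCell_reflection cs hij hM hm]
      simp [zpow_mul]
    · rw [show 2 * (2 * b + 1) + 1 = 4 * (b + 1) - 1 by ring,
        cellChar_endCell_reflection' cs hij hM hm]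
      simp [zpow_add, zpow_mul]

end DihedralCharacters

/-! ### Decomposition of `Υ` -/

section Upsilon

variable {m : ℕ} {W : Type*} [Group W] [Fintype W] {M : CoxeterMatrix (Fin 2)}
  {cs : CoxeterSystem M W} (d : Diamond cs) {i j : Fin 2} (hij : i ≠ j) (hM : M i j = 2 * m)
  (hm : 0 < m) (hd₁ : d.toMulEquiv (cs.simple i) = cs.simple j)
  (hd₂ : d.toMulEquiv (cs.simple j) = cs.simple i)
  {ω : ℂ} (hω : IsPrimitiveRoot ω (2 * m)) {χ : ℕ → W → ℂ}
  (hχ₀ : ∀ k (a : ℤ), χ k (walk cs i j (2 * a)) = (ω ^ k) ^ a + (ω ^ k) ^ (-a))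
  (hχ₁ : ∀ k (a : ℤ), χ k (walk cs i j (2 * a + 1)) = 0)

include hij hM hm hd₁ hd₂

theorem Diamond.upsilon_one_rotation (a : ℤ) :
    d.upsilon 1 (walk cs i j (2 * a)) = if (m : ℤ) ∣ a then (2 * m : ℂ) else 0 := by
  classical
  rw [d.upsilon_apply hij hM hm hd₁ hd₂ ⟨1, by simp⟩, ← walk_zero cs i j,
    walk_eq_walk_iff cs hij hM, walk_eq_walk_iff cs hij hM]
  congr 1
  rw [sub_zero, ← mul_sub, show (4 * m : ℤ) = 2 * (2 * m) by ring,
    mul_dvd_mul_iff_left two_ne_zero, mul_dvd_mul_iff_left two_ne_zero, eq_iff_iff]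
  constructor
  · rintro (⟨c, hc⟩ | ⟨c, hc⟩)
    · exact ⟨2 * c, by linarith⟩
    · exact ⟨2 * c + 1, by linarith⟩
  · rintro ⟨c, hc⟩
    rcases Int.even_or_odd' c with ⟨c, rfl | rfl⟩
    · exact .inl ⟨c, by linarith⟩
    · exact .inr ⟨c, by linarith⟩

theorem Diamond.upsilon_one_reflection (a : ℤ) : d.upsilon 1 (walk cs i j (2 * a + 1)) = 0 := by
  classical
  rw [d.upsilon_apply hij hM hm hd₁ hd₂ ⟨1, by simp⟩, ← walk_zero cs i j,
    walk_eq_walk_iff cs hij hM, walk_eq_walk_iff cs hij hM, if_neg]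
  rintro (⟨c, hc⟩ | ⟨c, hc⟩)
  · have : (1 : ℤ) = 2 * (2 * m * c - a) := by linarith
    omega
  · have : (1 : ℤ) = 2 * (2 * m * c - a + m) := by linarith
    omega

include hω hχ₀ hχ₁

/-- With `z = ω ^ (2a)` and `m = 2n`, on a rotation the four linear characters add up to `2(1 + z ^
n)`, which completes twice the even sum. For odd `m` the middle term is absent and `1 + ε` suffices.
-/
theorem Diamond.upsilon_one_of_even (hev : Even m) {f f' : W →* ℤˣ} (hi : f (cs.simple i) = 1)
    (hj : f (cs.simple j) = -1) (hi' : f' (cs.simple i) = -1) (hj' : f' (cs.simple j) = 1) :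
    d.upsilon 1 = (fun _ => 1) + (fun w => (-1) ^ cs.length w) +
      (fun g => (((f g : ℤˣ) : ℤ) : ℂ)) + (fun g => (((f' g : ℤˣ) : ℤ) : ℂ)) +
        ∑ k ∈ Finset.Icc 1 ((m - 2) / 2), (2 : ℂ) • χ (2 * k) := by
  obtain ⟨n, rfl⟩ := hev.exists_two_nsmul
  rw [smul_eq_mul] at *
  funext g
  simp only [Pi.add_apply, Finset.sum_apply, Pi.smul_apply, smul_eq_mul]
  obtain ⟨k, rfl⟩ := walk_surjective cs hij g
  rw [neg_one_pow_length_walk cs hij hM hm, show (2 * n - 2) / 2 = n - 1 by omega]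
  rcases Int.even_or_odd' k with ⟨a, rfl | rfl⟩
  · rw [d.upsilon_one_rotation hij hM hm hd₁ hd₂, (signHom_walk cs f a).1,
      (signHom_walk cs f' a).1, hi, hj, hi', hj']
    simp only [hχ₀, zpow_pow_add_inv]
    simp only [pow_mul]
    have hone : (ω ^ a) ^ 2 = 1 ↔ ((2 * n : ℕ) : ℤ) ∣ a := by
      rw [← zpow_natCast, ← zpow_mul, hω.zpow_eq_one_iff_dvd, mul_comm a]
      push_cast
      exact mul_dvd_mul_iff_left two_ne_zero
    have hz : ((ω ^ a) ^ 2) ^ (2 * n) = 1 := by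
      rw [← pow_mul, ← zpow_natCast, ← zpow_mul, mul_comm, zpow_mul, zpow_natCast, hω.pow_eq_one,
        one_zpow]
    have hz' : ((ω ^ a) ^ 2) ^ n = (-1) ^ a := by
      rw [← pow_mul, ← zpow_natCast, ← zpow_mul, mul_comm, zpow_mul, zpow_natCast,
        primitiveRoot_pow_half hm hω]
    have h := sum_pow_add_inv_of_even (by omega) hz
    simp only [hone] at h
    have h2 : (if ((2 * n : ℕ) : ℤ) ∣ a then (2 * ((2 * n : ℕ) : ℂ)) else 0) =
        2 * (if ((2 * n : ℕ) : ℤ) ∣ a then (2 * n : ℂ) else 0) := by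
      split_ifs <;> push_cast <;> ring
    rw [h2, ← h, hz', ← Finset.mul_sum, if_pos (even_two_mul a), one_mul, mul_one,
      intCast_neg_one_zpow]
    ring
  · simp only [hχ₁, mul_zero, Finset.sum_const_zero, add_zero]
    rw [d.upsilon_one_reflection hij hM hm hd₁ hd₂, (signHom_walk cs f a).2,
      (signHom_walk cs f' a).2, hi, hj, hi', hj', if_neg (by simp)]
    simp

theorem Diamond.upsilon_one_of_odd (hodd : Odd m) :
    d.upsilon 1 = (fun _ => 1) + (fun w => (-1) ^ cs.length w) +
        ∑ k ∈ Finset.Icc 1 ((m - 1) / 2), (2 : ℂ) • χ (2 * k) := by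
  obtain ⟨n, rfl⟩ := hodd
  funext g
  simp only [Pi.add_apply, Finset.sum_apply, Pi.smul_apply, smul_eq_mul]
  obtain ⟨k, rfl⟩ := walk_surjective cs hij g
  rw [neg_one_pow_length_walk cs hij hM hm, show (2 * n + 1 - 1) / 2 = n by omega]
  rcases Int.even_or_odd' k with ⟨a, rfl | rfl⟩
  · rw [d.upsilon_one_rotation hij hM hm hd₁ hd₂]
    simp only [hχ₀, zpow_pow_add_inv]
    simp only [pow_mul]
    have hone : (ω ^ a) ^ 2 = 1 ↔ ((2 * n + 1 : ℕ) : ℤ) ∣ a := by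
      rw [← zpow_natCast, ← zpow_mul, hω.zpow_eq_one_iff_dvd, mul_comm a]
      push_cast
      exact mul_dvd_mul_iff_left two_ne_zero
    have hz : ((ω ^ a) ^ 2) ^ (2 * n + 1) = 1 := by
      rw [← pow_mul, ← zpow_natCast, ← zpow_mul, mul_comm, zpow_mul, zpow_natCast, hω.pow_eq_one,
        one_zpow]
    have h := sum_pow_add_inv_of_odd hz
    simp only [hone] at h
    have h2 : (if ((2 * n + 1 : ℕ) : ℤ) ∣ a then (2 * ((2 * n + 1 : ℕ) : ℂ)) else 0) =
        2 * (if ((2 * n + 1 : ℕ) : ℤ) ∣ a then (2 * n + 1 : ℂ) else 0) := by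
      split_ifs <;> push_cast <;> ring
    rw [h2, ← h, ← Finset.mul_sum, if_pos (even_two_mul a)]
    ring
  · simp only [hχ₁, mul_zero, Finset.sum_const_zero, add_zero]
    rw [d.upsilon_one_reflection hij hM hm hd₁ hd₂, if_neg (by simp)]
    simp

end Upsilon

/-! ### The list of irreducible characters -/

section IrreducibleCharacters

variable {m : ℕ} {W : Type*} [Group W] {M : CoxeterMatrix (Fin 2)} (cs : CoxeterSystem M W)
  {i j : Fin 2} (hij : i ≠ j) (hM : M i j = 2 * m) (hm : 0 < m)

include hij hM

theorem exists_dihedralCharacters (hm : 0 < m) {ω : ℂ} (hω : IsPrimitiveRoot ω (2 * m)) :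
    ∃ χ : ℕ → W → ℂ,
      (∀ k (a : ℤ), χ k (walk cs i j (2 * a)) = (ω ^ k) ^ a + (ω ^ k) ^ (-a)) ∧
      (∀ k (a : ℤ), χ k (walk cs i j (2 * a + 1)) = 0) ∧
      ∀ k ∈ Finset.Icc 1 (m - 1), χ k ∈ irrChars W := by
  have h (k : ℕ) : ∃ ψ : W → ℂ,
      (∀ a : ℤ, ψ (walk cs i j (2 * a)) = (ω ^ k) ^ a + (ω ^ k) ^ (-a)) ∧
      (∀ a : ℤ, ψ (walk cs i j (2 * a + 1)) = 0) ∧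
      (k ∈ Finset.Icc 1 (m - 1) → ψ ∈ irrChars W) := by
    obtain ⟨ρ, h1, h2, h3⟩ := exists_dihedralRepresentation cs hij hM (ζ := ω ^ k)
      (by rw [← pow_mul, mul_comm, pow_mul, hω.pow_eq_one, one_pow]) hm
    refine ⟨ρ.character, h1, h2, fun hk => ⟨2, ρ, h3 ?_, rfl⟩⟩
    rw [Finset.mem_Icc] at hk
    rw [← pow_mul]
    exact hω.pow_ne_one_of_pos_of_lt (by omega) (by omega)
  choose χ h1 h2 h3 using h
  exact ⟨χ, h1, h2, h3⟩

variable {ω : ℂ} (hω : IsPrimitiveRoot ω (2 * m)) {χ : ℕ → W → ℂ}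
  (hχ₀ : ∀ k (a : ℤ), χ k (walk cs i j (2 * a)) = (ω ^ k) ^ a + (ω ^ k) ^ (-a))
  (hχ₁ : ∀ k (a : ℤ), χ k (walk cs i j (2 * a + 1)) = 0)
  (hχ₂ : ∀ k ∈ Finset.Icc 1 (m - 1), χ k ∈ irrChars W)
  {f f' : W →* ℤˣ} (hi : f (cs.simple i) = 1)
  (hj : f (cs.simple j) = -1) (hi' : f' (cs.simple i) = -1) (hj' : f' (cs.simple j) = 1)

include hm hω hχ₀ hχ₁ hχ₂ hi hj hi' hj'

theorem irrChars_eq : irrChars W =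
    {(fun _ => 1), (fun w => (-1) ^ cs.length w), (fun g => (((f g : ℤˣ) : ℤ) : ℂ)),
      (fun g => (((f' g : ℤˣ) : ℤ) : ℂ))} ∪ χ '' (Finset.Icc 1 (m - 1) : Set ℕ) := by
  have hext (p q : W →* ℤˣ) (h1 : p (cs.simple i) = q (cs.simple i))
      (h2 : p (cs.simple j) = q (cs.simple j)) : p = q :=
    cs.ext_simple fun b => by rcases eq_or_eq_of_ne hij b with rfl | rfl <;> assumption
  ext ψ
  constructor
  · intro hψ
    rcases irrChars_classification cs hij hM hψ with ⟨p, rfl⟩ | ⟨ζ, hζ, hζ2, h0, h1⟩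
    · left
      rcases Int.units_eq_one_or (p (cs.simple i)) with hp | hp <;>
        rcases Int.units_eq_one_or (p (cs.simple j)) with hp' | hp'
      · rw [hext p 1 (by simp [hp]) (by simp [hp'])]
        left; funext; simp
      · rw [hext p f (hp.trans hi.symm) (hp'.trans hj.symm)]
        right; right; left; rfl
      · rw [hext p f' (hp.trans hi'.symm) (hp'.trans hj'.symm)]
        right; right; right; rfl
      · right; left; funext g
        exact signHom_eq_neg_one_pow_length cs hij hM hm hp hp' g
    · right
      have : NeZero (2 * m) := ⟨by omega⟩
      obtain ⟨k, hk, rfl⟩ := hω.eq_pow_of_pow_eq_one hζ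
      have hk0 : k ≠ 0 := by rintro rfl; simp at hζ2
      have hkm : k ≠ m := by
        rintro rfl
        rw [← pow_mul, mul_comm, hω.pow_eq_one] at hζ2
        exact hζ2 rfl
      have hψχ (l : ℕ) (hl : ∀ a : ℤ, (ω ^ l) ^ a + (ω ^ l) ^ (-a) = (ω ^ k) ^ a + (ω ^ k) ^ (-a)) :
          χ l = ψ := by
        funext g
        obtain ⟨b, rfl⟩ := walk_surjective cs hij g
        rcases Int.even_or_odd' b with ⟨a, rfl | rfl⟩
        · rw [hχ₀, hl, h0]
        · rw [hχ₁, h1]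
      rcases lt_or_gt_of_ne hkm with h | h
      · exact ⟨k, by simp; omega, hψχ k fun _ => rfl⟩
      -- The exponents `k` and `2m - k` give inverse roots of unity, hence the same character; `0`
      -- and `m` were excluded by `ζ² ≠ 1`.
      · refine ⟨2 * m - k, by simp; omega, hψχ _ fun a => ?_⟩
        have hinv : ω ^ (2 * m - k) = (ω ^ k)⁻¹ := by
          refine (inv_eq_of_mul_eq_one_left ?_).symm
          rw [← pow_add, Nat.sub_add_cancel hk.le, hω.pow_eq_one]
        rw [hinv, inv_zpow', inv_zpow', neg_neg, add_comm]
  · rintro ((rfl | rfl | rfl | rfl) | ⟨k, hk, rfl⟩)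
    · simpa using linear_mem_irrChars (1 : W →* ℤˣ)
    · obtain ⟨p, hp, hp'⟩ := exists_signHom cs hij hM (-1) (-1)
      have := linear_mem_irrChars p
      simpa only [signHom_eq_neg_one_pow_length cs hij hM hm hp hp'] using this
    · exact linear_mem_irrChars f
    · exact linear_mem_irrChars f'
    · exact hχ₂ k hk

omit hij hM hm hω hχ₀ hχ₁ hχ₂ in
theorem ncard_linearCharacters : ({(fun _ => 1), (fun w => (-1) ^ cs.length w),
    (fun g => (((f g : ℤˣ) : ℤ) : ℂ)), (fun g => (((f' g : ℤˣ) : ℤ) : ℂ))} :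
      Set (W → ℂ)).ncard = 4 := by
  have hne {φ ψ : W → ℂ} (g : W) (h : φ g ≠ ψ g) : φ ≠ ψ := fun h' => h (h' ▸ rfl)
  rw [Set.ncard_insert_of_notMem, Set.ncard_insert_of_notMem, Set.ncard_pair]
  · exact hne (cs.simple i) (by simp only [hi, hi']; norm_num)
  · rw [Set.mem_insert_iff, Set.mem_singleton_iff, not_or]
    exact ⟨hne (cs.simple i) (by simp only [hi, cs.length_simple]; norm_num),
      hne (cs.simple j) (by simp only [hj', cs.length_simple]; norm_num)⟩
  · rw [Set.mem_insert_iff, Set.mem_insert_iff, Set.mem_singleton_iff, not_or, not_or]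
    exact ⟨hne (cs.simple i) (by simp only [cs.length_simple]; norm_num),
      hne (cs.simple j) (by simp only [hj]; norm_num),
      hne (cs.simple i) (by simp only [hi']; norm_num)⟩

end IrreducibleCharacters

theorem cos_pi_mul_div_injOn {m : ℕ} (hm : 0 < m) {k l : ℕ} (hk : k ≤ m) (hl : l ≤ m)
    (h : 2 * Real.cos (Real.pi * k / m) = 2 * Real.cos (Real.pi * l / m)) : k = l := by
  have hm' : (0 : ℝ) < m := by exact_mod_cast hm
  have hmem {k : ℕ} (hk : k ≤ m) : Real.pi * k / m ∈ Set.Icc 0 Real.pi := by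
    have : (k : ℝ) ≤ m := by exact_mod_cast hk
    refine ⟨by positivity, ?_⟩
    rw [div_le_iff₀ hm']
    exact mul_le_mul_of_nonneg_left this Real.pi_pos.le
  have h' := Real.injOn_cos (hmem hk) (hmem hl) (by linarith)
  have hpi := Real.pi_ne_zero
  field_simp at h'
  exact_mod_cast h'

end

end TwistedInv

/-! ### The theorem -/

open TwistedInv in
theorem mainTheorem12 (m : ℕ) (hm : 2 ≤ m) {W : Type*} [Group W] [Fintype W]
    {M : CoxeterMatrix (Fin 2)} (hM : M 0 1 = 2 * m) (cs : CoxeterSystem M W)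
    (d : Diamond cs)
    (hd₁ : d.toMulEquiv (cs.simple 0) = cs.simple 1)
    (hd₂ : d.toMulEquiv (cs.simple 1) = cs.simple 0) :
    -- `1_{2m} = 2_{2m}` is the longest element
    (word1 cs (2 * m) = word2 cs (2 * m) ∧
      ∀ w, cs.length w ≤ cs.length (word1 cs (2 * m))) ∧
    -- up to `⋄`-conjugacy, `1` is the only `⋄`-twisted involution
    (d.IsTwistedInvolution 1 ∧ ∀ w, d.IsTwistedInvolution w → d.Conj 1 w) ∧
    -- the `⋄`-centraliser of `1`, and the character `ε_w` for `w = 1`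
    ((d.centralizer 1 : Set W) = {x | d.toMulEquiv x = x} ∧
      (d.centralizer 1 : Set W) = {1, word1 cs (2 * m)} ∧
      d.twistedRoots 1 = ∅ ∧ (∀ x, d.sign 1 x = 1) ∧
      d.upsilon 1 = induced (d.centralizer 1) (fun _ => 1)) ∧
    -- the left cells, and their intersections with the class of `1`
    ({Γ | IsLeftCell cs Γ} = {{1}, cell1 cs m, cell2 cs m, {word1 cs (2 * m)}} ∧
      {Γ | IsLeftCell cs Γ}.ncard = 4 ∧
      (d.conjClass 1 ∩ {1}).ncard = 1 ∧
      (d.conjClass 1 ∩ cell1 cs m).ncard = m - 1 ∧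
      (d.conjClass 1 ∩ cell2 cs m).ncard = m - 1 ∧
      (d.conjClass 1 ∩ {word1 cs (2 * m)}).ncard = 1) ∧
    -- the irreducible characters, and the decompositions
    (∃ (ε₁ ε₂ : W → ℂ) (χ : ℕ → W → ℂ),
      (ε₁ 1 = 1 ∧ ε₁ (cs.simple 0) = 1 ∧ ε₁ (cs.simple 1) = -1) ∧
      (ε₂ 1 = 1 ∧ ε₂ (cs.simple 0) = -1 ∧ ε₂ (cs.simple 1) = 1) ∧
      (∀ j ∈ Finset.Icc 1 (m - 1), χ j 1 = 2 ∧
        χ j (word1 cs 2) = ((2 * Real.cos (Real.pi * j / m) : ℝ) : ℂ) ∧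
        ∀ ψ ∈ irrChars W, ψ 1 = 2 →
          ψ (word1 cs 2) = ((2 * Real.cos (Real.pi * j / m) : ℝ) : ℂ) → ψ = χ j) ∧
      irrChars W = {(fun _ => 1), (fun w => (-1) ^ cs.length w), ε₁, ε₂} ∪
        χ '' (Finset.Icc 1 (m - 1) : Set ℕ) ∧
      (irrChars W).ncard = m + 3 ∧
      (Even m → d.upsilon 1 = (fun _ => 1) + (fun w => (-1) ^ cs.length w) + ε₁ + ε₂ +
        ∑ j ∈ Finset.Icc 1 ((m - 2) / 2), (2 : ℂ) • χ (2 * j)) ∧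
      (Odd m → d.upsilon 1 = (fun _ => 1) + (fun w => (-1) ^ cs.length w) +
        ∑ j ∈ Finset.Icc 1 ((m - 1) / 2), (2 : ℂ) • χ (2 * j)) ∧
      cellChar cs {1} = (fun _ => 1) ∧
      cellChar cs (cell1 cs m) = ε₂ + ∑ j ∈ Finset.Icc 1 (m - 1), χ j ∧
      cellChar cs (cell2 cs m) = ε₁ + ∑ j ∈ Finset.Icc 1 (m - 1), χ j ∧
      cellChar cs {word1 cs (2 * m)} = (fun w => (-1) ^ cs.length w)) ∧
    -- the scalar products, and Kottwitz' conjecture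
    (classInner (d.upsilon 1) (cellChar cs {1}) = 1 ∧
      classInner (d.upsilon 1) (cellChar cs (cell1 cs m)) = (m : ℂ) - 1 ∧
      classInner (d.upsilon 1) (cellChar cs (cell2 cs m)) = (m : ℂ) - 1 ∧
      classInner (d.upsilon 1) (cellChar cs {word1 cs (2 * m)}) = 1) ∧
    KottwitzConjecture cs d := by
  have hij : (0 : Fin 2) ≠ 1 := by decide
  have hm0 : 0 < m := by omega
  have hM' : M 1 0 = 2 * m := by rw [M.symmetric, hM]
  have hone : d.Conj 1 1 := ⟨1, by simp⟩
  have hlong : word1 cs (2 * m) = walk cs 0 1 (2 * m) := by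
    rw [word1, altProd_eq_walk]; push_cast; rfl
  have hlen : cs.length (word1 cs (2 * m)) = 2 * m := length_altProd cs hij hM le_rfl
  have hmem := d.mem_centralizer_iff hij hM hd₁ hd₂ hone
  have htwist := d.isTwistedInvolution_iff hij hM hd₁ hd₂
  have hcell (Γ : Set W) : IsLeftCell cs Γ ↔
      Γ = {1} ∨ Γ = cell1 cs m ∨ Γ = cell2 cs m ∨ Γ = {word1 cs (2 * m)} :=
    isLeftCell_iff cs hij hM hm0 Γ
  have hclass : d.conjClass 1 = {w | ∃ a : ℤ, w = walk cs 0 1 (2 * a)} := by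
    ext w; exact d.conj_one_iff hij hd₁ hd₂ w
  have hclass' : d.conjClass 1 = {w | ∃ a : ℤ, w = walk cs 1 0 (2 * a)} := by
    ext w; exact d.conj_one_iff hij.symm hd₂ hd₁ w
  have hncard₀ : (d.conjClass 1 ∩ {1}).ncard = 1 := by
    rw [Set.inter_singleton_of_mem (show (1 : W) ∈ d.conjClass 1 from hone), Set.ncard_singleton]
  have hncard₁ : (d.conjClass 1 ∩ cell1 cs m).ncard = m - 1 := by
    rw [hclass]; exact ncard_rotations_inter_endCell cs hij hM hm0
  have hncard₂ : (d.conjClass 1 ∩ cell2 cs m).ncard = m - 1 := by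
    rw [hclass']; exact ncard_rotations_inter_endCell cs hij.symm hM' hm0
  have hncard₃ : (d.conjClass 1 ∩ {word1 cs (2 * m)}).ncard = 1 := by
    rw [Set.inter_singleton_of_mem, Set.ncard_singleton]
    rw [hclass, hlong]; exact ⟨m, rfl⟩
  have hchar₀ : cellChar cs {1} = fun _ => 1 := cellChar_one cs hij hM hm0
  have hchar₃ : cellChar cs {word1 cs (2 * m)} = fun w => (-1) ^ cs.length w :=
    cellChar_longest cs hij hM hm0
  have hinner (w : W) (hw : d.Conj 1 w) :
      classInner (d.upsilon w) (cellChar cs {1}) = 1 ∧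
      classInner (d.upsilon w) (cellChar cs (cell1 cs m)) = (m : ℂ) - 1 ∧
      classInner (d.upsilon w) (cellChar cs (cell2 cs m)) = (m : ℂ) - 1 ∧
      classInner (d.upsilon w) (cellChar cs {word1 cs (2 * m)}) = 1 := by
    -- Only the values at `1` and `w₀` enter the scalar product; their average is `m - 1`.
    have hval {i j : Fin 2} (hij : i ≠ j) (hM : M i j = 2 * m) :
        cellChar cs (endCell cs i j m) 1 = 2 * m - 1 ∧
          cellChar cs (endCell cs i j m) (walk cs i j (2 * m)) = -1 := by
      have h1 := cellChar_endCell_rotation cs hij hM hm0 0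
      have h2 := cellChar_endCell_rotation cs hij hM hm0 m
      rw [mul_zero, walk_zero, if_pos (dvd_zero _)] at h1
      rw [if_neg, zero_sub] at h2
      · exact ⟨h1, h2⟩
      · intro h
        have := Int.le_of_dvd (by omega) h
        omega
    have hlong' : walk cs 0 1 (2 * m) = walk cs 1 0 (2 * m) := by
      rw [walk_swap cs 0 1, walk_eq_walk_iff cs hij hM]
      exact ⟨1, by ring⟩
    have h1 := hval hij hM
    have h2 := hval hij.symm hM'
    rw [← hlong'] at h2
    refine ⟨?_, ?_, ?_, ?_⟩
    · rw [d.classInner_upsilon hij hM hm0 hd₁ hd₂ hw, hchar₀]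
      norm_num
    · change classInner _ (cellChar cs (endCell cs 0 1 m)) = _
      rw [d.classInner_upsilon hij hM hm0 hd₁ hd₂ hw, h1.1, h1.2, map_sub, map_mul, map_natCast,
        map_ofNat, map_neg, map_one]
      ring
    · change classInner _ (cellChar cs (endCell cs 1 0 m)) = _
      rw [d.classInner_upsilon hij hM hm0 hd₁ hd₂ hw, h2.1, h2.2, map_sub, map_mul, map_natCast,
        map_ofNat, map_neg, map_one]
      ring
    · rw [d.classInner_upsilon hij hM hm0 hd₁ hd₂ hw, hchar₃, ← hlong]
      simp [hlen, cs.length_one]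
  refine ⟨⟨altProd_longest cs hij hM, fun w => ?_⟩, ⟨(htwist 1).mpr hone, fun w => (htwist w).mp⟩,
    ⟨?_, ?_, d.twistedRoots_one hij hM hm0 hd₁, d.sign_eq_one hij hM hm0 hd₁ hone,
      d.upsilon_eq_induced hij hM hm0 hd₁ hd₂ hone⟩,
    ⟨?_, ncard_leftCells cs hij hM hm0, hncard₀, hncard₁, hncard₂, hncard₃⟩, ?_, hinner 1 hone, ?_⟩
  · rw [hlen]; exact (exists_altProd cs hij hM hm0 w).1
  · ext x
    change d.toMulEquiv x * 1 = 1 * x ↔ d.toMulEquiv x = x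
    rw [mul_one, one_mul]
  · ext x
    rw [SetLike.mem_coe, hmem, hlong]; rfl
  · ext Γ
    exact hcell Γ
  · have hω := Complex.isPrimitiveRoot_exp (2 * m) (by omega)
    set ω := Complex.exp (2 * Real.pi * Complex.I / (2 * m : ℕ)) with hωdef
    obtain ⟨f, hf0, hf1⟩ := exists_signHom cs hij hM 1 (-1)
    obtain ⟨f', hf0', hf1'⟩ := exists_signHom cs hij hM (-1) 1
    obtain ⟨χ, hχ₀, hχ₁, hχ₂⟩ := exists_dihedralCharacters cs hij hM hm0 hω
    have hirr := irrChars_eq cs hij hM hm0 hω hχ₀ hχ₁ hχ₂ hf0 hf1 hf0' hf1'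
    have hχ_one (k : ℕ) : χ k 1 = 2 := by
      have := hχ₀ k 0
      rw [mul_zero, walk_zero] at this
      rw [this]; norm_num
    have hχ_two (k : ℕ) : χ k (word1 cs 2) = ((2 * Real.cos (Real.pi * k / m) : ℝ) : ℂ) := by
      have h := hχ₀ k 1
      have h2 : word1 cs 2 = walk cs 0 1 (2 * 1) := altProd_eq_walk cs 0 1 2
      rw [h2, h, zpow_neg, zpow_one, exp_pow_add_inv]
    have hχ_inj {k l : ℕ} (hk : k ∈ Finset.Icc 1 (m - 1)) (hl : l ∈ Finset.Icc 1 (m - 1))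
        (h : 2 * Real.cos (Real.pi * k / m) = 2 * Real.cos (Real.pi * l / m)) : k = l := by
      rw [Finset.mem_Icc] at hk hl
      exact cos_pi_mul_div_injOn hm0 (by omega) (by omega) h
    have hlin {ψ : W → ℂ} (hψ : ψ ∈ ({(fun _ => 1), (fun w => (-1) ^ cs.length w),
        (fun g => (((f g : ℤˣ) : ℤ) : ℂ)), (fun g => (((f' g : ℤˣ) : ℤ) : ℂ))} :
          Set (W → ℂ))) : ψ 1 = 1 := by
      rcases hψ with rfl | rfl | rfl | rfl <;> simp
    -- The second large cell comes from exchanging the generators. This inverts the rotations, under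
    -- which the values of `χ k` are symmetric.
    have hswap₀ (k : ℕ) (a : ℤ) : χ k (walk cs 1 0 (2 * a)) = (ω ^ k) ^ a + (ω ^ k) ^ (-a) := by
      rw [walk_swap cs 0 1, ← mul_neg, hχ₀, neg_neg, add_comm]
    have hswap₁ (k : ℕ) (a : ℤ) : χ k (walk cs 1 0 (2 * a + 1)) = 0 := by
      rw [walk_swap cs 0 1, show -(2 * a + 1) = 2 * (-a - 1) + 1 by ring, hχ₁]
    refine ⟨fun g => (((f g : ℤˣ) : ℤ) : ℂ), fun g => (((f' g : ℤˣ) : ℤ) : ℂ), χ,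
      ⟨by simp, by simp [hf0], by simp [hf1]⟩, ⟨by simp, by simp [hf0'], by simp [hf1']⟩,
      fun k hk => ⟨hχ_one k, hχ_two k, fun ψ hψ h1 h2 => ?_⟩, hirr, ?_,
      fun h => d.upsilon_one_of_even hij hM hm0 hd₁ hd₂ hω hχ₀ hχ₁ h hf0 hf1 hf0' hf1',
      fun h => d.upsilon_one_of_odd hij hM hm0 hd₁ hd₂ hω hχ₀ hχ₁ h, hchar₀,
      cellChar_endCell_eq cs hij hM hm0 hω hχ₀ hχ₁ hf0' hf1',
      cellChar_endCell_eq cs hij.symm hM' hm0 hω hswap₀ hswap₁ hf1 hf0, hchar₃⟩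
    · rw [hirr] at hψ
      rcases hψ with hψ | ⟨l, hl, rfl⟩
      · rw [hlin hψ] at h1
        norm_num at h1
      · rw [hχ_two, Complex.ofReal_inj] at h2
        rw [hχ_inj hl hk h2]
    · rw [hirr, Set.ncard_union_eq, ncard_linearCharacters cs hf0 hf1 hf0' hf1',
        Set.InjOn.ncard_image, Set.ncard_coe_finset, Nat.card_Icc]
      · omega
      · intro k hk l hl h
        refine hχ_inj hk hl ?_
        rw [← Complex.ofReal_inj, ← hχ_two, ← hχ_two, h]
      · rw [Set.disjoint_left]
        rintro ψ hψ ⟨k, -, rfl⟩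
        have := hlin hψ
        rw [hχ_one] at this
        norm_num at this
  · intro w hw Γ hΓ
    have hw' := (htwist w).mp hw
    obtain ⟨h0, h1, h2, h3⟩ := hinner w hw'
    -- The class of `w` is the class of `1`, and `hinner` already covers `Υ_w` for every `w` in it.
    rw [d.conjClass_eq hw']
    rcases (hcell Γ).mp hΓ with rfl | rfl | rfl | rfl
    · rw [h0, hncard₀, Nat.cast_one]
    · rw [h1, hncard₁, Nat.cast_sub (by omega), Nat.cast_one]
    · rw [h2, hncard₂, Nat.cast_sub (by omega), Nat.cast_one]
    · rw [h3, hncard₃, Nat.cast_one]
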